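/- Let $d\ge 1$, $\eta>0$ and $k>d+2$. For $a<b$ write $Q(a,b)=(a,b)\times\mathbb R^d$. There is a constant $C>0$, depending only on $\eta$, $d$ and $k$, such that the following holds. Let $Q=(q_{ij})_{i,j=1}^d$ be a matrix of functions $q_{ij}\in C^{\varsigma}_{\mathrm{loc}}(\mathbb R^d)\cap C_b(\mathbb R^d)$, for some $\varsigma\in(0,1]$ (bounded, and $\varsigma$-Hölder continuous on every compact set), such that $q_{ij}=q_{ji}$ for all $i,j$ and $\langle Q(x)\xi,\xi\rangle\ge\eta|\xi|^2$ for all $x,\xi\in\mathbb R^d$. Let $0\le a_0<b_0\le 1$, $f\in L^{k/2}(Q(a_0,b_0))$ and $h\in L^k(Q(a_0,b_0);\mathbb R^d)$. Let $p\in(d+2,\infty)$ and $$u\in\mathcal H^{p,1}(Q(a_0,b_0))\cap L^\infty(a_0,b_0;L^2(\mathbb R^d))$$ be such that $u(a_0)=0$ and $$\int_{Q(a_0,b_0)}\big[\langle Q\nabla u,\nabla\psi\rangle+\psi\,\partial_t u\big]\,dt\,dx=\int_{Q(a_0,b_0)}f\psi\,dt\,dx+\int_{Q(a_0,b_0)}\langle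 h,\nabla\psi\rangle\,dt\,dx\qquad\text{for all }\psi\in C_c^\infty(Q(a_0,b_0)).$$ Then $u$ is (essentially) bounded on $Q(a_0,b_0)$ and $$\|u\|_\infty\le C\big(\|u\|_2+\|f\|_{k/2}+\|h\|_k\big),$$ where the norms are those of the Lebesgue spaces over $Q(a_0,b_0)$. In particular, $C$ does not depend on $\|Q\|_\infty$. Here $\nabla$ is the gradient in the space variable; $W^{0,1}_q(Q(a,b))$ is the space of all $v\in L^q(Q(a,b))$ with weak space derivatives $D_iv\in L^q(Q(a,b))$, normed by the sum of these $L^q$ norms; $\mathcal H^{p,1}(Q(a,b))$ is the space of all $u\in W^{0,1}_p(Q(a,b))$ whose distributional time derivative $\partial_t u$ belongs to the dual space $(W^{0,1}_{p'}(Q(a,b)))'$, $1/p+1/p'=1$; the integral $\int\psi\,\partial_tu\,dt\,dx$ is the duality pairing of $\partial_tu$ with $\psi$; and $u(a_0)=0$ means that the initial trace of $u$ vanishes, i.e. $\int_{\mathbb R^d}u(t,x)\varphi(x)\,dx\to0$ as $t\downarrow a_0$ (outside a null set of times) for every $\varphi\in C_c^\infty(\mathbb R^d)$. -/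

import Mathlib

open MeasureTheory Filter Topology Set
open scoped ENNReal NNReal Distributions

noncomputable section

namespace ParabolicRegularity

/-- The Euclidean space `ℝ^d`. -/
abbrev Space (d : ℕ) : Type := EuclideanSpace ℝ (Fin d)

/-- The open strip `Q(a, b) = (a, b) × ℝ^d`. -/
def strip (d : ℕ) (a b : ℝ) : TopologicalSpace.Opens (ℝ × Space d) :=
  ⟨Ioo a b ×ˢ univ, isOpen_Ioo.prod isOpen_univ⟩

/-- Lebesgue measure on `Q(a, b)`. -/
def stripMeasure (d : ℕ) (a b : ℝ) : Measure (ℝ × Space d) :=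
  volume.restrict (strip d a b : Set (ℝ × Space d))

/-- The (classical) time derivative. -/
def timeDeriv {d : ℕ} (ψ : ℝ × Space d → ℝ) (z : ℝ × Space d) : ℝ :=
  fderiv ℝ ψ z (1, 0)

/-- The (classical) space derivative `D_i`. -/
def spaceDeriv {d : ℕ} (i : Fin d) (ψ : ℝ × Space d → ℝ) (z : ℝ × Space d) : ℝ :=
  fderiv ℝ ψ z (0, EuclideanSpace.single i 1)

/-- The (classical) space gradient `∇ = (D_1, …, D_d)`. -/
def spaceGrad {d : ℕ} (ψ : ℝ × Space d → ℝ) (z : ℝ × Space d) : Space d :=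
  WithLp.toLp 2 fun i => spaceDeriv i ψ z

/-- `⟨A v, w⟩` for a square matrix `A`. -/
def form {d : ℕ} (A : Matrix (Fin d) (Fin d) ℝ) (v w : Space d) : ℝ :=
  ∑ i, ∑ j, A i j * v j * w i

/-- `g` is the weak space gradient of `v` on `Q(a, b)`
(used for `v` and `g` that are locally integrable there). -/
def IsWeakSpaceGrad {d : ℕ} (a b : ℝ) (v : ℝ × Space d → ℝ) (g : ℝ × Space d → Space d) : Prop :=
  ∀ (ψ : 𝓓(strip d a b, ℝ)) (i : Fin d),
    ∫ z, v z * spaceDeriv i ψ z ∂stripMeasure d a b = -∫ z, g z i * ψ z ∂stripMeasure d a b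

lemma continuous_fderiv_testFunction {d : ℕ} {a b : ℝ} (ψ : 𝓓(strip d a b, ℝ)) :
    Continuous (fderiv ℝ ψ) :=
  ψ.contDiff.continuous_fderiv (by simp)

lemma continuous_spaceDeriv {d : ℕ} {a b : ℝ} (i : Fin d) (ψ : 𝓓(strip d a b, ℝ)) :
    Continuous (spaceDeriv i ψ) :=
  (continuous_fderiv_testFunction ψ).clm_apply continuous_const

lemma hasCompactSupport_spaceDeriv {d : ℕ} {a b : ℝ} (i : Fin d) (ψ : 𝓓(strip d a b, ℝ)) :
    HasCompactSupport (spaceDeriv i ψ) :=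
  (ψ.hasCompactSupport.fderiv (𝕜 := ℝ)).comp_left
    (g := fun L : (ℝ × Space d) →L[ℝ] ℝ => L (0, EuclideanSpace.single i 1)) rfl

lemma continuous_spaceGrad {d : ℕ} {a b : ℝ} (ψ : 𝓓(strip d a b, ℝ)) :
    Continuous (spaceGrad ψ) :=
  (PiLp.continuous_toLp 2 _).comp (continuous_pi fun i => continuous_spaceDeriv i ψ)

lemma hasCompactSupport_spaceGrad {d : ℕ} {a b : ℝ} (ψ : 𝓓(strip d a b, ℝ)) :
    HasCompactSupport (spaceGrad ψ) :=
  (ψ.hasCompactSupport.fderiv (𝕜 := ℝ)).comp_left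
    (g := fun L : (ℝ × Space d) →L[ℝ] ℝ =>
      (WithLp.toLp 2 fun i => L (0, EuclideanSpace.single i 1) : Space d)) (by ext i; simp)

instance (d : ℕ) (a b : ℝ) : IsFiniteMeasureOnCompacts (stripMeasure d a b) := by
  unfold stripMeasure; infer_instance

lemma memLp_testFunction {d : ℕ} {a b : ℝ} (q : ℝ≥0∞) (ψ : 𝓓(strip d a b, ℝ)) :
    MemLp ψ q (stripMeasure d a b) :=
  ψ.continuous.memLp_of_hasCompactSupport ψ.hasCompactSupport

lemma memLp_spaceDeriv {d : ℕ} {a b : ℝ} (q : ℝ≥0∞) (i : Fin d) (ψ : 𝓓(strip d a b, ℝ)) :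
    MemLp (spaceDeriv i ψ) q (stripMeasure d a b) :=
  (continuous_spaceDeriv i ψ).memLp_of_hasCompactSupport (hasCompactSupport_spaceDeriv i ψ)

lemma memLp_spaceGrad {d : ℕ} {a b : ℝ} (q : ℝ≥0∞) (ψ : 𝓓(strip d a b, ℝ)) :
    MemLp (spaceGrad ψ) q (stripMeasure d a b) :=
  (continuous_spaceGrad ψ).memLp_of_hasCompactSupport (hasCompactSupport_spaceGrad ψ)

lemma memLp_coord {d : ℕ} {q : ℝ≥0∞} {μ : Measure (ℝ × Space d)} {g : ℝ × Space d → Space d}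
    (hg : MemLp g q μ) (i : Fin d) : MemLp (fun z => g z i) q μ :=
  hg.continuousLinearMap_comp (EuclideanSpace.proj (𝕜 := ℝ) i)

lemma integrable_mul_of_conj {d : ℕ} {q : ℝ≥0∞} [Fact (1 ≤ q)] {μ : Measure (ℝ × Space d)}
    {v w : ℝ × Space d → ℝ} (hv : MemLp v q μ) (hw : MemLp w (ENNReal.conjExponent q) μ) :
    Integrable (fun z => v z * w z) μ :=
  hv.integrable_mul hw

/-- A test function on `Q(a, b)` has its classical space gradient as weak space gradient. -/
lemma isWeakSpaceGrad_testFunction {d : ℕ} {a b : ℝ} (φ : 𝓓(strip d a b, ℝ)) :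
    IsWeakSpaceGrad a b φ (spaceGrad φ) := by
  intro ψ i
  have hφ := φ.continuous
  have hψ := ψ.continuous
  have h1 : ∀ w : ℝ × Space d → ℝ,
      ∫ z, φ z * w z ∂stripMeasure d a b = ∫ z, φ z * w z := by
    intro w
    refine setIntegral_eq_integral_of_forall_compl_eq_zero fun z hz => ?_
    rw [image_eq_zero_of_notMem_tsupport fun h => hz (φ.tsupport_subset h), zero_mul]
  have h2 : ∀ w : ℝ × Space d → ℝ,
      ∫ z, w z * ψ z ∂stripMeasure d a b = ∫ z, w z * ψ z := by
    intro w
    refine setIntegral_eq_integral_of_forall_compl_eq_zero fun z hz => ?_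
    rw [image_eq_zero_of_notMem_tsupport fun h => hz (ψ.tsupport_subset h), mul_zero]
  rw [h1, h2]
  have hint : ∀ w w' : ℝ × Space d → ℝ, Continuous w → Continuous w' → HasCompactSupport w' →
      Integrable (fun z => w z * w' z) (volume : Measure (ℝ × Space d)) :=
    fun w w' hw hw' hs => (hw.mul hw').integrable_of_hasCompactSupport hs.mul_left
  have : (volume : Measure (ℝ × Space d)).IsAddHaarMeasure := by
    rw [Measure.volume_eq_prod]; infer_instance
  exact integral_mul_fderiv_eq_neg_fderiv_mul_of_integrable
    (hint _ _ (continuous_spaceDeriv i φ) hψ ψ.hasCompactSupport)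
    (hint _ _ hφ (continuous_spaceDeriv i ψ) (hasCompactSupport_spaceDeriv i ψ))
    (hint _ _ hφ hψ ψ.hasCompactSupport)
    (fun z _ => φ.contDiff.differentiable (by simp) z)
    (fun z _ => ψ.contDiff.differentiable (by simp) z)

/-- The parabolic Sobolev space `W_q^{0,1}(Q(a, b))` of all `v ∈ L^q` with weak space gradient in
`L^q`. An element is recorded as the pair `(v, ∇v)`; its norm, `max ‖v‖_q ‖∇v‖_q`, is equivalent
to the sum of the `L^q` norms of `v` and of the `D_i v`. -/
def W01 (d : ℕ) (q : ℝ≥0∞) [Fact (1 ≤ q)] (a b : ℝ) :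
    Submodule ℝ (Lp ℝ q (stripMeasure d a b) × Lp (Space d) q (stripMeasure d a b)) where
  carrier := {v | IsWeakSpaceGrad a b v.1 v.2}
  zero_mem' := by
    intro ψ i
    have h1 : ∫ z, (0 : Lp ℝ q (stripMeasure d a b)) z * spaceDeriv i ψ z ∂stripMeasure d a b
        = 0 := by
      refine integral_eq_zero_of_ae ?_
      filter_upwards [Lp.coeFn_zero ℝ q (stripMeasure d a b)] with z hz
      rw [hz, Pi.zero_apply, zero_mul]
    have h2 : ∫ z, (0 : Lp (Space d) q (stripMeasure d a b)) z i * ψ z ∂stripMeasure d a b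
        = 0 := by
      refine integral_eq_zero_of_ae ?_
      filter_upwards [Lp.coeFn_zero (Space d) q (stripMeasure d a b)] with z hz
      rw [hz]; simp
    change ∫ z, (0 : Lp ℝ q (stripMeasure d a b)) z * spaceDeriv i ψ z ∂stripMeasure d a b
      = -∫ z, (0 : Lp (Space d) q (stripMeasure d a b)) z i * ψ z ∂stripMeasure d a b
    rw [h1, h2, neg_zero]
  add_mem' := by
    intro v w hv hw ψ i
    have h1 : ∫ z, (v + w).1 z * spaceDeriv i ψ z ∂stripMeasure d a b
        = ∫ z, v.1 z * spaceDeriv i ψ z ∂stripMeasure d a b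
          + ∫ z, w.1 z * spaceDeriv i ψ z ∂stripMeasure d a b := by
      rw [← integral_add (integrable_mul_of_conj (Lp.memLp v.1) (memLp_spaceDeriv _ i ψ))
        (integrable_mul_of_conj (Lp.memLp w.1) (memLp_spaceDeriv _ i ψ))]
      refine integral_congr_ae ?_
      filter_upwards [Lp.coeFn_add v.1 w.1] with z hz
      rw [Prod.fst_add, hz, Pi.add_apply, add_mul]
    have h2 : ∫ z, (v + w).2 z i * ψ z ∂stripMeasure d a b
        = ∫ z, v.2 z i * ψ z ∂stripMeasure d a b
          + ∫ z, w.2 z i * ψ z ∂stripMeasure d a b := by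
      rw [← integral_add
        (integrable_mul_of_conj (memLp_coord (Lp.memLp v.2) i) (memLp_testFunction _ ψ))
        (integrable_mul_of_conj (memLp_coord (Lp.memLp w.2) i) (memLp_testFunction _ ψ))]
      refine integral_congr_ae ?_
      filter_upwards [Lp.coeFn_add v.2 w.2] with z hz
      rw [Prod.snd_add, hz, Pi.add_apply, PiLp.add_apply, add_mul]
    rw [h1, h2, hv ψ i, hw ψ i, neg_add]
  smul_mem' := by
    intro c v hv ψ i
    have h1 : ∫ z, (c • v).1 z * spaceDeriv i ψ z ∂stripMeasure d a b
        = c * ∫ z, v.1 z * spaceDeriv i ψ z ∂stripMeasure d a b := by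
      rw [← integral_const_mul]
      refine integral_congr_ae ?_
      filter_upwards [Lp.coeFn_smul c v.1] with z hz
      rw [Prod.smul_fst, hz, Pi.smul_apply, smul_eq_mul, mul_assoc]
    have h2 : ∫ z, (c • v).2 z i * ψ z ∂stripMeasure d a b
        = c * ∫ z, v.2 z i * ψ z ∂stripMeasure d a b := by
      rw [← integral_const_mul]
      refine integral_congr_ae ?_
      filter_upwards [Lp.coeFn_smul c v.2] with z hz
      rw [Prod.smul_snd, hz, Pi.smul_apply, PiLp.smul_apply, smul_eq_mul, mul_assoc]
    rw [h1, h2, hv ψ i, mul_neg]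

/-- A test function as an element of `W_q^{0,1}(Q(a, b))`. -/
def testToW01 {d : ℕ} (q : ℝ≥0∞) [Fact (1 ≤ q)] {a b : ℝ} (ψ : 𝓓(strip d a b, ℝ)) :
    W01 d q a b :=
  ⟨((memLp_testFunction q ψ).toLp ψ, (memLp_spaceGrad q ψ).toLp (spaceGrad ψ)), by
    intro φ i
    have h1 : ∫ z, (memLp_testFunction q ψ).toLp ψ z * spaceDeriv i φ z ∂stripMeasure d a b
        = ∫ z, ψ z * spaceDeriv i φ z ∂stripMeasure d a b := by
      refine integral_congr_ae ?_
      filter_upwards [(memLp_testFunction q ψ).coeFn_toLp] with z hz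
      rw [hz]
    have h2 : ∫ z, (memLp_spaceGrad q ψ).toLp (spaceGrad ψ) z i * φ z ∂stripMeasure d a b
        = ∫ z, spaceGrad ψ z i * φ z ∂stripMeasure d a b := by
      refine integral_congr_ae ?_
      filter_upwards [(memLp_spaceGrad q ψ).coeFn_toLp] with z hz
      rw [hz]
    change ∫ z, (memLp_testFunction q ψ).toLp ψ z * spaceDeriv i φ z ∂stripMeasure d a b
      = -∫ z, (memLp_spaceGrad q ψ).toLp (spaceGrad ψ) z i * φ z ∂stripMeasure d a b
    rw [h1, h2]
    exact isWeakSpaceGrad_testFunction ψ φ i⟩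

instance (p : ℝ≥0∞) : Fact (1 ≤ ENNReal.conjExponent p) := ⟨by
  unfold ENNReal.conjExponent; exact le_self_add⟩

/-- The dual space `(W_{p'}^{0,1}(Q(a, b)))'`, where `1/p + 1/p' = 1`. -/
abbrev DualW01 (d : ℕ) (p : ℝ≥0∞) (a b : ℝ) : Type :=
  StrongDual ℝ (W01 d (ENNReal.conjExponent p) a b)

/-- `u ∈ ℋ^{p,1}(Q(a, b))` with weak space gradient `g = ∇u` and time derivative `T = ∂ₜu`:
`u` and `g` are in `L^p(Q(a, b))` and `T ∈ (W_{p'}^{0,1}(Q(a, b)))'` is the distributional time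
derivative of `u`. Both `g` (up to null sets) and `T` are determined by `u`. -/
structure MemH (d : ℕ) (p : ℝ≥0∞) (a b : ℝ) (u : ℝ × Space d → ℝ)
    (g : ℝ × Space d → Space d) (T : DualW01 d p a b) : Prop where
  memLp : MemLp u p (stripMeasure d a b)
  memLp_grad : MemLp g p (stripMeasure d a b)
  isWeakSpaceGrad : IsWeakSpaceGrad a b u g
  timeDeriv_eq : ∀ ψ : 𝓓(strip d a b, ℝ),
    T (testToW01 (ENNReal.conjExponent p) ψ) = -∫ z, u z * timeDeriv ψ z ∂stripMeasure d a b

/-- `u ∈ L^∞(a, b; L²(ℝ^d))`. -/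
def MemLinfL2 (d : ℕ) (a b : ℝ) (u : ℝ × Space d → ℝ) : Prop :=
  AEStronglyMeasurable u (stripMeasure d a b) ∧
    essSup (fun t => eLpNorm (fun x => u (t, x)) 2 volume) (volume.restrict (Ioo a b)) < ∞

/-- `u(a) = 0`: the trace of `u` at the initial time `a` vanishes, that is
`∫ u(t, x) φ(x) dx → 0` for all `φ ∈ C_c^∞(ℝ^d)` as `t ↓ a` outside a null set of times (an
essential limit, since `u` is determined up to null sets only). -/
def InitialZero (d : ℕ) (a : ℝ) (u : ℝ × Space d → ℝ) : Prop :=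
  ∀ φ : 𝓓((⊤ : TopologicalSpace.Opens (Space d)), ℝ),
    Tendsto (fun t => ∫ x, u (t, x) * φ x) (𝓝[>] a ⊓ ae volume) (𝓝 0)

/-- `q ∈ C^ς_loc(ℝ^d)`: `ς`-Hölder continuous on every compact set. -/
def LocHolder (d : ℕ) (ς : ℝ≥0) (q : Space d → ℝ) : Prop :=
  ∀ K : Set (Space d), IsCompact K → ∃ L : ℝ≥0, HolderOnWith L ς q K

/-- The diffusion coefficients: symmetric, entries in `C^ς_loc(ℝ^d) ∩ C_b(ℝ^d)`, and uniformly
elliptic with constant `η`. -/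
structure IsDiffusion (d : ℕ) (η : ℝ) (ς : ℝ≥0)
    (Q : Space d → Matrix (Fin d) (Fin d) ℝ) : Prop where
  locHolder : ∀ i j, LocHolder d ς fun x => Q x i j
  continuous : ∀ i j, Continuous fun x => Q x i j
  bounded : ∀ i j, ∃ M : ℝ, ∀ x, |Q x i j| ≤ M
  symm : ∀ x i j, Q x i j = Q x j i
  elliptic : ∀ x ξ, η * ‖ξ‖ ^ 2 ≤ form (Q x) ξ ξ

/-- The weak equation `∂ₜu - div(Q∇u) = f - div h` on `Q(a, b)`: for all `ψ ∈ C_c^∞(Q(a, b))`,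
`∫ [⟨Q∇u, ∇ψ⟩ + ψ ∂ₜu] = ∫ f ψ + ∫ ⟨h, ∇ψ⟩`, where `g = ∇u`, `T = ∂ₜu`, and `∫ ψ ∂ₜu` is the
duality pairing of `∂ₜu` with `ψ`. -/
def IsWeakSolution (d : ℕ) (p : ℝ≥0∞) (a b : ℝ) (Q : Space d → Matrix (Fin d) (Fin d) ℝ)
    (f : ℝ × Space d → ℝ) (h g : ℝ × Space d → Space d) (T : DualW01 d p a b) : Prop :=
  ∀ ψ : 𝓓(strip d a b, ℝ),
    ∫ z, form (Q z.2) (g z) (spaceGrad ψ z) ∂stripMeasure d a b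
        + T (testToW01 (ENNReal.conjExponent p) ψ)
      = ∫ z, f z * ψ z ∂stripMeasure d a b
        + ∫ z, inner ℝ (h z) (spaceGrad ψ z) ∂stripMeasure d a b

end ParabolicRegularity

end

open ParabolicRegularity

/-!
The bound is obtained by De Giorgi's iteration, arranged so that the diffusion matrix enters only
through its ellipticity constant `η`.

*Extension by zero.* Since the initial trace of `u` vanishes, `u`, its gradient `g`, the flux
`G = Q g` and the data can be extended by zero to `ℝ × ℝ^d`, and the extension solves
`∂ₜu = div (G - h) + f` on `(-∞, b) × ℝ^d`. Inserting a time cutoff into a test function produces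
the boundary term `∫ u ψ χ'`, which tends to zero by the initial condition and the bound in
`L^∞(L²)`. This is `exists_isGlobalSolution`; after this step only `⟨G, g⟩ ≥ η |g|²` is known about
`Q`.

*Energy.* Let `S` be a smooth bounded nondecreasing function that vanishes near zero, and `Φ` its
primitive. The equation is tested with `S(u)` times a cutoff in time, but with no cutoff in space:
because `u ∈ L²` and `S` vanishes near zero, `S(u)` and `S'(u)` belong to every `L^q` with `q < ∞`,
which makes every product integrable. The identity holds for mollifications and passes to the limit
(`energy_identity`). By Young's inequality both `∫ Φ(u(t, x)) dx`, for almost every `t`, and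
`(η / 2) ∫ S'(u) |g|²` are at most `∫ S(u) |f| + (1 / 2η) ∫ S'(u) |h|²`
(`IsGlobalSolution.ae_integral_primitive_le`, `IsGlobalSolution.integral_grad_le`). A cutoff in
space would have brought in `‖Q‖_∞`.

*One step.* Let `a(ℓ)` be the measure of `{u > ℓ}`, and let `K` bound `‖f‖_{k/2}` and `‖h‖_k`. For
the ramp from `0` at `ℓ` to `δ ≤ K` at `ℓ + δ`, Hölder's inequality bounds the energy by
`c K² a(ℓ)^{1 - 2/k}`. By Chebyshev's inequality almost every time slice of `{u > ℓ + δ}` has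
measure at most a multiple of `(K / δ)² a(ℓ)^{1 - 2/k}`. Let `w` be the ramp of `u` at the level
`ℓ + δ`. On a ball of radius `ρ` with twice that measure, for every point at least half of the
translations lead outside `{w ≠ 0}`, so `‖w‖₂² ≤ 2 sup_{|y| < ρ} ‖w - w(· - y)‖₂²`, and the latter
is at most a multiple of `ρ²` times the energy (`lintegral_sq_le_of_translate`,
`eLpNorm_sub_translate_le`). As `ρ^d` is proportional to the measure of the slices, this gives
`a(ℓ + 2δ) ≤ C (K / δ)^{2 + 4/d} a(ℓ)^{(1 - 2/k)(1 + 2/d)}` (`IsGlobalSolution.deGiorgi_step`).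

*Iteration.* The exponent `(1 - 2/k)(1 + 2/d)` exceeds `1` exactly when `k > d + 2`. Hence the
recursion along the levels `K (2 - 2^{-j})` converges to zero if `a(K) ≤ (‖u‖₂ / K)²` is small,
which holds for `K = M ‖u‖₂ + ‖f‖_{k/2} + ‖h‖_k` with a large `M` depending only on `η`, `d` and
`k`; thus `u ≤ 2K` (`exists_ae_le_two_mul`). The same applies to `-u`.
-/

set_option linter.unusedSectionVars false

open scoped Convolution

noncomputable section

/-! ### Young's inequality for convolutions -/

section Convolution

variable {E : Type*} [NormedAddCommGroup E] [NormedSpace ℝ E] [FiniteDimensional ℝ E]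
  [MeasurableSpace E] [BorelSpace E] {μ : Measure E} [μ.IsAddHaarMeasure]

/-- Young's inequality `‖ρ ⋆ v‖_q ≤ ‖ρ‖₁ ‖v‖_q`, by Jensen's inequality for the finite measure
`|ρ| dy` and Tonelli's theorem. -/
theorem eLpNorm_convolution_le {ρ v : E → ℝ} {q : ℝ≥0∞} (hq1 : 1 ≤ q) (hqt : q ≠ ∞)
    (hρ : Continuous ρ) (hv : AEStronglyMeasurable v μ) :
    eLpNorm (ρ ⋆[ContinuousLinearMap.lsmul ℝ ℝ, μ] v) q μ
      ≤ (∫⁻ y, ‖ρ y‖ₑ ∂μ) * eLpNorm v q μ := by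
  obtain ⟨w, hw, hvw⟩ := hv
  rw [convolution_congr _ (ae_eq_refl ρ) hvw, eLpNorm_congr_ae hvw]
  have hwm : Measurable w := hw.measurable
  have hq0 : q ≠ 0 := (zero_lt_one.trans_le hq1).ne'
  have hr : 1 ≤ q.toReal := by
    rw [← ENNReal.toReal_one]; exact ENNReal.toReal_mono hqt hq1
  have hr0 : 0 < q.toReal := by linarith
  set r := q.toReal with hrdef
  set ν : Measure E := μ.withDensity fun y => ‖ρ y‖ₑ with hν
  set M : ℝ≥0∞ := ∫⁻ y, ‖ρ y‖ₑ ∂μ with hM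
  have hMν : ν univ = M := by simp [hν, hM]
  have hρm : Measurable fun y => ‖ρ y‖ₑ := hρ.enorm.measurable
  have key : ∀ x, ‖(ρ ⋆[ContinuousLinearMap.lsmul ℝ ℝ, μ] w) x‖ₑ ^ r
      ≤ M ^ (r - 1) * ∫⁻ y, ‖w (x - y)‖ₑ ^ r ∂ν := by
    intro x
    have h1 : ‖(ρ ⋆[ContinuousLinearMap.lsmul ℝ ℝ, μ] w) x‖ₑ
        ≤ eLpNorm (fun y => w (x - y)) 1 ν := by
      rw [eLpNorm_one_eq_lintegral_enorm, hν,
        lintegral_withDensity_eq_lintegral_mul _ hρm (by fun_prop), convolution]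
      refine (enorm_integral_le_lintegral_enorm _).trans (le_of_eq ?_)
      simp [enorm_mul]
    have h2 : eLpNorm (fun y => w (x - y)) 1 ν
        ≤ eLpNorm (fun y => w (x - y)) q ν * M ^ (1 - 1 / r) := by
      have := eLpNorm_le_eLpNorm_mul_rpow_measure_univ (μ := ν) (f := fun y => w (x - y)) hq1
        (Measurable.aestronglyMeasurable (by fun_prop))
      simpa [hMν] using this
    calc _ ≤ (eLpNorm (fun y => w (x - y)) q ν * M ^ (1 - 1 / r)) ^ r := by
          gcongr; exact h1.trans h2
      _ = _ := by
          rw [ENNReal.mul_rpow_of_nonneg _ _ hr0.le, eLpNorm_eq_lintegral_rpow_enorm_toReal hq0 hqt,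
            ← ENNReal.rpow_mul, ← ENNReal.rpow_mul, mul_comm]
          congr 2
          · field_simp
          · rw [← hrdef]; field_simp; simp
  have hswap : ∫⁻ x, ∫⁻ y, ‖w (x - y)‖ₑ ^ r ∂ν ∂μ = M * ∫⁻ x, ‖w x‖ₑ ^ r ∂μ := by
    rw [lintegral_lintegral_swap (Measurable.aemeasurable (by fun_prop))]
    have : ∀ y, ∫⁻ x, ‖w (x - y)‖ₑ ^ r ∂μ = ∫⁻ x, ‖w x‖ₑ ^ r ∂μ := fun y =>
      lintegral_sub_right_eq_self (fun x => ‖w x‖ₑ ^ r) y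
    simp_rw [this]
    rw [lintegral_const, hMν, mul_comm]
  rw [eLpNorm_eq_lintegral_rpow_enorm_toReal hq0 hqt,
    eLpNorm_eq_lintegral_rpow_enorm_toReal hq0 hqt, ← hrdef]
  calc _ ≤ (∫⁻ x, M ^ (r - 1) * ∫⁻ y, ‖w (x - y)‖ₑ ^ r ∂ν ∂μ) ^ (1 / r) := by
        gcongr with x; exact key x
    _ = (M ^ r * ∫⁻ x, ‖w x‖ₑ ^ r ∂μ) ^ (1 / r) := by
        rw [lintegral_const_mul _ (by fun_prop), hswap, ← mul_assoc]
        congr 2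
        have := ENNReal.rpow_add_of_nonneg (x := M) (r - 1) 1 (by linarith) zero_le_one
        rw [ENNReal.rpow_one] at this
        rw [← this]; simp
    _ = _ := by
        rw [ENNReal.mul_rpow_of_nonneg _ _ (by positivity), ← ENNReal.rpow_mul]
        field_simp
        simp

theorem memLp_convolution {ρ v : E → ℝ} {q : ℝ≥0∞} (hq1 : 1 ≤ q) (hqt : q ≠ ∞)
    (hρ : Continuous ρ) (hc : HasCompactSupport ρ) (hv : MemLp v q μ) :
    MemLp (ρ ⋆[ContinuousLinearMap.lsmul ℝ ℝ, μ] v) q μ := by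
  refine ⟨?_, (eLpNorm_convolution_le hq1 hqt hρ hv.1).trans_lt (ENNReal.mul_lt_top ?_ hv.2)⟩
  · exact (hc.continuous_convolution_left _ hρ (hv.locallyIntegrable hq1)).aestronglyMeasurable
  · exact (hρ.integrable_of_hasCompactSupport hc).2

end Convolution

/-! ### Mollification -/

section Mollifier

variable {E : Type*} [NormedAddCommGroup E] [NormedSpace ℝ E] [FiniteDimensional ℝ E]
  [MeasurableSpace E] [BorelSpace E]

/-- A bump function at the origin supported in the ball of radius `2 / (n + 1)`. -/
def shrinkingBump (E : Type*) [NormedAddCommGroup E] [NormedSpace ℝ E] (n : ℕ) :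
    ContDiffBump (0 : E) where
  rIn := 1 / (n + 1)
  rOut := 2 / (n + 1)
  rIn_pos := by positivity
  rIn_lt_rOut := by gcongr; norm_num

lemma tendsto_rOut_shrinkingBump :
    Tendsto (fun n => (shrinkingBump E n).rOut) atTop (𝓝 0) := by
  have := (tendsto_one_div_add_atTop_nhds_zero_nat (𝕜 := ℝ)).const_mul 2
  simpa [shrinkingBump, div_eq_mul_inv] using this

/-- The standard mollifier on `E`, of integral `1`. -/
def mollifier (μ : Measure E) (n : ℕ) : E → ℝ := (shrinkingBump E n).normed μ

/-- The mollification `ρ_n ⋆ v`. -/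
def mollify (μ : Measure E) (n : ℕ) (v : E → ℝ) : E → ℝ :=
  mollifier μ n ⋆[ContinuousLinearMap.lsmul ℝ ℝ, μ] v

variable {μ : Measure E} [μ.IsAddHaarMeasure]

lemma contDiff_mollifier (n : ℕ) : ContDiff ℝ (⊤ : ℕ∞) (mollifier μ n) :=
  (shrinkingBump E n).contDiff_normed

lemma hasCompactSupport_mollifier (n : ℕ) : HasCompactSupport (mollifier μ n) :=
  (shrinkingBump E n).hasCompactSupport_normed

lemma mollifier_nonneg (n : ℕ) (x : E) : 0 ≤ mollifier μ n x :=
  (shrinkingBump E n).nonneg_normed x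

lemma integral_mollifier (n : ℕ) : ∫ x, mollifier μ n x ∂μ = 1 :=
  (shrinkingBump E n).integral_normed

lemma lintegral_mollifier (n : ℕ) : ∫⁻ x, ‖mollifier μ n x‖ₑ ∂μ = 1 := by
  have h := (contDiff_mollifier (μ := μ) n).continuous.integrable_of_hasCompactSupport
    (μ := μ) (hasCompactSupport_mollifier n)
  rw [← ofReal_integral_norm_eq_lintegral_enorm h]
  simp [Real.norm_of_nonneg (mollifier_nonneg n _), integral_mollifier]

lemma contDiff_mollify {v : E → ℝ} (n : ℕ) (hv : LocallyIntegrable v μ) :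
    ContDiff ℝ (⊤ : ℕ∞) (mollify μ n v) :=
  (hasCompactSupport_mollifier n).contDiff_convolution_left _ (contDiff_mollifier n) hv

lemma memLp_mollify {v : E → ℝ} {q : ℝ≥0∞} (hq1 : 1 ≤ q) (hqt : q ≠ ∞) (n : ℕ)
    (hv : MemLp v q μ) : MemLp (mollify μ n v) q μ :=
  memLp_convolution hq1 hqt (contDiff_mollifier n).continuous (hasCompactSupport_mollifier n) hv

lemma eLpNorm_mollify_le {v : E → ℝ} {q : ℝ≥0∞} (hq1 : 1 ≤ q) (hqt : q ≠ ∞) (n : ℕ)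
    (hv : AEStronglyMeasurable v μ) : eLpNorm (mollify μ n v) q μ ≤ eLpNorm v q μ := by
  have := eLpNorm_convolution_le hq1 hqt (contDiff_mollifier (μ := μ) n).continuous hv
  rwa [lintegral_mollifier, one_mul] at this

lemma mollify_sub {v w : E → ℝ} (n : ℕ) (hv : LocallyIntegrable v μ)
    (hw : LocallyIntegrable w μ) :
    mollify μ n (v - w) = mollify μ n v - mollify μ n w := by
  have h : ∀ {f : E → ℝ}, LocallyIntegrable f μ →
      ConvolutionExists (mollifier μ n) f (ContinuousLinearMap.lsmul ℝ ℝ) μ := fun hf =>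
    (hasCompactSupport_mollifier n).convolutionExists_left _ (contDiff_mollifier n).continuous hf
  have h2 := (h hv).distrib_add (h hw.neg)
  rw [mollify, sub_eq_add_neg, h2]
  ext x
  simp [mollify, convolution, integral_neg, sub_eq_add_neg]

/-- The partial derivatives of `ρ_n ⋆ v` are the convolutions with those of `ρ_n`. -/
lemma fderiv_mollify {v : E → ℝ} (n : ℕ) (hv : LocallyIntegrable v μ) (x e : E) :
    fderiv ℝ (mollify μ n v) x e
      = ((fun y => fderiv ℝ (mollifier μ n) y e)
          ⋆[ContinuousLinearMap.lsmul ℝ ℝ, μ] v) x := by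
  have hc := hasCompactSupport_mollifier (μ := μ) n
  have hd := contDiff_mollifier (μ := μ) n
  have h := hc.hasFDerivAt_convolution_left (ContinuousLinearMap.lsmul ℝ ℝ)
    (hd.of_le (by exact_mod_cast le_top)) hv x
  rw [mollify, h.fderiv, convolution, convolution, ContinuousLinearMap.integral_apply]
  · rfl
  · exact (hc.fderiv ℝ).convolutionExists_left _
      (hd.continuous_fderiv (by simp)) hv x

lemma memLp_fderiv_mollify {v : E → ℝ} {q : ℝ≥0∞} (hq1 : 1 ≤ q) (hqt : q ≠ ∞) (n : ℕ)
    (hv : MemLp v q μ) (e : E) : MemLp (fun x => fderiv ℝ (mollify μ n v) x e) q μ := by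
  have hc := hasCompactSupport_mollifier (μ := μ) n
  have hd := contDiff_mollifier (μ := μ) n
  simp_rw [fderiv_mollify n (hv.locallyIntegrable hq1)]
  refine memLp_convolution hq1 hqt ?_ ?_ hv
  · exact (hd.continuous_fderiv (by simp)).clm_apply continuous_const
  · exact (hc.fderiv (𝕜 := ℝ)).comp_left (g := fun L : E →L[ℝ] ℝ => L e) rfl

lemma mollify_apply {v : E → ℝ} (n : ℕ) (x : E) :
    mollify μ n v x = ∫ y, v y * mollifier μ n (x - y) ∂μ := by
  rw [mollify, convolution_eq_swap]
  simp [mul_comm]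

lemma fderiv_mollifier_const_sub (n : ℕ) (x y e : E) :
    fderiv ℝ (fun y => mollifier μ n (x - y)) y e = -fderiv ℝ (mollifier μ n) (x - y) e := by
  have h1 : HasFDerivAt (fun y => x - y) (-ContinuousLinearMap.id ℝ E) y :=
    (hasFDerivAt_id y).const_sub x
  have h2 : HasFDerivAt (mollifier μ n) (fderiv ℝ (mollifier μ n) (x - y)) (x - y) :=
    ((contDiff_mollifier n).differentiable (by simp) _).hasFDerivAt
  have := h2.comp y h1
  simp only [Function.comp_def] at this
  rw [this.fderiv]; simp

/-- Differentiating `ρ_n ⋆ v` at `x` amounts to testing `v` with `-ρ_n(x - ·)`. -/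
lemma fderiv_mollify_eq_neg_integral {v : E → ℝ} (n : ℕ) (hv : LocallyIntegrable v μ) (x e : E) :
    fderiv ℝ (mollify μ n v) x e
      = -∫ y, v y * fderiv ℝ (fun y => mollifier μ n (x - y)) y e ∂μ := by
  rw [fderiv_mollify n hv, convolution_eq_swap, ← integral_neg]
  refine integral_congr_ae (Eventually.of_forall fun y => ?_)
  simp only [fderiv_mollifier_const_sub]
  simp [mul_comm]

lemma contDiff_mollifier_const_sub (n : ℕ) (x : E) :
    ContDiff ℝ (⊤ : ℕ∞) fun y => mollifier μ n (x - y) :=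
  (contDiff_mollifier n).comp (contDiff_const.sub contDiff_id)

lemma hasCompactSupport_mollifier_const_sub (n : ℕ) (x : E) :
    HasCompactSupport fun y => mollifier μ n (x - y) :=
  (hasCompactSupport_mollifier n).comp_homeomorph (Homeomorph.subLeft x)

lemma tsupport_mollifier_const_sub_subset (n : ℕ) (x : E) :
    tsupport (fun y => mollifier μ n (x - y))
      ⊆ Metric.closedBall x (shrinkingBump E n).rOut := by
  refine closure_minimal (fun y hy => ?_) Metric.isClosed_closedBall
  have : x - y ∈ Function.support (mollifier μ n) := hy
  rw [mollifier, ContDiffBump.support_normed_eq] at this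
  rw [Metric.mem_ball, dist_zero_right] at this
  rw [Metric.mem_closedBall, dist_comm, dist_eq_norm]
  exact this.le

theorem ae_tendsto_mollify {v : E → ℝ} (hv : LocallyIntegrable v μ) :
    ∀ᵐ x ∂μ, Tendsto (fun n => mollify μ n v x) atTop (𝓝 (v x)) :=
  ContDiffBump.ae_convolution_tendsto_right_of_locallyIntegrable (K := 2)
    tendsto_rOut_shrinkingBump
    (Eventually.of_forall fun n => by simp [shrinkingBump, div_eq_mul_inv]) hv

/-- Mollifications of a continuous function with compact support converge in `L^q`: they converge
uniformly, with supports in a common compact set. -/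
lemma tendsto_eLpNorm_mollify_sub_of_continuous {v : E → ℝ} {q : ℝ≥0∞}
    (hv : Continuous v) (hc : HasCompactSupport v) :
    Tendsto (fun n => eLpNorm (mollify μ n v - v) q μ) atTop (𝓝 0) := by
  by_cases hq0 : q = 0
  · simp [hq0]
  have hK : IsCompact (Metric.cthickening 2 (tsupport v)) :=
    IsCompact.cthickening hc
  set K := Metric.cthickening 2 (tsupport v) with hKdef
  have hsupp : ∀ n x, x ∉ K → (mollify μ n v - v) x = 0 := by
    intro n x hx
    have h1 : v x = 0 := by
      refine image_eq_zero_of_notMem_tsupport fun h => hx (Metric.self_subset_cthickening _ h)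
    have h2 : mollify μ n v x = 0 := by
      rw [mollify_apply]
      refine integral_eq_zero_of_ae (Eventually.of_forall fun y => ?_)
      by_contra hne
      have hy : y ∈ tsupport v := by
        by_contra hy
        simp [image_eq_zero_of_notMem_tsupport hy] at hne
      have hy2 : mollifier μ n (x - y) ≠ 0 := by
        intro h0; simp [h0] at hne
      have := tsupport_mollifier_const_sub_subset (μ := μ) n x (subset_tsupport _ hy2)
      rw [Metric.mem_closedBall] at this
      refine hx (Metric.mem_cthickening_of_dist_le x y _ _ hy ?_)
      rw [dist_comm]
      refine this.trans ?_
      simp only [shrinkingBump]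
      rw [div_le_iff₀ (by positivity)]
      have : (0:ℝ) ≤ n := by positivity
      linarith
    simp [h1, h2]
  have huc := hc.uniformContinuous_of_continuous hv
  rw [ENNReal.tendsto_atTop_zero]
  intro ε hε
  have hμK : (μ K) ^ (1 / q.toReal) ≠ ∞ :=
    ENNReal.rpow_ne_top_of_nonneg (by positivity) hK.measure_lt_top.ne
  obtain ⟨c, hc0, hcε⟩ : ∃ c : ℝ≥0, 0 < c ∧ (μ K) ^ (1 / q.toReal) * c ≤ ε := by
    rcases eq_or_ne ε ∞ with rfl | hεt
    · exact ⟨1, one_pos, le_top⟩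
    have hpos : 0 < ε / ((μ K) ^ (1 / q.toReal) + 1) :=
      ENNReal.div_pos hε.ne' (ENNReal.add_ne_top.2 ⟨hμK, by simp⟩)
    obtain ⟨c, hc0, hc⟩ := ENNReal.lt_iff_exists_nnreal_btwn.1 hpos
    refine ⟨c, by exact_mod_cast hc0, ?_⟩
    calc _ ≤ ((μ K) ^ (1 / q.toReal) + 1) * (ε / ((μ K) ^ (1 / q.toReal) + 1)) := by
          gcongr; exact le_self_add
      _ ≤ ε := ENNReal.mul_div_le
  obtain ⟨δ, hδ, hδ2⟩ := Metric.uniformContinuous_iff.1 huc c (by exact_mod_cast hc0)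
  obtain ⟨N, hN⟩ := eventually_atTop.1
    ((tendsto_rOut_shrinkingBump (E := E)).eventually (gt_mem_nhds hδ))
  refine ⟨N, fun n hn => ?_⟩
  have hb : ∀ x, ‖(mollify μ n v - v) x‖ ≤ c := by
    intro x
    have := (shrinkingBump E n).dist_normed_convolution_le (μ := μ) (x₀ := x) (ε := c)
      hv.aestronglyMeasurable (fun y hy => (hδ2 ((Metric.mem_ball.1 hy).trans (hN n hn))).le)
    rwa [dist_eq_norm] at this
  have : mollify μ n v - v = K.indicator (mollify μ n v - v) := by
    ext x
    by_cases hx : x ∈ K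
    · simp [hx]
    · rw [hsupp n x hx, indicator_of_notMem hx]
  rw [this, eLpNorm_indicator_eq_eLpNorm_restrict hK.measurableSet]
  refine (eLpNorm_le_of_ae_bound (C := c) (Eventually.of_forall hb)).trans ?_
  simpa using hcε

theorem tendsto_eLpNorm_mollify_sub {v : E → ℝ} {q : ℝ≥0∞} (hq1 : 1 ≤ q) (hqt : q ≠ ∞)
    (hv : MemLp v q μ) :
    Tendsto (fun n => eLpNorm (mollify μ n v - v) q μ) atTop (𝓝 0) := by
  rw [ENNReal.tendsto_nhds_zero]
  intro ε hε
  have hε3 : ε / 3 ≠ 0 := (ENNReal.div_pos hε.ne' (by simp)).ne'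
  obtain ⟨w, hwc, hvw, hw, hwL⟩ := hv.exists_hasCompactSupport_eLpNorm_sub_le hqt hε3
  have h1 := (ENNReal.tendsto_nhds_zero.1
    (tendsto_eLpNorm_mollify_sub_of_continuous (μ := μ) (q := q) hw hwc)) (ε / 3) hε3.bot_lt
  filter_upwards [h1] with n hn
  have hdec : mollify μ n v - v = mollify μ n (v - w) + ((mollify μ n w - w) - (v - w)) := by
    rw [mollify_sub n (hv.locallyIntegrable hq1) (hwL.locallyIntegrable hq1)]
    ring
  have hvwL := hv.sub hwL
  have hwn := (memLp_mollify hq1 hqt n hwL).sub hwL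
  rw [hdec]
  calc _ ≤ eLpNorm (mollify μ n (v - w)) q μ + eLpNorm ((mollify μ n w - w) - (v - w)) q μ :=
        eLpNorm_add_le (memLp_mollify hq1 hqt n hvwL).1 (hwn.sub hvwL).1 hq1
    _ ≤ ε / 3 + (ε / 3 + ε / 3) := by
        gcongr
        · exact (eLpNorm_mollify_le hq1 hqt n hvwL.1).trans hvw
        · exact (eLpNorm_sub_le hwn.1 hvwL.1 hq1).trans (add_le_add hn hvw)
    _ = ε := by rw [← add_assoc, ENNReal.add_thirds]

end Mollifier

/-! ### Convergence in `L^q` -/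

section LpConvergence

variable {α : Type*} [MeasurableSpace α] {μ : Measure α}

/-- Convergence `v n → w` in `L^q(μ)`, including that all functions belong to `L^q(μ)`. -/
structure TendstoLp (q : ℝ≥0∞) (μ : Measure α) (v : ℕ → α → ℝ) (w : α → ℝ) : Prop where
  memLp : MemLp w q μ
  memLp_seq : ∀ n, MemLp (v n) q μ
  tendsto : Tendsto (fun n => eLpNorm (v n - w) q μ) atTop (𝓝 0)

lemma TendstoLp.const {q : ℝ≥0∞} {w : α → ℝ} (hw : MemLp w q μ) :
    TendstoLp q μ (fun _ => w) w :=
  ⟨hw, fun _ => hw, by simp⟩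

/-- Hölder: multiplication is continuous `L^p × L^q → L^r` for `1/p + 1/q = 1/r`. -/
lemma TendstoLp.mul {p q r : ℝ≥0∞} [ENNReal.HolderTriple p q r] (hr : 1 ≤ r)
    {v v' : ℕ → α → ℝ} {w w' : α → ℝ} (h : TendstoLp p μ v w) (h' : TendstoLp q μ v' w') :
    TendstoLp r μ (fun n x => v n x * v' n x) (fun x => w x * w' x) := by
  have hm : ∀ {a b : α → ℝ}, MemLp a p μ → MemLp b q μ → MemLp (a • b) r μ :=
    fun ha hb => hb.smul ha
  refine ⟨hm h.memLp h'.memLp, fun n => hm (h.memLp_seq n) (h'.memLp_seq n), ?_⟩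
  have hle : ∀ {a b : α → ℝ}, MemLp a p μ → MemLp b q μ →
      eLpNorm (a • b) r μ ≤ eLpNorm a p μ * eLpNorm b q μ :=
    fun ha hb => eLpNorm_smul_le_mul_eLpNorm hb.1 ha.1
  have h0 : Tendsto (fun n => eLpNorm (v n - w) p μ * eLpNorm (v' n - w') q μ
      + eLpNorm (v n - w) p μ * eLpNorm w' q μ
      + eLpNorm w p μ * eLpNorm (v' n - w') q μ) atTop (𝓝 0) := by
    have e1 := ENNReal.Tendsto.mul h.tendsto (Or.inr ENNReal.zero_ne_top) h'.tendsto
      (Or.inr ENNReal.zero_ne_top)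
    have e2 := ENNReal.Tendsto.mul_const (b := eLpNorm w' q μ) h.tendsto (Or.inr h'.memLp.2.ne)
    have e3 := ENNReal.Tendsto.const_mul (a := eLpNorm w p μ) h'.tendsto (Or.inr h.memLp.2.ne)
    simpa using (e1.add e2).add e3
  refine tendsto_of_tendsto_of_tendsto_of_le_of_le tendsto_const_nhds h0 (fun _ => zero_le) ?_
  intro n
  have hv := (h.memLp_seq n).sub h.memLp
  have hv' := (h'.memLp_seq n).sub h'.memLp
  have hdec : (fun x => v n x * v' n x) - (fun x => w x * w' x)
      = (v n - w) • (v' n - w') + (v n - w) • w' + w • (v' n - w') := by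
    ext x; simp; ring
  change eLpNorm ((fun x => v n x * v' n x) - (fun x => w x * w' x)) r μ ≤ _
  rw [hdec]
  refine (eLpNorm_add_le ((hm hv hv').add (hm hv h'.memLp)).1 (hm h.memLp hv').1 hr).trans ?_
  refine add_le_add ((eLpNorm_add_le (hm hv hv').1 (hm hv h'.memLp).1 hr).trans ?_) (hle h.memLp hv')
  exact add_le_add (hle hv hv') (hle hv h'.memLp)

lemma TendstoLp.tendsto_integral {v : ℕ → α → ℝ} {w : α → ℝ} (h : TendstoLp 1 μ v w) :
    Tendsto (fun n => ∫ x, v n x ∂μ) atTop (𝓝 (∫ x, w x ∂μ)) :=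
  tendsto_integral_of_L1' _ h.memLp.1
    (Eventually.of_forall fun n => memLp_one_iff_integrable.1 (h.memLp_seq n)) h.tendsto

/-- A bounded integrable function is in every `L^q`, with
`‖f‖_q ≤ B^(1 - 1/q) ‖f‖_1^(1/q)`. -/
lemma eLpNorm_le_of_bound_of_one {f : α → ℝ} {B : ℝ≥0} (hB : ∀ x, ‖f x‖ₑ ≤ B) {q : ℝ≥0∞}
    (hq1 : 1 ≤ q) (hqt : q ≠ ∞) :
    eLpNorm f q μ ≤ ((B : ℝ≥0∞) ^ (q.toReal - 1) * eLpNorm f 1 μ) ^ (1 / q.toReal) := by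
  have hq0 : q ≠ 0 := (zero_lt_one.trans_le hq1).ne'
  have hr : 1 ≤ q.toReal := by
    rw [← ENNReal.toReal_one]; exact ENNReal.toReal_mono hqt hq1
  rw [eLpNorm_eq_lintegral_rpow_enorm_toReal hq0 hqt, eLpNorm_one_eq_lintegral_enorm,
    ← lintegral_const_mul' _ _ (ENNReal.rpow_ne_top_of_nonneg (by linarith) ENNReal.coe_ne_top)]
  gcongr with x
  have := ENNReal.rpow_add_of_nonneg (x := ‖f x‖ₑ) (q.toReal - 1) 1 (by linarith) zero_le_one
  rw [sub_add_cancel, ENNReal.rpow_one] at this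
  rw [this]
  gcongr
  exact hB x

lemma memLp_of_bound_of_one {f : α → ℝ} {B : ℝ} (hB : ∀ x, |f x| ≤ B) (hf : MemLp f 1 μ)
    {q : ℝ≥0∞} (hq1 : 1 ≤ q) (hqt : q ≠ ∞) : MemLp f q μ := by
  have hr : 1 ≤ q.toReal := by
    rw [← ENNReal.toReal_one]; exact ENNReal.toReal_mono hqt hq1
  have hB' : ∀ x, ‖f x‖ₑ ≤ (B.toNNReal : ℝ≥0∞) := fun x => by
    rw [← ofReal_norm]; exact ENNReal.ofReal_le_ofReal (hB x)
  refine ⟨hf.1, (eLpNorm_le_of_bound_of_one hB' hq1 hqt).trans_lt ?_⟩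
  refine ENNReal.rpow_lt_top_of_nonneg (by positivity) (ENNReal.mul_ne_top ?_ hf.2.ne)
  exact ENNReal.rpow_ne_top_of_nonneg (by linarith) ENNReal.coe_ne_top

/-- `L¹` convergence of uniformly bounded functions improves to `L^q` for every `q < ∞`. -/
lemma TendstoLp.of_bound_of_one {v : ℕ → α → ℝ} {w : α → ℝ} {B : ℝ} (h : TendstoLp 1 μ v w)
    (hv : ∀ n x, |v n x| ≤ B) (hw : ∀ x, |w x| ≤ B) {q : ℝ≥0∞} (hq1 : 1 ≤ q) (hqt : q ≠ ∞) :
    TendstoLp q μ v w := by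
  have hr : 1 ≤ q.toReal := by
    rw [← ENNReal.toReal_one]; exact ENNReal.toReal_mono hqt hq1
  refine ⟨memLp_of_bound_of_one hw h.memLp hq1 hqt,
    fun n => memLp_of_bound_of_one (hv n) (h.memLp_seq n) hq1 hqt, ?_⟩
  have hB' : ∀ n x, ‖(v n - w) x‖ₑ ≤ ((2 * B).toNNReal : ℝ≥0∞) := fun n x => by
    rw [← ofReal_norm]
    refine ENNReal.ofReal_le_ofReal ?_
    rw [Pi.sub_apply, Real.norm_eq_abs, two_mul]
    exact (abs_sub _ _).trans (add_le_add (hv n x) (hw x))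
  have hlim : Tendsto (fun n => ((((2 * B).toNNReal : ℝ≥0∞)) ^ (q.toReal - 1)
      * eLpNorm (v n - w) 1 μ) ^ (1 / q.toReal)) atTop (𝓝 0) := by
    have h1 := ENNReal.Tendsto.const_mul (a := (((2 * B).toNNReal : ℝ≥0∞)) ^ (q.toReal - 1))
      h.tendsto (Or.inr (ENNReal.rpow_ne_top_of_nonneg (by linarith) ENNReal.coe_ne_top))
    rw [mul_zero] at h1
    have h2 := h1.ennrpow_const (1 / q.toReal)
    rwa [ENNReal.zero_rpow_of_pos (by positivity)] at h2
  exact tendsto_of_tendsto_of_tendsto_of_le_of_le tendsto_const_nhds hlim (fun _ => zero_le)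
    fun n => eLpNorm_le_of_bound_of_one (hB' n) hq1 hqt

/-- A function with `|σ a - σ b| ≤ C (|a| + |b|) |a - b|` and `σ 0 = 0` acts continuously from
`L²` to `L¹`. -/
lemma TendstoLp.comp_one {v : ℕ → α → ℝ} {w : α → ℝ} (h : TendstoLp 2 μ v w) {σ : ℝ → ℝ} {C : ℝ}
    (hσc : Continuous σ) (hσ0 : σ 0 = 0) (hσ : ∀ a b, |σ a - σ b| ≤ C * ((|a| + |b|) * |a - b|)) :
    TendstoLp 1 μ (fun n x => σ (v n x)) (fun x => σ (w x)) := by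
  have hmem : ∀ {a : α → ℝ}, MemLp a 2 μ → MemLp (fun x => σ (a x)) 1 μ := by
    intro a ha
    refine memLp_one_iff_integrable.2 ((ha.integrable_sq.const_mul C).mono'
      (hσc.comp_aestronglyMeasurable ha.1) (Eventually.of_forall fun x => ?_))
    have := hσ (a x) 0
    rw [hσ0, abs_zero, add_zero, sub_zero, sub_zero, abs_mul_abs_self] at this
    rw [Real.norm_eq_abs, sq]
    exact this
  refine ⟨hmem h.memLp, fun n => hmem (h.memLp_seq n), ?_⟩
  have hle : ∀ n, eLpNorm ((fun x => σ (v n x)) - fun x => σ (w x)) 1 μ ≤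
      ‖C‖ₑ * ((eLpNorm (v n - w) 2 μ + (eLpNorm w 2 μ + eLpNorm w 2 μ))
        * eLpNorm (v n - w) 2 μ) := by
    intro n
    have hd := (h.memLp_seq n).sub h.memLp
    have hm : MemLp ((fun x => ‖(v n - w) x‖) + ((fun x => ‖w x‖) + (fun x => ‖w x‖))) 2 μ :=
      hd.norm.add (h.memLp.norm.add h.memLp.norm)
    have h1 : eLpNorm ((fun x => σ (v n x)) - fun x => σ (w x)) 1 μ ≤
        eLpNorm (C • (((fun x => ‖(v n - w) x‖) + ((fun x => ‖w x‖) + (fun x => ‖w x‖)))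
          • (v n - w))) 1 μ := by
      refine eLpNorm_mono fun x => ?_
      simp only [Pi.sub_apply, Pi.smul_apply, smul_eq_mul, Pi.add_apply, Pi.mul_apply, Real.norm_eq_abs,
        abs_mul]
      refine (hσ _ _).trans ?_
      refine mul_le_mul (le_abs_self C) (mul_le_mul_of_nonneg_right ?_ (abs_nonneg _))
        (by positivity) (abs_nonneg _)
      refine le_trans ?_ (le_abs_self _)
      have := abs_sub_abs_le_abs_sub (v n x) (w x)
      linarith
    refine h1.trans ?_
    rw [eLpNorm_const_smul]
    gcongr
    refine (eLpNorm_smul_le_mul_eLpNorm (p := 2) (q := 2) (r := 1) hd.1 hm.1).trans ?_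
    gcongr
    refine (eLpNorm_add_le hd.norm.1 (h.memLp.norm.add h.memLp.norm).1 (by norm_num)).trans ?_
    rw [eLpNorm_norm]
    gcongr
    refine (eLpNorm_add_le h.memLp.norm.1 h.memLp.norm.1 (by norm_num)).trans ?_
    rw [eLpNorm_norm]
  have hlim : Tendsto (fun n => ‖C‖ₑ * ((eLpNorm (v n - w) 2 μ + (eLpNorm w 2 μ + eLpNorm w 2 μ))
        * eLpNorm (v n - w) 2 μ)) atTop (𝓝 0) := by
    have h1 := ENNReal.Tendsto.mul (h.tendsto.add_const (eLpNorm w 2 μ + eLpNorm w 2 μ))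
      (Or.inr ENNReal.zero_ne_top) h.tendsto (Or.inr (by simpa using h.memLp.2.ne))
    rw [mul_zero] at h1
    have h2 := ENNReal.Tendsto.const_mul (a := ‖C‖ₑ) h1 (Or.inr (by simp))
    rwa [mul_zero] at h2
  exact tendsto_of_tendsto_of_tendsto_of_le_of_le tendsto_const_nhds hlim (fun _ => zero_le) hle

/-- Under `1/p + 1/m < 1`, a product of three factors converges in `L¹` if the last two converge
in `L^p` and `L^m` and the first one in every `L^q` with `q < ∞`. -/
lemma TendstoLp.mul_mul {p m : ℝ≥0∞} (hpm : p⁻¹ + m⁻¹ < 1) {s v v' : ℕ → α → ℝ}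
    {t w w' : α → ℝ} (hs : ∀ q : ℝ≥0∞, 1 ≤ q → q ≠ ∞ → TendstoLp q μ s t)
    (h : TendstoLp p μ v w) (h' : TendstoLp m μ v' w') :
    TendstoLp 1 μ (fun n x => s n x * (v n x * v' n x)) (fun x => t x * (w x * w' x)) := by
  set r : ℝ≥0∞ := (p⁻¹ + m⁻¹)⁻¹ with hr
  have hr1 : 1 < r := by rw [hr, ENNReal.one_lt_inv]; exact hpm
  have : ENNReal.HolderTriple p m r := ⟨by rw [hr, inv_inv]⟩
  have : ENNReal.HolderConjugate r (ENNReal.conjExponent r) :=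
    ENNReal.HolderConjugate.conjExponent hr1.le
  have h2 := TendstoLp.mul hr1.le h h'
  refine TendstoLp.mul (p := ENNReal.conjExponent r) (q := r) le_rfl (hs _ ?_ ?_) h2
  · unfold ENNReal.conjExponent; exact le_self_add
  · rw [ENNReal.conjExponent]
    refine ENNReal.add_ne_top.2 ⟨by simp, ?_⟩
    rw [Ne, ENNReal.inv_eq_top]
    exact (tsub_pos_of_lt hr1).ne'

end LpConvergence

/-! ### Truncations and the energy identity -/

section Energy

/-- A bounded `C¹` function `S` with bounded derivative `S'`, and its primitive `Φ`. The estimates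
`|σ a - σ b| ≤ C (|a| + |b|) |a - b|` for `σ = Φ, S, S'` express that these functions are flat near
`0`, and make `u ↦ σ(u)` continuous from `L²` to `L¹`. -/
structure IsTruncation (Φ S S' : ℝ → ℝ) (C : ℝ) : Prop where
  hasDerivAt_primitive : ∀ s, HasDerivAt Φ (S s) s
  hasDerivAt : ∀ s, HasDerivAt S (S' s) s
  continuous_deriv : Continuous S'
  primitive_zero : Φ 0 = 0
  zero : S 0 = 0
  deriv_zero : S' 0 = 0
  abs_le : ∀ s, |S s| ≤ C
  abs_deriv_le : ∀ s, |S' s| ≤ C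
  primitive_sub_le : ∀ a b, |Φ a - Φ b| ≤ C * ((|a| + |b|) * |a - b|)
  sub_le : ∀ a b, |S a - S b| ≤ C * ((|a| + |b|) * |a - b|)
  deriv_sub_le : ∀ a b, |S' a - S' b| ≤ C * ((|a| + |b|) * |a - b|)

lemma IsTruncation.continuous_primitive {Φ S S' : ℝ → ℝ} {C : ℝ} (h : IsTruncation Φ S S' C) :
    Continuous Φ :=
  continuous_iff_continuousAt.2 fun s => (h.hasDerivAt_primitive s).continuousAt

lemma IsTruncation.continuous {Φ S S' : ℝ → ℝ} {C : ℝ} (h : IsTruncation Φ S S' C) :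
    Continuous S :=
  continuous_iff_continuousAt.2 fun s => (h.hasDerivAt s).continuousAt

lemma IsTruncation.tendstoLp {α : Type*} [MeasurableSpace α] {μ : Measure α}
    {Φ S S' : ℝ → ℝ} {C : ℝ} (h : IsTruncation Φ S S' C) {v : ℕ → α → ℝ} {w : α → ℝ}
    (hv : TendstoLp 2 μ v w) {q : ℝ≥0∞} (hq1 : 1 ≤ q) (hqt : q ≠ ∞) :
    TendstoLp q μ (fun n x => S (v n x)) (fun x => S (w x)) :=
  (hv.comp_one h.continuous h.zero h.sub_le).of_bound_of_one (fun _ _ => h.abs_le _)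
    (fun _ => h.abs_le _) hq1 hqt

lemma IsTruncation.tendstoLp_deriv {α : Type*} [MeasurableSpace α] {μ : Measure α}
    {Φ S S' : ℝ → ℝ} {C : ℝ} (h : IsTruncation Φ S S' C) {v : ℕ → α → ℝ} {w : α → ℝ}
    (hv : TendstoLp 2 μ v w) {q : ℝ≥0∞} (hq1 : 1 ≤ q) (hqt : q ≠ ∞) :
    TendstoLp q μ (fun n x => S' (v n x)) (fun x => S' (w x)) :=
  (hv.comp_one h.continuous_deriv h.deriv_zero h.deriv_sub_le).of_bound_of_one
    (fun _ _ => h.abs_deriv_le _) (fun _ => h.abs_deriv_le _) hq1 hqt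

variable {E : Type*} [NormedAddCommGroup E] [NormedSpace ℝ E] [FiniteDimensional ℝ E]
  [MeasurableSpace E] [BorelSpace E] {μ : Measure E} [μ.IsAddHaarMeasure]

lemma tendstoLp_mollify {v : E → ℝ} {q : ℝ≥0∞} (hq1 : 1 ≤ q) (hqt : q ≠ ∞) (hv : MemLp v q μ) :
    TendstoLp q μ (fun n => mollify μ n v) v :=
  ⟨hv, fun n => memLp_mollify hq1 hqt n hv, tendsto_eLpNorm_mollify_sub hq1 hqt hv⟩

/-- Smooth functions with compact support in `U`. -/
structure IsTest (U : Set E) (ψ : E → ℝ) : Prop where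
  contDiff : ContDiff ℝ (⊤ : ℕ∞) ψ
  hasCompactSupport : HasCompactSupport ψ
  tsupport_subset : tsupport ψ ⊆ U

lemma isTest_mollifier_const_sub {U : Set E} {n : ℕ} {z : E}
    (h : Metric.closedBall z (shrinkingBump E n).rOut ⊆ U) :
    IsTest U fun y => mollifier μ n (z - y) :=
  ⟨contDiff_mollifier_const_sub n z, hasCompactSupport_mollifier_const_sub n z,
    (tsupport_mollifier_const_sub_subset n z).trans h⟩

/-- A weak directional derivative commutes with mollification. -/
lemma fderiv_mollify_of_weak {v w : E → ℝ} {e : E} (hv : LocallyIntegrable v μ)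
    (h : ∀ ψ, IsTest univ ψ → ∫ z, v z * fderiv ℝ ψ z e ∂μ = -∫ z, w z * ψ z ∂μ)
    (n : ℕ) (z : E) : fderiv ℝ (mollify μ n v) z e = mollify μ n w z := by
  rw [fderiv_mollify_eq_neg_integral n hv, h _ (isTest_mollifier_const_sub (subset_univ _)),
    neg_neg, mollify_apply]

lemma hasFDerivAt_comp_mollify {v : E → ℝ} (hv : LocallyIntegrable v μ) {σ σ' : ℝ → ℝ}
    (hσ : ∀ s, HasDerivAt σ (σ' s) s) (n : ℕ) (z : E) :
    HasFDerivAt (fun z => σ (mollify μ n v z))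
      (σ' (mollify μ n v z) • fderiv ℝ (mollify μ n v) z) z :=
  (hσ _).comp_hasFDerivAt z
    ((contDiff_mollify n hv).differentiable (by simp) z).hasFDerivAt

lemma MemLp.bdd_mul_cont {v θ : E → ℝ} {q : ℝ≥0∞} {B : ℝ} (hv : MemLp v q μ) (hθ : Continuous θ)
    (hB : ∀ z, |θ z| ≤ B) : MemLp (fun z => v z * θ z) q μ := by
  exact (memLp_top_of_bound hθ.aestronglyMeasurable B (Eventually.of_forall hB)).smul (p := q)
    (q := ∞) hv

lemma TendstoLp.bdd_mul_cont {v : ℕ → E → ℝ} {w θ : E → ℝ} {q : ℝ≥0∞} {B : ℝ} (hq : 1 ≤ q)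
    (hv : TendstoLp q μ v w) (hθ : Continuous θ) (hB : ∀ z, |θ z| ≤ B) :
    TendstoLp q μ (fun n z => v n z * θ z) (fun z => w z * θ z) := by
  have := TendstoLp.mul (p := q) (q := ∞) hq hv (TendstoLp.const (w := θ)
    (memLp_top_of_bound hθ.aestronglyMeasurable B (Eventually.of_forall hB)))
  exact this

/-- The energy identity: the equation `∂₀u - ∑ ∂_κ H_κ = f` may be tested with `S(u) θ`, where
`g_κ = ∂_κ u` and `θ` does not depend on the directions `e_κ`. It holds for the mollifications of
all functions by the chain rule and integration by parts, and passes to the limit. -/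
theorem energy_identity {κ : Type*} [Fintype κ] {U : Set E} {u f : E → ℝ} {e₀ : E} {e : κ → E}
    {g H : κ → E → ℝ} {p r : ℝ≥0∞} {m : κ → ℝ≥0∞} (hp : 1 ≤ p) (hpt : p ≠ ∞) (hr : 1 < r)
    (hrt : r ≠ ∞) (hm : ∀ j, 1 ≤ m j) (hmt : ∀ j, m j ≠ ∞) (hpm : ∀ j, p⁻¹ + (m j)⁻¹ < 1)
    (hu : MemLp u 2 μ) (hg : ∀ j, MemLp (g j) p μ) (hH : ∀ j, MemLp (H j) (m j) μ)
    (hf : MemLp f r μ)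
    (hgrad : ∀ j ψ, IsTest univ ψ → ∫ z, u z * fderiv ℝ ψ z (e j) ∂μ = -∫ z, g j z * ψ z ∂μ)
    (heq : ∀ ψ, IsTest U ψ → -∫ z, u z * fderiv ℝ ψ z e₀ ∂μ
      + ∑ j, ∫ z, H j z * fderiv ℝ ψ z (e j) ∂μ = ∫ z, f z * ψ z ∂μ)
    {θ : E → ℝ} {B : ℝ} (hθ : ContDiff ℝ 1 θ) (hθB : ∀ z, |θ z| ≤ B)
    (hθ0 : ∀ z, |fderiv ℝ θ z e₀| ≤ B) (hθe : ∀ j z, fderiv ℝ θ z (e j) = 0)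
    (hθU : ∃ ε > 0, ∀ z, θ z ≠ 0 → Metric.closedBall z ε ⊆ U)
    {Φ S S' : ℝ → ℝ} {C : ℝ} (hS : IsTruncation Φ S S' C) :
    -∫ z, Φ (u z) * fderiv ℝ θ z e₀ ∂μ + ∑ j, ∫ z, S' (u z) * (g j z * H j z) * θ z ∂μ
      = ∫ z, S (u z) * f z * θ z ∂μ := by
  have h12 : (1 : ℝ≥0∞) ≤ 2 := by norm_num
  have h2t : (2 : ℝ≥0∞) ≠ ∞ := by norm_num
  have huL := hu.locallyIntegrable h12
  have hHL := fun j => (hH j).locallyIntegrable (hm j)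
  have hθc := hθ.continuous
  have hθ0c : Continuous fun z => fderiv ℝ θ z e₀ :=
    (hθ.continuous_fderiv (by simp)).clm_apply continuous_const
  set un := fun n => mollify μ n u with hun
  have hu2 : TendstoLp 2 μ un u := tendstoLp_mollify h12 h2t hu
  -- `S(u_n)` is in `L^q` for every `q`, so its product with a function in any `L^q` is integrable.
  have hSint : ∀ n (q : ℝ≥0∞), 1 < q → ∀ w : E → ℝ, MemLp w q μ →
      MemLp (fun z => S (un n z) * w z) 1 μ := by
    intro n q hq w hw
    have : ENNReal.HolderConjugate q (ENNReal.conjExponent q) :=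
      ENNReal.HolderConjugate.conjExponent hq.le
    have h1 : MemLp (fun z => S (un n z)) (ENNReal.conjExponent q) μ := by
      refine (hS.tendstoLp hu2 ?_ ?_).memLp_seq n
      · unfold ENNReal.conjExponent; exact le_self_add
      · rw [ENNReal.conjExponent]
        refine ENNReal.add_ne_top.2 ⟨by simp, ?_⟩
        rw [Ne, ENNReal.inv_eq_top]
        exact (tsub_pos_of_lt hq).ne'
    exact hw.smul h1
  have hm1 : ∀ j, 1 < m j := by
    intro j
    have : (m j)⁻¹ < 1 := lt_of_le_of_lt le_add_self (hpm j)
    rwa [ENNReal.inv_lt_one] at this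
  -- The mollified equation, integrated against `S(u_n) θ`.
  have hstep : ∀ᶠ n in atTop, -∫ z, Φ (un n z) * fderiv ℝ θ z e₀ ∂μ
      + ∑ j, ∫ z, S' (un n z) * (mollify μ n (g j) z * mollify μ n (H j) z) * θ z ∂μ
      = ∫ z, S (un n z) * mollify μ n f z * θ z ∂μ := by
    obtain ⟨ε, hε, hεU⟩ := hθU
    filter_upwards [(tendsto_rOut_shrinkingBump (E := E)).eventually (gt_mem_nhds hε)] with n hn
    have hpt : ∀ z, θ z ≠ 0 → fderiv ℝ (un n) z e₀
        = mollify μ n f z + ∑ j, fderiv ℝ (mollify μ n (H j)) z (e j) := by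
      intro z hz
      have h1 := heq _ (isTest_mollifier_const_sub (μ := μ) (n := n) (z := z)
        ((Metric.closedBall_subset_closedBall hn.le).trans (hεU z hz)))
      rw [hun]
      simp only [fderiv_mollify_eq_neg_integral n huL]
      simp only [fderiv_mollify_eq_neg_integral n (hHL _), mollify_apply, ← h1,
        Finset.sum_neg_distrib]
      ring
    have hΦd : ∀ z, fderiv ℝ (fun z => Φ (un n z)) z e₀ = S (un n z) * fderiv ℝ (un n) z e₀ := by
      intro z
      rw [(hasFDerivAt_comp_mollify huL hS.hasDerivAt_primitive n z).fderiv]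
      simp [hun]
    have hSθd : ∀ j z, fderiv ℝ (fun z => S (un n z) * θ z) z (e j)
        = S' (un n z) * mollify μ n (g j) z * θ z := by
      intro j z
      have h1 := hasFDerivAt_comp_mollify huL hS.hasDerivAt n z
      have h2 := (hθ.differentiable (by simp) z).hasFDerivAt
      rw [show fderiv ℝ (fun z => S (un n z) * θ z) z = _ from (h1.mul h2).fderiv]
      simp only [add_apply, smul_apply, smul_eq_mul,
        hθe j z, fderiv_mollify_of_weak huL (hgrad j) n z, hun]
      ring
    have hdu : MemLp (fun z => fderiv ℝ (un n) z e₀) 2 μ := memLp_fderiv_mollify h12 h2t n hu e₀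
    have hdH : ∀ j, MemLp (fun z => fderiv ℝ (mollify μ n (H j)) z (e j)) (m j) μ := fun j =>
      memLp_fderiv_mollify (hm j) (hmt j) n (hH j) (e j)
    have hfn : MemLp (mollify μ n f) r μ := memLp_mollify hr.le hrt n hf
    have hHn : ∀ j, MemLp (mollify μ n (H j)) (m j) μ := fun j =>
      memLp_mollify (hm j) (hmt j) n (hH j)
    have hΦ1 : MemLp (fun z => Φ (un n z)) 1 μ :=
      (hu2.comp_one hS.continuous_primitive hS.primitive_zero hS.primitive_sub_le).memLp_seq n
    have ibp0 : ∫ z, Φ (un n z) * fderiv ℝ θ z e₀ ∂μ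
        = -∫ z, S (un n z) * fderiv ℝ (un n) z e₀ * θ z ∂μ := by
      rw [integral_mul_fderiv_eq_neg_fderiv_mul_of_integrable]
      · simp_rw [hΦd]
      · simp_rw [hΦd]
        exact memLp_one_iff_integrable.1
          (MemLp.bdd_mul_cont (hSint n 2 (by norm_num) _ hdu) hθc hθB)
      · exact memLp_one_iff_integrable.1 (MemLp.bdd_mul_cont hΦ1 hθ0c hθ0)
      · exact memLp_one_iff_integrable.1 (MemLp.bdd_mul_cont hΦ1 hθc hθB)
      · exact fun z _ =>
          (hasFDerivAt_comp_mollify huL hS.hasDerivAt_primitive n z).differentiableAt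
      · exact fun z _ => hθ.differentiable (by simp) z
    have ibpj : ∀ j, ∫ z, S (un n z) * θ z * fderiv ℝ (mollify μ n (H j)) z (e j) ∂μ
        = -∫ z, S' (un n z) * (mollify μ n (g j) z * mollify μ n (H j) z) * θ z ∂μ := by
      intro j
      rw [integral_mul_fderiv_eq_neg_fderiv_mul_of_integrable]
      · simp_rw [hSθd]
        congr 2; ext z; ring
      · simp_rw [hSθd]
        have := TendstoLp.mul_mul (hpm j) (fun q h1 h2 => hS.tendstoLp_deriv hu2 h1 h2)
          (tendstoLp_mollify hp ‹p ≠ ∞› (hg j)) (tendstoLp_mollify (hm j) (hmt j) (hH j))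
        refine (memLp_one_iff_integrable.1
          (MemLp.bdd_mul_cont (this.memLp_seq n) hθc hθB)).congr (Eventually.of_forall fun z => ?_)
        simp only; ring
      · refine (memLp_one_iff_integrable.1
          (MemLp.bdd_mul_cont (hSint n _ (hm1 j) _ (hdH j)) hθc hθB)).congr
          (Eventually.of_forall fun z => ?_)
        simp only; ring
      · refine (memLp_one_iff_integrable.1
          (MemLp.bdd_mul_cont (hSint n _ (hm1 j) _ (hHn j)) hθc hθB)).congr
          (Eventually.of_forall fun z => ?_)
        simp only; ring
      · exact fun z _ => (hasFDerivAt_comp_mollify huL hS.hasDerivAt n z).differentiableAt.mul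
          (hθ.differentiable (by simp) z)
      · exact fun z _ => (contDiff_mollify n (hHL j)).differentiable (by simp) z
    have hall : ∫ z, S (un n z) * fderiv ℝ (un n) z e₀ * θ z ∂μ
        = ∫ z, S (un n z) * mollify μ n f z * θ z ∂μ
          + ∑ j, ∫ z, S (un n z) * θ z * fderiv ℝ (mollify μ n (H j)) z (e j) ∂μ := by
      rw [← integral_finsetSum, ← integral_add]
      · refine integral_congr_ae (Eventually.of_forall fun z => ?_)
        by_cases hz : θ z = 0
        · simp [hz]
        · simp only [hpt z hz, ← Finset.mul_sum]; ring
      · exact memLp_one_iff_integrable.1 (MemLp.bdd_mul_cont (hSint n _ hr _ hfn) hθc hθB)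
      · refine integrable_finsetSum _ fun j _ => ?_
        refine (memLp_one_iff_integrable.1
          (MemLp.bdd_mul_cont (hSint n _ (hm1 j) _ (hdH j)) hθc hθB)).congr
          (Eventually.of_forall fun z => ?_)
        simp only; ring
      · intro j _
        refine (memLp_one_iff_integrable.1
          (MemLp.bdd_mul_cont (hSint n _ (hm1 j) _ (hdH j)) hθc hθB)).congr
          (Eventually.of_forall fun z => ?_)
        simp only; ring
    rw [ibp0, neg_neg, hall, Finset.sum_congr rfl fun j _ => ibpj j, Finset.sum_neg_distrib]
    ring
  have lim1 : Tendsto (fun n => ∫ z, Φ (un n z) * fderiv ℝ θ z e₀ ∂μ) atTop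
      (𝓝 (∫ z, Φ (u z) * fderiv ℝ θ z e₀ ∂μ)) :=
    (TendstoLp.bdd_mul_cont le_rfl (hu2.comp_one hS.continuous_primitive hS.primitive_zero
      hS.primitive_sub_le) hθ0c hθ0).tendsto_integral
  have lim2 : ∀ j, Tendsto (fun n => ∫ z, S' (un n z)
      * (mollify μ n (g j) z * mollify μ n (H j) z) * θ z ∂μ) atTop
      (𝓝 (∫ z, S' (u z) * (g j z * H j z) * θ z ∂μ)) := fun j =>
    (TendstoLp.bdd_mul_cont le_rfl (TendstoLp.mul_mul (hpm j)
      (fun q h1 h2 => hS.tendstoLp_deriv hu2 h1 h2) (tendstoLp_mollify hp hpt (hg j))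
      (tendstoLp_mollify (hm j) (hmt j) (hH j))) hθc hθB).tendsto_integral
  have lim3 : Tendsto (fun n => ∫ z, S (un n z) * mollify μ n f z * θ z ∂μ) atTop
      (𝓝 (∫ z, S (u z) * f z * θ z ∂μ)) := by
    have : ENNReal.HolderConjugate (ENNReal.conjExponent r) r :=
      (ENNReal.HolderConjugate.conjExponent hr.le).symm
    refine (TendstoLp.bdd_mul_cont le_rfl (TendstoLp.mul (p := ENNReal.conjExponent r) (q := r)
      le_rfl (hS.tendstoLp hu2 ?_ ?_) (tendstoLp_mollify hr.le hrt hf)) hθc hθB).tendsto_integral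
    · unfold ENNReal.conjExponent; exact le_self_add
    · rw [ENNReal.conjExponent]
      refine ENNReal.add_ne_top.2 ⟨by simp, ?_⟩
      rw [Ne, ENNReal.inv_eq_top]
      exact (tsub_pos_of_lt hr).ne'
  exact tendsto_nhds_unique ((lim1.neg.add (tendsto_finsetSum _ fun j _ => lim2 j)).congr' hstep) lim3

end Energy

/-! ### Time cutoffs -/

section TimeCutoff

/-- The time cutoff `τ(t) = ∫_t^∞ ρ_n(t₀ - s) ds`, which is `1` well before `t₀` and `0` well after
`t₀`. The upper limit `t₀ + 3` is beyond the support of the integrand. -/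
def timeCutoff (n : ℕ) (t₀ t : ℝ) : ℝ :=
  ∫ s in t..t₀ + 3, mollifier (volume : Measure ℝ) n (t₀ - s)

lemma rOut_le_two (n : ℕ) : (shrinkingBump ℝ n).rOut ≤ 2 := by
  simp only [shrinkingBump]
  rw [div_le_iff₀ (by positivity)]
  have : (0 : ℝ) ≤ n := by positivity
  linarith

lemma mollifier_sub_eq_zero {n : ℕ} {t₀ s : ℝ} (h : (shrinkingBump ℝ n).rOut ≤ |t₀ - s|) :
    mollifier (volume : Measure ℝ) n (t₀ - s) = 0 := by
  by_contra hne
  have : t₀ - s ∈ Function.support (mollifier (volume : Measure ℝ) n) := hne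
  rw [mollifier, ContDiffBump.support_normed_eq, Metric.mem_ball, dist_zero_right] at this
  exact absurd this (not_lt.2 h)

lemma continuous_mollifier_sub (n : ℕ) (t₀ : ℝ) :
    Continuous fun s => mollifier (volume : Measure ℝ) n (t₀ - s) :=
  (contDiff_mollifier_const_sub n t₀).continuous

lemma hasDerivAt_timeCutoff (n : ℕ) (t₀ t : ℝ) :
    HasDerivAt (timeCutoff n t₀) (-mollifier (volume : Measure ℝ) n (t₀ - t)) t :=
  intervalIntegral.integral_hasDerivAt_left
    ((continuous_mollifier_sub n t₀).intervalIntegrable _ _)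
    (continuous_mollifier_sub n t₀).aestronglyMeasurable.stronglyMeasurableAtFilter
    (continuous_mollifier_sub n t₀).continuousAt

lemma contDiff_timeCutoff (n : ℕ) (t₀ : ℝ) : ContDiff ℝ 1 (timeCutoff n t₀) := by
  rw [contDiff_one_iff_deriv]
  refine ⟨fun t => (hasDerivAt_timeCutoff n t₀ t).differentiableAt, ?_⟩
  rw [show deriv (timeCutoff n t₀) = fun t => -mollifier (volume : Measure ℝ) n (t₀ - t) from
    funext fun t => (hasDerivAt_timeCutoff n t₀ t).deriv]
  exact (continuous_mollifier_sub n t₀).neg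

lemma antitone_timeCutoff (n : ℕ) (t₀ : ℝ) : Antitone (timeCutoff n t₀) :=
  antitone_of_hasDerivAt_nonpos (hasDerivAt_timeCutoff n t₀)
    fun _ => neg_nonpos.2 (mollifier_nonneg n _)

lemma timeCutoff_eq_zero {n : ℕ} {t₀ t : ℝ} (h : t₀ + (shrinkingBump ℝ n).rOut ≤ t) :
    timeCutoff n t₀ t = 0 := by
  rw [timeCutoff, intervalIntegral.integral_congr (g := fun _ => 0)]
  · simp
  · intro s hs
    have := rOut_le_two n
    refine mollifier_sub_eq_zero ?_
    have h1 : t₀ + (shrinkingBump ℝ n).rOut ≤ s := le_trans (le_min h (by linarith)) hs.1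
    rw [abs_sub_comm]
    exact le_trans (by linarith) (le_abs_self _)

lemma timeCutoff_eq_one {n : ℕ} {t₀ t : ℝ} (h : t ≤ t₀ - (shrinkingBump ℝ n).rOut) :
    timeCutoff n t₀ t = 1 := by
  rw [timeCutoff, intervalIntegral.integral_eq_integral_of_support_subset,
    integral_sub_left_eq_self, integral_mollifier]
  intro s hs
  have hlt : |t₀ - s| < (shrinkingBump ℝ n).rOut := by
    by_contra hle
    exact hs (mollifier_sub_eq_zero (not_lt.1 hle))
  have := rOut_le_two n
  rw [abs_lt] at hlt
  constructor <;> linarith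

lemma timeCutoff_nonneg (n : ℕ) (t₀ t : ℝ) : 0 ≤ timeCutoff n t₀ t := by
  rw [← timeCutoff_eq_zero (n := n) (t₀ := t₀)
    (le_max_right t (t₀ + (shrinkingBump ℝ n).rOut))]
  exact antitone_timeCutoff n t₀ (le_max_left _ _)

lemma timeCutoff_le_one (n : ℕ) (t₀ t : ℝ) : timeCutoff n t₀ t ≤ 1 := by
  rw [← timeCutoff_eq_one (n := n) (t₀ := t₀)
    (min_le_right t (t₀ - (shrinkingBump ℝ n).rOut))]
  exact antitone_timeCutoff n t₀ (min_le_left _ _)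

end TimeCutoff

/-! ### Global solutions and their energy estimates -/

section EnergyEstimates

instance isAddHaarMeasure_volume_spaceTime (d : ℕ) :
    (volume : Measure (ℝ × Space d)).IsAddHaarMeasure := by
  rw [Measure.volume_eq_prod]; infer_instance

/-- The direction `(0, e_i)` in space-time. -/
def spaceDir {d : ℕ} (i : Fin d) : ℝ × Space d := (0, EuclideanSpace.single i 1)

/-- A weak solution of `∂ₜu = div (G - h) + f` on `(-∞, b) × ℝ^d`, where `g = ∇u` and the flux `G`
satisfies `⟨G, g⟩ ≥ η |g|²`, and where `u` and `g` vanish after the time `b`. This is the equation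
obtained when all data are extended by zero to `ℝ × ℝ^d`. -/
structure IsGlobalSolution (d : ℕ) (b η : ℝ) (p r m : ℝ≥0∞) (u f : ℝ × Space d → ℝ)
    (g G h : ℝ × Space d → Space d) : Prop where
  measurable : Measurable u
  memLp_two : MemLp u 2 volume
  memLp_grad : MemLp g p volume
  memLp_flux : MemLp G p volume
  memLp_source : MemLp f r volume
  memLp_field : MemLp h m volume
  grad : ∀ i ψ, IsTest univ ψ →
    ∫ z, u z * fderiv ℝ ψ z (spaceDir i) = -∫ z, g z i * ψ z
  eq : ∀ ψ, IsTest (Iio b ×ˢ univ) ψ → -(∫ z, u z * fderiv ℝ ψ z (1, 0))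
    + ((∑ i, ∫ z, G z i * fderiv ℝ ψ z (spaceDir i))
      + ∑ i, ∫ z, -h z i * fderiv ℝ ψ z (spaceDir i)) = ∫ z, f z * ψ z
  elliptic : ∀ z, η * ∑ i, g z i * g z i ≤ ∑ i, g z i * G z i
  zero_after : ∀ z, b ≤ z.1 → u z = 0
  grad_zero_after : ∀ z, b ≤ z.1 → g z = 0

lemma IsGlobalSolution.neg {d : ℕ} {b η : ℝ} {p r m : ℝ≥0∞} {u f : ℝ × Space d → ℝ}
    {g G h : ℝ × Space d → Space d} (H : IsGlobalSolution d b η p r m u f g G h) :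
    IsGlobalSolution d b η p r m (-u) (-f) (-g) (-G) (-h) where
  measurable := H.measurable.neg
  memLp_two := H.memLp_two.neg
  memLp_grad := H.memLp_grad.neg
  memLp_flux := H.memLp_flux.neg
  memLp_source := H.memLp_source.neg
  memLp_field := H.memLp_field.neg
  grad i ψ hψ := by
    have := H.grad i ψ hψ
    simp only [Pi.neg_apply, PiLp.neg_apply, neg_mul, integral_neg, this]
  eq ψ hψ := by
    have := H.eq ψ hψ
    simp only [Pi.neg_apply, PiLp.neg_apply, neg_mul, integral_neg, ← this, neg_neg,
      Finset.sum_neg_distrib]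
    ring
  elliptic z := by simpa using H.elliptic z
  zero_after z hz := by simp [H.zero_after z hz]
  grad_zero_after z hz := by simp [H.grad_zero_after z hz]

variable {d : ℕ} {b η : ℝ} {p r m : ℝ≥0∞} {u f : ℝ × Space d → ℝ}
    {g G h : ℝ × Space d → Space d}

lemma inv_add_inv_lt_one {p q : ℝ≥0∞} (hp : 2 < p) (hq : 2 < q) : p⁻¹ + q⁻¹ < 1 := by
  rw [← ENNReal.inv_two_add_inv_two]
  exact ENNReal.add_lt_add (ENNReal.inv_lt_inv.2 hp) (ENNReal.inv_lt_inv.2 hq)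

lemma IsTruncation.integrable_deriv_mul {Φ S S' : ℝ → ℝ} {C : ℝ} (hS : IsTruncation Φ S S' C)
    (hu : MemLp u 2 volume) {p q : ℝ≥0∞} (hp : 2 < p) (hq : 2 < q) {v w : ℝ × Space d → ℝ}
    (hv : MemLp v p volume) (hw : MemLp w q volume) :
    Integrable (fun z => S' (u z) * (v z * w z)) := by
  have := (TendstoLp.mul_mul (inv_add_inv_lt_one hp hq)
    (fun q h1 h2 => hS.tendstoLp_deriv (TendstoLp.const hu) h1 h2) (TendstoLp.const hv)
    (TendstoLp.const hw)).memLp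
  exact memLp_one_iff_integrable.1 this

lemma IsTruncation.integrable_mul {Φ S S' : ℝ → ℝ} {C : ℝ} (hS : IsTruncation Φ S S' C)
    (hu : MemLp u 2 volume) {r : ℝ≥0∞} (hr : 1 < r) {v : ℝ × Space d → ℝ}
    (hv : MemLp v r volume) : Integrable (fun z => S (u z) * v z) := by
  have : ENNReal.HolderConjugate (ENNReal.conjExponent r) r :=
    (ENNReal.HolderConjugate.conjExponent hr.le).symm
  refine memLp_one_iff_integrable.1 (TendstoLp.mul (p := ENNReal.conjExponent r) (q := r)
      le_rfl (hS.tendstoLp (TendstoLp.const hu) ?_ ?_) (TendstoLp.const hv)).memLp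
  · unfold ENNReal.conjExponent; exact le_self_add
  · rw [ENNReal.conjExponent]
    refine ENNReal.add_ne_top.2 ⟨by simp, ?_⟩
    rw [Ne, ENNReal.inv_eq_top]
    exact (tsub_pos_of_lt hr).ne'

lemma hasFDerivAt_comp_fst {τ : ℝ → ℝ} {τ' : ℝ} {z : ℝ × Space d} (h : HasDerivAt τ τ' z.1) :
    HasFDerivAt (fun z : ℝ × Space d => τ z.1)
      (τ' • ContinuousLinearMap.fst ℝ ℝ (Space d)) z :=
  h.comp_hasFDerivAt z hasFDerivAt_fst

/-- The right-hand side of the energy estimates. -/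
def energyBound (η : ℝ) (S S' : ℝ → ℝ) (u f : ℝ × Space d → ℝ) (h : ℝ × Space d → Space d) : ℝ :=
  ∫ z, (S (u z) * |f z| + 1 / (2 * η) * (S' (u z) * ∑ i, h z i * h z i))

/-- The energy inequality with a time cutoff: the equation is tested with `S(u) τ`. No cutoff in
space is needed, so no upper bound of the diffusion matrix enters. -/
lemma IsGlobalSolution.energy_le (H : IsGlobalSolution d b η p r m u f g G h) (hη : 0 < η)
    (hp : 2 < p) (hpt : p ≠ ∞) (hr : 1 < r) (hrt : r ≠ ∞) (hm : 2 < m) (hmt : m ≠ ∞)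
    {Φ S S' : ℝ → ℝ} {C : ℝ} (hS : IsTruncation Φ S S' C) (hS0 : ∀ s, 0 ≤ S s)
    (hS'0 : ∀ s, 0 ≤ S' s) {n : ℕ} {t₀ : ℝ} (ht₀ : t₀ + (shrinkingBump ℝ n).rOut < b) :
    (∫ z, Φ (u z) * mollifier (volume : Measure ℝ) n (t₀ - z.1))
      + η / 2 * ∫ z, S' (u z) * (∑ i, g z i * g z i) * timeCutoff n t₀ z.1
      ≤ energyBound η S S' u f h := by
  set τ := timeCutoff n t₀ with hτ
  have hgi : ∀ i, MemLp (fun z => g z i) p volume := memLp_coord H.memLp_grad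
  have hGi : ∀ i, MemLp (fun z => G z i) p volume := memLp_coord H.memLp_flux
  have hhi : ∀ i, MemLp (fun z => h z i) m volume := memLp_coord H.memLp_field
  have h1p : 1 ≤ p := le_trans (by norm_num) hp.le
  have h1m : 1 ≤ m := le_trans (by norm_num) hm.le
  have hθd : ∀ z : ℝ × Space d, HasFDerivAt (fun z : ℝ × Space d => τ z.1)
      ((-mollifier (volume : Measure ℝ) n (t₀ - z.1)) • ContinuousLinearMap.fst ℝ ℝ (Space d)) z :=
    fun z => hasFDerivAt_comp_fst (hasDerivAt_timeCutoff n t₀ z.1)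
  have hτc : Continuous fun z : ℝ × Space d => τ z.1 :=
    (contDiff_timeCutoff n t₀).continuous.comp continuous_fst
  have hτ1 : ∀ z : ℝ × Space d, |τ z.1| ≤ 1 := fun z => by
    rw [abs_of_nonneg (timeCutoff_nonneg _ _ _)]; exact timeCutoff_le_one _ _ _
  obtain ⟨B, hB⟩ : ∃ B, ∀ s, ‖mollifier (volume : Measure ℝ) n s‖ ≤ B :=
    (contDiff_mollifier n).continuous.bounded_above_of_compact_support
      (hasCompactSupport_mollifier n)
  -- The fluxes `G` and `-h` lie in different Lebesgue spaces, so each direction is counted twice.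
  have hid := energy_identity (κ := Fin d ⊕ Fin d) (μ := volume) (U := Iio b ×ˢ univ) (u := u)
    (f := f) (e₀ := (1, 0)) (e := Sum.elim spaceDir spaceDir)
    (g := Sum.elim (fun i z => g z i) (fun i z => g z i))
    (H := Sum.elim (fun i z => G z i) (fun i z => -h z i))
    (p := p) (r := r) (m := Sum.elim (fun _ => p) (fun _ => m)) (θ := fun z => τ z.1)
    (B := max 1 B)
    h1p hpt hr hrt (by rintro (i | i) <;> simpa) (by rintro (i | i) <;> simpa)
    (by rintro (i | i) <;> exact inv_add_inv_lt_one hp (by simpa))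
    H.memLp_two (by rintro (i | i) <;> exact hgi i)
    (by rintro (i | i); exacts [hGi i, (hhi i).neg]) H.memLp_source
    (by rintro (i | i) <;> exact H.grad i)
    (fun ψ hψ => by simpa only [Fintype.sum_sum_type, Sum.elim_inl, Sum.elim_inr] using H.eq ψ hψ)
    ((contDiff_timeCutoff n t₀).comp contDiff_fst)
    (fun z => (hτ1 z).trans (le_max_left _ _))
    (fun z => by
      rw [(hθd z).fderiv]
      simpa using Or.inr (hB (t₀ - z.1)))
    (by rintro (i | i) z <;> rw [(hθd z).fderiv] <;> simp [spaceDir])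
    (by
      refine ⟨b - (t₀ + (shrinkingBump ℝ n).rOut), by linarith, fun z hz w hw => ⟨?_, mem_univ _⟩⟩
      have h1 : z.1 < t₀ + (shrinkingBump ℝ n).rOut := by
        by_contra hle
        exact hz (timeCutoff_eq_zero (not_lt.1 hle))
      have h2 : |w.1 - z.1| ≤ b - (t₀ + (shrinkingBump ℝ n).rOut) := by
        rw [Metric.mem_closedBall, Prod.dist_eq] at hw
        exact (le_max_left _ _).trans hw
      have := (abs_le.1 h2).2
      simp only [mem_Iio]; linarith)
    hS
  simp only [Fintype.sum_sum_type, Sum.elim_inl, Sum.elim_inr] at hid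
  have hθ0 : ∀ z : ℝ × Space d, fderiv ℝ (fun z : ℝ × Space d => τ z.1) z (1, 0)
      = -mollifier (volume : Measure ℝ) n (t₀ - z.1) := fun z => by
    rw [(hθd z).fderiv]; simp
  have hΦθ : ∫ z, Φ (u z) * fderiv ℝ (fun z : ℝ × Space d => τ z.1) z (1, 0)
      = -∫ z, Φ (u z) * mollifier (volume : Measure ℝ) n (t₀ - z.1) := by
    simp only [hθ0, mul_neg, integral_neg]
  rw [hΦθ, neg_neg] at hid
  have i1 : ∀ i, Integrable fun z => S' (u z) * (g z i * G z i) * τ z.1 := fun i =>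
    memLp_one_iff_integrable.1 (MemLp.bdd_mul_cont (memLp_one_iff_integrable.2
      (hS.integrable_deriv_mul H.memLp_two hp hp (hgi i) (hGi i))) hτc hτ1)
  have i2 : ∀ i, Integrable fun z => S' (u z) * (g z i * -h z i) * τ z.1 := fun i =>
    memLp_one_iff_integrable.1 (MemLp.bdd_mul_cont (memLp_one_iff_integrable.2
      (hS.integrable_deriv_mul H.memLp_two hp hm (hgi i) (hhi i).neg)) hτc hτ1)
  have i3 : ∀ i, Integrable fun z => S' (u z) * (g z i * g z i) * τ z.1 := fun i =>
    memLp_one_iff_integrable.1 (MemLp.bdd_mul_cont (memLp_one_iff_integrable.2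
      (hS.integrable_deriv_mul H.memLp_two hp hp (hgi i) (hgi i))) hτc hτ1)
  have i4 : ∀ i, Integrable fun z => S' (u z) * (h z i * h z i) := fun i =>
    hS.integrable_deriv_mul H.memLp_two hm hm (hhi i) (hhi i)
  have i5 : Integrable fun z => S (u z) * f z * τ z.1 :=
    memLp_one_iff_integrable.1 (MemLp.bdd_mul_cont (memLp_one_iff_integrable.2
      (hS.integrable_mul H.memLp_two hr H.memLp_source)) hτc hτ1)
  have i6 : Integrable fun z => S (u z) * |f z| :=
    hS.integrable_mul H.memLp_two hr H.memLp_source.abs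
  have i3' : Integrable fun z => S' (u z) * (∑ i, g z i * g z i) * τ z.1 := by
    refine (integrable_finsetSum Finset.univ fun i _ => i3 i).congr (Eventually.of_forall fun z => ?_)
    simp only [Finset.mul_sum, Finset.sum_mul]
  have i4' : Integrable fun z => S' (u z) * ∑ i, h z i * h z i := by
    refine (integrable_finsetSum Finset.univ fun i _ => i4 i).congr (Eventually.of_forall fun z => ?_)
    simp only [Finset.mul_sum]
  rw [← integral_finsetSum _ fun i _ => i1 i, ← integral_finsetSum _ fun i _ => i2 i,
    ← integral_add (integrable_finsetSum _ fun i _ => i1 i)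
      (integrable_finsetSum _ fun i _ => i2 i)] at hid
  have hle : (∫ z, S (u z) * f z * τ z.1)
      + η / 2 * ∫ z, S' (u z) * (∑ i, g z i * g z i) * τ z.1
      ≤ energyBound η S S' u f h + ∫ z, (∑ i, S' (u z) * (g z i * G z i) * τ z.1
        + ∑ i, S' (u z) * (g z i * -h z i) * τ z.1) := by
    have iA : Integrable fun z =>
        S (u z) * |f z| + 1 / (2 * η) * (S' (u z) * ∑ i, h z i * h z i) :=
      i6.add (i4'.const_mul _)
    have iB : Integrable fun z => (∑ i, S' (u z) * (g z i * G z i) * τ z.1)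
        + ∑ i, S' (u z) * (g z i * -h z i) * τ z.1 :=
      (integrable_finsetSum _ fun i _ => i1 i).add (integrable_finsetSum _ fun i _ => i2 i)
    rw [energyBound, ← integral_const_mul, ← integral_add i5 (i3'.const_mul _),
      ← integral_add iA iB]
    refine integral_mono (i5.add (i3'.const_mul _)) (iA.add iB)
      fun z => ?_
    simp only
    have hτ0 : 0 ≤ τ z.1 := timeCutoff_nonneg _ _ _
    have hτ1' : τ z.1 ≤ 1 := timeCutoff_le_one _ _ _
    have e1 : S (u z) * f z * τ z.1 ≤ S (u z) * |f z| := by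
      rw [mul_assoc]
      refine mul_le_mul_of_nonneg_left ?_ (hS0 _)
      calc f z * τ z.1 ≤ |f z| * τ z.1 := mul_le_mul_of_nonneg_right (le_abs_self _) hτ0
        _ ≤ |f z| * 1 := mul_le_mul_of_nonneg_left hτ1' (abs_nonneg _)
        _ = _ := mul_one _
    -- Young's inequality absorbs the mixed term `⟨g, h⟩` in half of the elliptic term.
    have e2 : ∑ i, g z i * h z i
        ≤ η / 2 * ∑ i, g z i * g z i + 1 / (2 * η) * ∑ i, h z i * h z i := by
      rw [Finset.mul_sum, Finset.mul_sum, ← Finset.sum_add_distrib]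
      refine Finset.sum_le_sum fun i _ => ?_
      have h1 : 0 ≤ 1 / (2 * η) * (η * g z i - h z i) ^ 2 := by positivity
      have h2 : 1 / (2 * η) * (η * g z i - h z i) ^ 2
          = η / 2 * (g z i * g z i) + 1 / (2 * η) * (h z i * h z i) - g z i * h z i := by
        field_simp; ring
      linarith
    have e3 := H.elliptic z
    have e4 : 0 ≤ ∑ i, h z i * h z i := Finset.sum_nonneg fun i _ => mul_self_nonneg _
    set A := ∑ i, g z i * g z i
    set W := ∑ i, h z i * h z i
    have e5 : ∑ i, S' (u z) * (g z i * G z i) * τ z.1 = S' (u z) * τ z.1 * ∑ i, g z i * G z i := by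
      rw [Finset.mul_sum]; exact Finset.sum_congr rfl fun i _ => by ring
    have e6 : ∑ i, S' (u z) * (g z i * -h z i) * τ z.1
        = -(S' (u z) * τ z.1 * ∑ i, g z i * h z i) := by
      rw [Finset.mul_sum, ← Finset.sum_neg_distrib]; exact Finset.sum_congr rfl fun i _ => by ring
    rw [e5, e6]
    have e7 : 0 ≤ S' (u z) * τ z.1 := mul_nonneg (hS'0 _) hτ0
    have e8 := mul_le_mul_of_nonneg_left e2 e7
    have e9 := mul_le_mul_of_nonneg_left e3 e7
    have e10 : S' (u z) * τ z.1 * (1 / (2 * η) * W) ≤ 1 / (2 * η) * (S' (u z) * W) := by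
      have h1 : 0 ≤ 1 / (2 * η) * (S' (u z) * W) :=
        mul_nonneg (by positivity) (mul_nonneg (hS'0 _) e4)
      calc _ = τ z.1 * (1 / (2 * η) * (S' (u z) * W)) := by ring
        _ ≤ 1 * _ := mul_le_mul_of_nonneg_right hτ1' h1
        _ = _ := one_mul _
    linarith
  linarith

/-- The energy at almost every time, by Lebesgue differentiation in time. -/
theorem IsGlobalSolution.ae_integral_primitive_le (H : IsGlobalSolution d b η p r m u f g G h)
    (hη : 0 < η) (hp : 2 < p) (hpt : p ≠ ∞) (hr : 1 < r) (hrt : r ≠ ∞) (hm : 2 < m) (hmt : m ≠ ∞)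
    {Φ S S' : ℝ → ℝ} {C : ℝ} (hS : IsTruncation Φ S S' C) (hS0 : ∀ s, 0 ≤ S s)
    (hS'0 : ∀ s, 0 ≤ S' s) :
    ∀ᵐ t : ℝ, t < b → ∫ x, Φ (u (t, x)) ≤ energyBound η S S' u f h := by
  have hΦ1 : Integrable (fun z => Φ (u z)) := memLp_one_iff_integrable.1
    ((TendstoLp.const H.memLp_two).comp_one hS.continuous_primitive hS.primitive_zero
      hS.primitive_sub_le).memLp
  have hΦ2 : Integrable (fun z => Φ (u z)) ((volume : Measure ℝ).prod volume) := hΦ1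
  have hmint := hΦ2.integral_prod_left
  filter_upwards [ae_tendsto_mollify hmint.locallyIntegrable] with t ht htb
  refine le_of_tendsto ht ?_
  have hev := (tendsto_rOut_shrinkingBump (E := ℝ)).eventually (gt_mem_nhds (sub_pos.2 htb))
  filter_upwards [hev] with n hn
  have h1 := H.energy_le hη hp hpt hr hrt hm hmt hS hS0 hS'0 (n := n) (t₀ := t) (by linarith)
  have h2 : 0 ≤ η / 2 * ∫ z, S' (u z) * (∑ i, g z i * g z i) * timeCutoff n t z.1 := by
    refine mul_nonneg (by positivity) (integral_nonneg fun z => ?_)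
    exact mul_nonneg (mul_nonneg (hS'0 _) (Finset.sum_nonneg fun i _ => mul_self_nonneg _))
      (timeCutoff_nonneg _ _ _)
  obtain ⟨B, hB⟩ : ∃ B, ∀ s, ‖mollifier (volume : Measure ℝ) n s‖ ≤ B :=
    (contDiff_mollifier n).continuous.bounded_above_of_compact_support
      (hasCompactSupport_mollifier n)
  have h3 : (∫ z, Φ (u z) * mollifier (volume : Measure ℝ) n (t - z.1))
      = mollify volume n (fun t => ∫ x, Φ (u (t, x))) t := by
    rw [mollify_apply, Measure.volume_eq_prod, integral_prod]
    · simp_rw [integral_mul_const]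
    · exact memLp_one_iff_integrable.1 (MemLp.bdd_mul_cont (memLp_one_iff_integrable.2 hΦ1)
        ((continuous_mollifier_sub n t).comp continuous_fst) (fun z => hB _))
  rw [← h3]
  linarith

/-- The energy of the gradient. The time cutoffs converge to `1` for `t < b`, and the
gradient vanishes afterwards. -/
theorem IsGlobalSolution.integral_grad_le (H : IsGlobalSolution d b η p r m u f g G h)
    (hη : 0 < η) (hp : 2 < p) (hpt : p ≠ ∞) (hr : 1 < r) (hrt : r ≠ ∞) (hm : 2 < m) (hmt : m ≠ ∞)
    {Φ S S' : ℝ → ℝ} {C : ℝ} (hS : IsTruncation Φ S S' C) (hS0 : ∀ s, 0 ≤ S s)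
    (hS'0 : ∀ s, 0 ≤ S' s) (hΦ0 : ∀ s, 0 ≤ Φ s) :
    η / 2 * ∫ z, S' (u z) * ∑ i, g z i * g z i ≤ energyBound η S S' u f h := by
  have hgi : ∀ i, MemLp (fun z => g z i) p volume := memLp_coord H.memLp_grad
  have hint : Integrable fun z => S' (u z) * ∑ i, g z i * g z i := by
    refine (integrable_finsetSum Finset.univ fun i _ =>
      hS.integrable_deriv_mul H.memLp_two hp hp (hgi i) (hgi i)).congr
      (Eventually.of_forall fun z => ?_)
    simp only [Finset.mul_sum]
  set t₀ : ℕ → ℝ := fun n => b - 2 * (shrinkingBump ℝ n).rOut with ht₀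
  have hlim : Tendsto (fun n => ∫ z, S' (u z) * (∑ i, g z i * g z i) * timeCutoff n (t₀ n) z.1)
      atTop (𝓝 (∫ z, S' (u z) * ∑ i, g z i * g z i)) := by
    refine tendsto_integral_of_dominated_convergence
      (fun z => ‖S' (u z) * ∑ i, g z i * g z i‖) (fun n => ?_) hint.norm (fun n => ?_) ?_
    · exact hint.1.mul ((contDiff_timeCutoff n _).continuous.comp
        continuous_fst).aestronglyMeasurable
    · refine Eventually.of_forall fun z => ?_
      rw [norm_mul]
      refine mul_le_of_le_one_right (norm_nonneg _) ?_
      rw [Real.norm_of_nonneg (timeCutoff_nonneg _ _ _)]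
      exact timeCutoff_le_one _ _ _
    · refine Eventually.of_forall fun z => ?_
      rcases le_or_gt b z.1 with hz | hz
      · simp [H.grad_zero_after z hz]
      · refine tendsto_const_nhds.congr' ?_
        have hev := (tendsto_rOut_shrinkingBump (E := ℝ)).eventually
          (gt_mem_nhds (show 0 < (b - z.1) / 3 by linarith))
        filter_upwards [hev] with n hn
        rw [timeCutoff_eq_one, mul_one]
        simp only [ht₀]; linarith
  refine le_of_tendsto (hlim.const_mul (η / 2)) (Eventually.of_forall fun n => ?_)
  have h1 := H.energy_le hη hp hpt hr hrt hm hmt hS hS0 hS'0 (n := n) (t₀ := t₀ n) (by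
    have := (shrinkingBump ℝ n).rOut_pos
    simp only [ht₀]; linarith)
  have h2 : 0 ≤ ∫ z, Φ (u z) * mollifier (volume : Measure ℝ) n (t₀ n - z.1) :=
    integral_nonneg fun z => mul_nonneg (hΦ0 _) (mollifier_nonneg _ _)
  linarith

end EnergyEstimates

/-! ### Translations and weak derivatives -/

section Translation

variable {E : Type*} [NormedAddCommGroup E] [NormedSpace ℝ E] [FiniteDimensional ℝ E]
  [MeasurableSpace E] [BorelSpace E] {μ : Measure E} [μ.IsAddHaarMeasure]

lemma eLpNorm_two_sq {α F : Type*} [MeasurableSpace α] [NormedAddCommGroup F] {ν : Measure α}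
    (v : α → F) :
    eLpNorm v 2 ν ^ 2 = ∫⁻ z, ‖v z‖ₑ ^ 2 ∂ν := by
  rw [eLpNorm_eq_lintegral_rpow_enorm_toReal (by norm_num) (by norm_num), ← ENNReal.rpow_natCast,
    ← ENNReal.rpow_mul]
  simp

/-- For a `C¹` function, `‖w - w(· - e)‖₂ ≤ ‖∂_e w‖₂`. -/
lemma eLpNorm_sub_translate_le_of_contDiff {w : E → ℝ} (hw : ContDiff ℝ 1 w) (e : E) :
    eLpNorm (fun z => w z - w (z - e)) 2 μ ≤ eLpNorm (fun z => fderiv ℝ w z e) 2 μ := by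
  set D := fun z => fderiv ℝ w z e with hD
  have hDc : Continuous D := (hw.continuous_fderiv (by simp)).clm_apply continuous_const
  set ν : Measure ℝ := volume.restrict (Ioc 0 1) with hν
  have hpt : ∀ z, ‖w z - w (z - e)‖ₑ ^ 2 ≤ ∫⁻ s, ‖D (z - s • e)‖ₑ ^ 2 ∂ν := by
    intro z
    have hFTC : ∫ s in (0 : ℝ)..1, D (z - s • e) = w z - w (z - e) := by
      have hder : ∀ s ∈ uIcc (0 : ℝ) 1,
          HasDerivAt (fun s : ℝ => -w (z - s • e)) (D (z - s • e)) s := by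
        intro s _
        have h1 : HasDerivAt (fun s : ℝ => z - s • e) (-e) s := by
          simpa using ((hasDerivAt_id s).smul_const e).const_sub z
        have h2 := (hw.differentiable (by simp) (z - s • e)).hasFDerivAt.comp_hasDerivAt s h1
        have h3 := h2.neg
        simp only [map_neg, neg_neg] at h3
        exact h3
      rw [intervalIntegral.integral_eq_sub_of_hasDerivAt hder
        (Continuous.intervalIntegrable (by fun_prop) _ _)]
      simp only [one_smul, zero_smul, sub_zero]
      ring
    have h1 : ‖w z - w (z - e)‖ₑ ≤ eLpNorm (fun s : ℝ => D (z - s • e)) 1 ν := by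
      rw [← hFTC, intervalIntegral.integral_of_le zero_le_one, eLpNorm_one_eq_lintegral_enorm]
      exact enorm_integral_le_lintegral_enorm _
    have : IsProbabilityMeasure ν := ⟨by simp [hν]⟩
    have h2 : eLpNorm (fun s : ℝ => D (z - s • e)) 1 ν ≤ eLpNorm (fun s : ℝ => D (z - s • e)) 2 ν :=
      eLpNorm_le_eLpNorm_of_exponent_le (by norm_num)
        (Continuous.aestronglyMeasurable (by fun_prop))
    calc _ ≤ (eLpNorm (fun s : ℝ => D (z - s • e)) 2 ν) ^ 2 := by gcongr; exact h1.trans h2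
      _ = _ := eLpNorm_two_sq _
  have hsq : eLpNorm (fun z => w z - w (z - e)) 2 μ ^ 2 ≤ eLpNorm D 2 μ ^ 2 := by
    rw [eLpNorm_two_sq, eLpNorm_two_sq]
    calc _ ≤ ∫⁻ z, ∫⁻ s, ‖D (z - s • e)‖ₑ ^ 2 ∂ν ∂μ := lintegral_mono hpt
      _ = ∫⁻ s, ∫⁻ z, ‖D (z - s • e)‖ₑ ^ 2 ∂μ ∂ν := by
          refine lintegral_lintegral_swap (Measurable.aemeasurable ?_)
          have : Continuous (Function.uncurry fun (z : E) (s : ℝ) => D (z - s • e)) := by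
            simp only [Function.uncurry_def]; fun_prop
          exact (this.enorm.measurable).pow_const 2
      _ = ∫⁻ s, ∫⁻ z, ‖D z‖ₑ ^ 2 ∂μ ∂ν := by
          refine lintegral_congr fun s => ?_
          exact lintegral_sub_right_eq_self (fun z => ‖D z‖ₑ ^ 2) (s • e)
      _ = _ := by simp [hν]
  exact (ENNReal.pow_le_pow_left_iff two_ne_zero).1 hsq

/-- A truncation of a function with weak derivative `v = ∂_e u` satisfies
`‖S(u) - S(u(· - e))‖₂ ≤ ‖S'(u) v‖₂`. -/
theorem eLpNorm_sub_translate_le {u v : E → ℝ} {e : E} {p : ℝ≥0∞} (hp : 2 < p) (hpt : p ≠ ∞)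
    (hu : MemLp u 2 μ) (hv : MemLp v p μ)
    (hweak : ∀ ψ, IsTest univ ψ → ∫ z, u z * fderiv ℝ ψ z e ∂μ = -∫ z, v z * ψ z ∂μ)
    {Φ S S' : ℝ → ℝ} {C : ℝ} (hS : IsTruncation Φ S S' C) :
    eLpNorm (fun z => S (u z) - S (u (z - e))) 2 μ ≤ eLpNorm (fun z => S' (u z) * v z) 2 μ := by
  have h12 : (1 : ℝ≥0∞) ≤ 2 := by norm_num
  have h2t : (2 : ℝ≥0∞) ≠ ∞ := by norm_num
  have huL := hu.locallyIntegrable h12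
  have hu2 : TendstoLp 2 μ (fun n => mollify μ n u) u := tendstoLp_mollify h12 h2t hu
  have hp2 : p⁻¹ < 2⁻¹ := ENNReal.inv_lt_inv.2 hp
  have hq0 : (2 : ℝ≥0∞)⁻¹ - p⁻¹ ≠ 0 := (tsub_pos_of_lt hp2).ne'
  have hq1 : 1 ≤ ((2 : ℝ≥0∞)⁻¹ - p⁻¹)⁻¹ := by
    rw [ENNReal.one_le_inv]
    exact tsub_le_self.trans (by simp)
  have : ENNReal.HolderTriple ((2 : ℝ≥0∞)⁻¹ - p⁻¹)⁻¹ p 2 :=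
    ⟨by rw [inv_inv, tsub_add_cancel_of_le hp2.le]⟩
  have lim1 : TendstoLp 2 μ (fun n z => S (mollify μ n u z)) (fun z => S (u z)) :=
    hS.tendstoLp hu2 h12 h2t
  have lim2 : TendstoLp 2 μ (fun n z => S' (mollify μ n u z) * mollify μ n v z)
      (fun z => S' (u z) * v z) :=
    TendstoLp.mul h12 (hS.tendstoLp_deriv hu2 hq1 (ENNReal.inv_ne_top.2 hq0))
      (tendstoLp_mollify (h12.trans hp.le) hpt hv)
  have hstep : ∀ n, eLpNorm (fun z => S (mollify μ n u z) - S (mollify μ n u (z - e))) 2 μ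
      ≤ eLpNorm (fun z => S' (mollify μ n u z) * mollify μ n v z) 2 μ := by
    intro n
    have hS1 : ContDiff ℝ 1 S := by
      rw [contDiff_one_iff_deriv]
      refine ⟨fun s => (hS.hasDerivAt s).differentiableAt, ?_⟩
      rw [show deriv S = S' from funext fun s => (hS.hasDerivAt s).deriv]
      exact hS.continuous_deriv
    have h1 : ContDiff ℝ 1 fun z => S (mollify μ n u z) :=
      hS1.comp ((contDiff_mollify n huL).of_le (by exact_mod_cast le_top))
    refine (eLpNorm_sub_translate_le_of_contDiff (μ := μ) h1 e).trans (le_of_eq ?_)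
    congr 1
    ext z
    rw [(hasFDerivAt_comp_mollify huL hS.hasDerivAt n z).fderiv]
    simp [fderiv_mollify_of_weak huL hweak n z]
  have hmp : MeasurePreserving (fun z : E => z - e) μ μ := measurePreserving_sub_right μ e
  set A : ℕ → E → ℝ := fun n => (fun z => S (mollify μ n u z)) - fun z => S (u z) with hA
  have hAm : ∀ n, MemLp (A n) 2 μ := fun n => (lim1.memLp_seq n).sub lim1.memLp
  have hbound : ∀ n, eLpNorm (fun z => S (u z) - S (u (z - e))) 2 μ
      ≤ (eLpNorm (fun z => S' (u z) * v z) 2 μ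
          + eLpNorm ((fun z => S' (mollify μ n u z) * mollify μ n v z)
            - fun z => S' (u z) * v z) 2 μ)
        + (eLpNorm (A n) 2 μ + eLpNorm (A n) 2 μ) := by
    intro n
    have hA' : MemLp (fun z => A n (z - e)) 2 μ := (hAm n).comp_measurePreserving hmp
    have hA'' : eLpNorm (fun z => A n (z - e)) 2 μ = eLpNorm (A n) 2 μ :=
      eLpNorm_comp_measurePreserving (hAm n).1 hmp
    have hb : MemLp (fun z => S (mollify μ n u z) - S (mollify μ n u (z - e))) 2 μ :=
      (lim1.memLp_seq n).sub ((lim1.memLp_seq n).comp_measurePreserving hmp)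
    have hdec : (fun z => S (u z) - S (u (z - e)))
        = (fun z => S (mollify μ n u z) - S (mollify μ n u (z - e)))
          - (A n - fun z => A n (z - e)) := by
      ext z; simp only [hA, Pi.sub_apply]; ring
    rw [hdec]
    refine (eLpNorm_sub_le hb.1 ((hAm n).sub hA').1 h12).trans (add_le_add ?_ ?_)
    · refine (hstep n).trans ?_
      have : (fun z => S' (mollify μ n u z) * mollify μ n v z) = (fun z => S' (u z) * v z)
          + ((fun z => S' (mollify μ n u z) * mollify μ n v z) - fun z => S' (u z) * v z) := by
        ext z; simp
      conv_lhs => rw [this]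
      exact eLpNorm_add_le lim2.memLp.1 ((lim2.memLp_seq n).sub lim2.memLp).1 h12
    · refine (eLpNorm_sub_le (hAm n).1 hA'.1 h12).trans ?_
      rw [hA'']
  have hlim := ((tendsto_const_nhds (x := eLpNorm (fun z => S' (u z) * v z) 2 μ)).add
    lim2.tendsto).add (lim1.tendsto.add lim1.tendsto)
  simp only [add_zero] at hlim
  exact ge_of_tendsto' hlim hbound

end Translation

/-! ### A Faber–Krahn inequality on time slices -/

section FaberKrahn

/-- A Faber–Krahn inequality on time slices. If the slices of `{w ≠ 0}` have measure at most half
that of the ball of radius `ρ`, then for every `x` at least half of the shifts `y` in the ball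
satisfy `w(t, x - y) = 0`, and for those `|w(t, x)|² = |w(t, x) - w(t, x - y)|²`. -/
theorem lintegral_sq_le_of_translate {d : ℕ} {w : ℝ × Space d → ℝ} (hw : Measurable w)
    {ρ : ℝ} (hρ : 0 < ρ) {α K : ℝ≥0∞}
    (hK : ∀ y ∈ Metric.ball (0 : Space d) ρ, ∫⁻ z, ‖w z - w (z - (0, y))‖ₑ ^ 2 ≤ K)
    (hα : ∀ᵐ t : ℝ, volume {x : Space d | w (t, x) ≠ 0} ≤ α)
    (hV : 2 * α ≤ volume (Metric.ball (0 : Space d) ρ)) :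
    ∫⁻ z, ‖w z‖ₑ ^ 2 ≤ 2 * K := by
  set B := Metric.ball (0 : Space d) ρ with hB
  set V := volume B with hVdef
  have hV0 : V ≠ 0 := (Metric.measure_ball_pos volume _ hρ).ne'
  have hVt : V ≠ ∞ := measure_ball_lt_top.ne
  have hBm : MeasurableSet B := Metric.isOpen_ball.measurableSet
  set Z : Set ((ℝ × Space d) × Space d) := {q | w (q.1 - (0, q.2)) = 0} with hZ
  have hZm : MeasurableSet Z :=
    (hw.comp (by fun_prop : Measurable fun q : (ℝ × Space d) × Space d => q.1 - (0, q.2)))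
      (measurableSet_singleton (0 : ℝ))
  set F : (ℝ × Space d) → Space d → ℝ≥0∞ := fun z y => Z.indicator (fun q => ‖w q.1‖ₑ ^ 2) (z, y)
    with hF
  have hFm : Measurable (Function.uncurry F) :=
    Measurable.indicator (((hw.comp measurable_fst).enorm).pow_const 2) hZm
  have upper : ∫⁻ y in B, ∫⁻ z, F z y ≤ V * K := by
    calc _ ≤ ∫⁻ y in B, K := by
          refine setLIntegral_mono' hBm fun y hy => (lintegral_mono fun z => ?_).trans (hK y hy)
          by_cases h : (z, y) ∈ Z
          · have h0 : w (z - (0, y)) = 0 := h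
            simp only [hF, indicator_of_mem h]
            rw [h0, sub_zero]
          · simp only [hF, indicator_of_notMem h]; exact zero_le
      _ = V * K := by simp [mul_comm, hVdef]
  rw [lintegral_lintegral_swap] at upper
  swap
  · exact (hFm.comp measurable_swap).aemeasurable
  have hα' : ∀ᵐ z : ℝ × Space d, volume {x : Space d | w (z.1, x) ≠ 0} ≤ α := by
    rw [Measure.volume_eq_prod]
    exact (Measure.quasiMeasurePreserving_fst (μ := (volume : Measure ℝ))
      (ν := (volume : Measure (Space d)))).ae hα
  have lower : ∀ᵐ z : ℝ × Space d, ‖w z‖ₑ ^ 2 * (V / 2) ≤ ∫⁻ y in B, F z y := by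
    filter_upwards [hα'] with z hz
    have hset : ∀ y, F z y = {y | (z, y) ∈ Z}.indicator (fun _ => ‖w z‖ₑ ^ 2) y := fun y => rfl
    have hZz : MeasurableSet {y | (z, y) ∈ Z} := measurable_prodMk_left hZm
    simp_rw [hset]
    rw [lintegral_indicator hZz, lintegral_const, Measure.restrict_apply_univ,
      Measure.restrict_apply hZz]
    gcongr
    have h1 : volume {y : Space d | (z, y) ∉ Z} ≤ α := by
      refine le_trans (le_of_eq ?_) hz
      have hmp := (Measure.measurePreserving_sub_left (volume : Measure (Space d)) z.2)
      have hms : MeasurableSet {x : Space d | w (z.1, x) ≠ 0} :=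
        (hw.comp measurable_prodMk_left) (measurableSet_singleton (0 : ℝ)).compl
      rw [← hmp.measure_preimage hms.nullMeasurableSet]
      congr 1
      ext y
      simp only [hZ, mem_ofPred_eq, mem_preimage]
      rw [show z - (0, y) = (z.1, z.2 - y) from Prod.ext (sub_zero _) rfl]
    have h2 : V ≤ volume ({y | (z, y) ∈ Z} ∩ B) + α := by
      calc V ≤ volume (({y | (z, y) ∈ Z} ∩ B) ∪ {y | (z, y) ∉ Z}) := by
            refine measure_mono fun y hy => ?_
            by_cases h : (z, y) ∈ Z
            · exact Or.inl ⟨h, hy⟩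
            · exact Or.inr h
        _ ≤ _ := (measure_union_le _ _).trans (add_le_add le_rfl h1)
    have h3 : α ≤ V / 2 := by
      rw [ENNReal.le_div_iff_mul_le (by simp) (by simp), mul_comm]; exact hV
    have h4 : V / 2 + V / 2 ≤ volume ({y | (z, y) ∈ Z} ∩ B) + V / 2 := by
      rw [ENNReal.add_halves]; exact h2.trans (add_le_add le_rfl h3)
    exact (ENNReal.add_le_add_iff_right (ENNReal.div_ne_top hVt (by simp))).1 h4
  have h5 : (∫⁻ z, ‖w z‖ₑ ^ 2) * (V / 2) ≤ V * K := by
    rw [← lintegral_mul_const _ (hw.enorm.pow_const 2)]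
    exact (lintegral_mono_ae lower).trans upper
  have h6 : V * (∫⁻ z, ‖w z‖ₑ ^ 2) ≤ V * (2 * K) := by
    calc _ = 2 * ((∫⁻ z, ‖w z‖ₑ ^ 2) * (V / 2)) := by
          rw [mul_comm, mul_left_comm, ENNReal.mul_div_cancel (by simp) (by simp)]
      _ ≤ 2 * (V * K) := by gcongr
      _ = _ := by ring
  exact (ENNReal.mul_le_mul_iff_right hV0 hVt).1 h6

end FaberKrahn

/-! ### Smooth ramps as truncations -/

section Ramp

lemma deriv_smoothTransition_of_nonpos {s : ℝ} (h : s ≤ 0) :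
    deriv Real.smoothTransition s = 0 := by
  refine IsLocalMin.deriv_eq_zero (Eventually.of_forall fun t => ?_)
  rw [Real.smoothTransition.zero_of_nonpos h]
  exact Real.smoothTransition.nonneg t

lemma deriv_smoothTransition_of_one_le {s : ℝ} (h : 1 ≤ s) :
    deriv Real.smoothTransition s = 0 := by
  refine IsLocalMax.deriv_eq_zero (Eventually.of_forall fun t => ?_)
  rw [Real.smoothTransition.one_of_one_le h]
  exact Real.smoothTransition.le_one t

lemma contDiff_smoothTransition : ContDiff ℝ 2 Real.smoothTransition :=
  Real.smoothTransition.contDiff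

lemma contDiff_deriv_smoothTransition : ContDiff ℝ 1 (deriv Real.smoothTransition) :=
  ((contDiff_succ_iff_deriv (n := 1)).1 contDiff_smoothTransition).2.2

lemma hasCompactSupport_deriv_smoothTransition :
    HasCompactSupport (deriv Real.smoothTransition) := by
  refine HasCompactSupport.intro (isCompact_Icc (a := (0 : ℝ)) (b := 1)) fun s hs => ?_
  rcases lt_or_ge s 0 with h | h
  · exact deriv_smoothTransition_of_nonpos h.le
  · refine deriv_smoothTransition_of_one_le ?_
    by_contra h1
    exact hs ⟨h, (not_le.1 h1).le⟩

lemma deriv_smoothTransition_nonneg (s : ℝ) : 0 ≤ deriv Real.smoothTransition s :=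
  Real.smoothTransition.monotone.deriv_nonneg

lemma exists_deriv_smoothTransition_le :
    ∃ L : ℝ, 1 ≤ L ∧ ∀ s, deriv Real.smoothTransition s ≤ L := by
  obtain ⟨L, hL⟩ := contDiff_deriv_smoothTransition.continuous.bounded_above_of_compact_support
    hasCompactSupport_deriv_smoothTransition
  exact ⟨max 1 L, le_max_left _ _, fun s => (le_abs_self _).trans ((hL s).trans (le_max_right _ _))⟩

lemma exists_abs_deriv_deriv_smoothTransition_le :
    ∃ L : ℝ, ∀ s, |deriv (deriv Real.smoothTransition) s| ≤ L :=
  (contDiff_deriv_smoothTransition.continuous_deriv le_rfl).bounded_above_of_compact_support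
    hasCompactSupport_deriv_smoothTransition.deriv

/-- A smooth version of `min (s - ℓ)₊ δ`: it is `0` for `s ≤ ℓ` and `δ` for `s ≥ ℓ + δ`. -/
def ramp (ℓ δ s : ℝ) : ℝ := δ * Real.smoothTransition ((s - ℓ) / δ)

/-- The derivative of `ramp ℓ δ`. -/
def rampDeriv (ℓ δ s : ℝ) : ℝ := deriv Real.smoothTransition ((s - ℓ) / δ)

/-- The primitive of `ramp ℓ δ` that vanishes for `s ≤ ℓ`. -/
def rampPrimitive (ℓ δ s : ℝ) : ℝ := ∫ t in ℓ..s, ramp ℓ δ t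

variable {ℓ δ s : ℝ}

lemma hasDerivAt_ramp (hδ : 0 < δ) : HasDerivAt (ramp ℓ δ) (rampDeriv ℓ δ s) s := by
  have h1 : HasDerivAt (fun s : ℝ => (s - ℓ) / δ) (1 / δ) s :=
    ((hasDerivAt_id s).sub_const ℓ).div_const δ
  have h2 : HasDerivAt Real.smoothTransition (rampDeriv ℓ δ s) ((s - ℓ) / δ) :=
    (contDiff_smoothTransition.differentiable (by simp) _).hasDerivAt
  have h3 := (h2.comp s h1).const_mul δ
  exact h3.congr_deriv (by field_simp)

lemma continuous_ramp (hδ : 0 < δ) : Continuous (ramp ℓ δ) :=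
  continuous_iff_continuousAt.2 fun _ => (hasDerivAt_ramp hδ).continuousAt

lemma hasDerivAt_rampPrimitive (hδ : 0 < δ) :
    HasDerivAt (rampPrimitive ℓ δ) (ramp ℓ δ s) s :=
  intervalIntegral.integral_hasDerivAt_right ((continuous_ramp hδ).intervalIntegrable _ _)
    (continuous_ramp hδ).aestronglyMeasurable.stronglyMeasurableAtFilter
    (continuous_ramp hδ).continuousAt

lemma ramp_nonneg (hδ : 0 < δ) : 0 ≤ ramp ℓ δ s :=
  mul_nonneg hδ.le (Real.smoothTransition.nonneg _)

lemma ramp_le (hδ : 0 < δ) : ramp ℓ δ s ≤ δ :=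
  mul_le_of_le_one_right hδ.le (Real.smoothTransition.le_one _)

lemma ramp_of_le (hδ : 0 < δ) (h : s ≤ ℓ) : ramp ℓ δ s = 0 := by
  rw [ramp, Real.smoothTransition.zero_of_nonpos (div_nonpos_of_nonpos_of_nonneg (by linarith) hδ.le),
    mul_zero]

lemma ramp_of_ge (hδ : 0 < δ) (h : ℓ + δ ≤ s) : ramp ℓ δ s = δ := by
  rw [ramp, Real.smoothTransition.one_of_one_le, mul_one]
  rw [le_div_iff₀ hδ]; linarith

lemma rampDeriv_nonneg : 0 ≤ rampDeriv ℓ δ s := deriv_smoothTransition_nonneg _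

lemma rampDeriv_of_le (hδ : 0 < δ) (h : s ≤ ℓ) : rampDeriv ℓ δ s = 0 :=
  deriv_smoothTransition_of_nonpos (div_nonpos_of_nonpos_of_nonneg (by linarith) hδ.le)

lemma rampPrimitive_of_le (hδ : 0 < δ) (h : s ≤ ℓ) : rampPrimitive ℓ δ s = 0 := by
  rw [rampPrimitive, intervalIntegral.integral_congr (g := fun _ => 0)]
  · simp
  · intro t ht
    rw [uIcc_of_ge h] at ht
    exact ramp_of_le hδ ht.2

/-- `S²/(2L) ≤ Φ`, since the derivative `S S'/L` of the left side is at most `S = Φ'`. -/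
lemma sq_ramp_le (hδ : 0 < δ) {L : ℝ}
    (hL : ∀ s, deriv Real.smoothTransition s ≤ L) :
    ramp ℓ δ s ^ 2 ≤ 2 * L * rampPrimitive ℓ δ s := by
  have hder : ∀ s, HasDerivAt (fun s => 2 * L * rampPrimitive ℓ δ s - ramp ℓ δ s ^ 2)
      (2 * L * ramp ℓ δ s - 2 * ramp ℓ δ s * rampDeriv ℓ δ s) s := by
    intro s
    have := ((hasDerivAt_rampPrimitive (ℓ := ℓ) (s := s) hδ).const_mul (2 * L)).sub
      ((hasDerivAt_ramp (ℓ := ℓ) (s := s) hδ).pow 2)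
    exact this.congr_deriv (by norm_num)
  have hmono := monotone_of_hasDerivAt_nonneg hder fun s => by
    have h1 := ramp_nonneg (ℓ := ℓ) (s := s) hδ
    have h2 : rampDeriv ℓ δ s ≤ L := hL _
    have := mul_le_mul_of_nonneg_left h2 h1
    simp only [Pi.zero_apply]; linarith
  rcases le_total s ℓ with h | h
  · simp [ramp_of_le hδ h, rampPrimitive_of_le hδ h]
  · have := hmono h
    simp only [ramp_of_le hδ le_rfl, rampPrimitive_of_le hδ le_rfl] at this
    linarith

lemma rampPrimitive_nonneg (hδ : 0 < δ) : 0 ≤ rampPrimitive ℓ δ s := by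
  obtain ⟨L, hL1, hL⟩ := exists_deriv_smoothTransition_le
  have h1 := sq_ramp_le (ℓ := ℓ) (s := s) hδ hL
  have h2 : 0 ≤ 2 * L * rampPrimitive ℓ δ s := (sq_nonneg _).trans h1
  by_contra h
  have : 2 * L * rampPrimitive ℓ δ s < 0 := mul_neg_of_pos_of_neg (by linarith) (not_le.1 h)
  linarith

/-- A Lipschitz function vanishing up to `ℓ > 0` varies only where `|a| + |b| ≥ ℓ`. -/
lemma abs_sub_le_of_vanishing {F F' : ℝ → ℝ} {M : ℝ} (hℓ : 0 < ℓ)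
    (hF : ∀ s, HasDerivAt F (F' s) s) (hM : ∀ s, |F' s| ≤ M) (h0 : ∀ s ≤ ℓ, F s = 0) (a b : ℝ) :
    |F a - F b| ≤ M / ℓ * ((|a| + |b|) * |a - b|) := by
  have hM0 : 0 ≤ M := (abs_nonneg _).trans (hM 0)
  have hlip : |F a - F b| ≤ M * |a - b| :=
    convex_univ.norm_image_sub_le_of_norm_hasDerivWithin_le
      (fun s _ => (hF s).hasDerivWithinAt) (fun s _ => hM s) (mem_univ b) (mem_univ a)
  by_cases h : a ≤ ℓ ∧ b ≤ ℓ
  · rw [h0 a h.1, h0 b h.2, sub_self, abs_zero]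
    positivity
  · have hab : ℓ ≤ |a| + |b| := by
      by_contra hlt
      have h1 := le_abs_self a
      have h2 := le_abs_self b
      have h3 := abs_nonneg a
      have h4 := abs_nonneg b
      exact h ⟨by linarith, by linarith⟩
    refine hlip.trans ?_
    calc M * |a - b| = M / ℓ * (ℓ * |a - b|) := by field_simp
      _ ≤ _ := by gcongr

lemma exists_isTruncation_ramp (hℓ : 0 < ℓ) (hδ : 0 < δ) :
    ∃ C, IsTruncation (rampPrimitive ℓ δ) (ramp ℓ δ) (rampDeriv ℓ δ) C := by
  obtain ⟨L, hL1, hL⟩ := exists_deriv_smoothTransition_le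
  obtain ⟨L', hL'⟩ := exists_abs_deriv_deriv_smoothTransition_le
  have hS : ∀ s, |ramp ℓ δ s| ≤ δ := fun s => by
    rw [abs_of_nonneg (ramp_nonneg hδ)]; exact ramp_le hδ
  have hS' : ∀ s, |rampDeriv ℓ δ s| ≤ L := fun s => by
    rw [abs_of_nonneg rampDeriv_nonneg]; exact hL _
  have hd2 : ∀ s, HasDerivAt (rampDeriv ℓ δ)
      (deriv (deriv Real.smoothTransition) ((s - ℓ) / δ) * (1 / δ)) s := fun s => by
    have h1 : HasDerivAt (fun s : ℝ => (s - ℓ) / δ) (1 / δ) s :=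
      ((hasDerivAt_id s).sub_const ℓ).div_const δ
    have h2 := (contDiff_deriv_smoothTransition.differentiable (by simp) ((s - ℓ) / δ)).hasDerivAt
    exact h2.comp s h1
  have hS'' : ∀ s, |deriv (deriv Real.smoothTransition) ((s - ℓ) / δ) * (1 / δ)|
      ≤ L' * (1 / δ) := fun s => by
    rw [abs_mul, abs_of_pos (by positivity : 0 < 1 / δ)]
    gcongr; exact hL' _
  have b1 := abs_sub_le_of_vanishing hℓ (fun s => hasDerivAt_rampPrimitive (ℓ := ℓ) (s := s) hδ) hS
    (fun s h => rampPrimitive_of_le hδ h)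
  have b2 := abs_sub_le_of_vanishing hℓ (fun s => hasDerivAt_ramp (ℓ := ℓ) (s := s) hδ) hS'
    (fun s h => ramp_of_le hδ h)
  have b3 := abs_sub_le_of_vanishing hℓ hd2 hS'' (fun s h => rampDeriv_of_le hδ h)
  set C := max (max δ L) (max (δ / ℓ) (max (L / ℓ) (L' * (1 / δ) / ℓ))) with hC
  have hnn : ∀ a b : ℝ, 0 ≤ (|a| + |b|) * |a - b| := fun a b => by positivity
  exact ⟨C, {
    hasDerivAt_primitive := fun s => hasDerivAt_rampPrimitive hδ
    hasDerivAt := fun s => hasDerivAt_ramp hδ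
    continuous_deriv := continuous_iff_continuousAt.2 fun s => (hd2 s).continuousAt
    primitive_zero := rampPrimitive_of_le hδ hℓ.le
    zero := ramp_of_le hδ hℓ.le
    deriv_zero := rampDeriv_of_le hδ hℓ.le
    abs_le := fun s => (hS s).trans (by simp [hC])
    abs_deriv_le := fun s => (hS' s).trans (by simp [hC])
    primitive_sub_le := fun a b => (b1 a b).trans
      (mul_le_mul_of_nonneg_right (by simp [hC]) (hnn a b))
    sub_le := fun a b => (b2 a b).trans (mul_le_mul_of_nonneg_right (by simp [hC]) (hnn a b))
    deriv_sub_le := fun a b => (b3 a b).trans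
      (mul_le_mul_of_nonneg_right (by simp only [hC, le_max_iff, le_refl, or_true]) (hnn a b)) }⟩

end Ramp

/-! ### The measure of level sets -/

section LevelSets

variable {d : ℕ} {b η p k : ℝ} {u f : ℝ × Space d → ℝ} {g G h : ℝ × Space d → Space d}

lemma setIntegral_norm_le_eLpNorm {F : Type*} [NormedAddCommGroup F] {v : ℝ × Space d → F}
    {q : ℝ} (hq : 1 ≤ q) (hv : MemLp v (ENNReal.ofReal q) volume) {A : Set (ℝ × Space d)}
    (hA : volume A ≠ ∞) :
    ∫ z in A, ‖v z‖ ≤ (eLpNorm v (ENNReal.ofReal q) volume).toReal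
      * volume.real A ^ (1 - 1 / q) := by
  have hexp : (0 : ℝ) ≤ 1 - 1 / q := by
    rw [sub_nonneg, div_le_one (by linarith)]; exact hq
  have h1 := eLpNorm_le_eLpNorm_mul_rpow_measure_univ (μ := volume.restrict A) (f := v) (p := 1)
    (q := ENNReal.ofReal q) (by simpa using hq) hv.1.restrict
  rw [ENNReal.toReal_ofReal (by linarith), Measure.restrict_apply_univ, ENNReal.toReal_one,
    div_one] at h1
  have h2 : eLpNorm v 1 (volume.restrict A)
      ≤ eLpNorm v (ENNReal.ofReal q) volume * volume A ^ (1 - 1 / q) :=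
    h1.trans (by gcongr; exact Measure.restrict_le_self)
  rw [integral_norm_eq_lintegral_enorm hv.1.restrict, ← eLpNorm_one_eq_lintegral_enorm,
    Measure.real, ENNReal.toReal_rpow, ← ENNReal.toReal_mul]
  exact ENNReal.toReal_mono
    (ENNReal.mul_ne_top hv.2.ne (ENNReal.rpow_ne_top_of_nonneg hexp hA)) h2

lemma setIntegral_sq_le_eLpNorm {v : ℝ × Space d → Space d}
    {q : ℝ} (hq : 2 ≤ q) (hv : MemLp v (ENNReal.ofReal q) volume) {A : Set (ℝ × Space d)}
    (hA : volume A ≠ ∞) :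
    ∫ z in A, ‖v z‖ ^ 2 ≤ (eLpNorm v (ENNReal.ofReal q) volume).toReal ^ 2
      * volume.real A ^ (1 - 2 / q) := by
  have hexp : (0 : ℝ) ≤ 1 / 2 - 1 / q := by
    rw [sub_nonneg]; gcongr
  have h1 := eLpNorm_le_eLpNorm_mul_rpow_measure_univ (μ := volume.restrict A) (f := v) (p := 2)
    (q := ENNReal.ofReal q) (by simpa using hq) hv.1.restrict
  rw [ENNReal.toReal_ofReal (by linarith), Measure.restrict_apply_univ, ENNReal.toReal_ofNat] at h1
  have h2 : eLpNorm v 2 (volume.restrict A) ^ 2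
      ≤ (eLpNorm v (ENNReal.ofReal q) volume * volume A ^ (1 / 2 - 1 / q)) ^ 2 :=
    pow_le_pow_left' (h1.trans (by gcongr; exact Measure.restrict_le_self)) 2
  have h3 : ∫ z in A, ‖v z‖ ^ 2 = (eLpNorm v 2 (volume.restrict A) ^ 2).toReal := by
    rw [eLpNorm_two_sq, integral_eq_lintegral_of_nonneg_ae
      (Eventually.of_forall fun z => sq_nonneg _) (hv.1.restrict.norm.pow 2)]
    congr 1
    refine lintegral_congr fun z => ?_
    rw [ENNReal.ofReal_pow (norm_nonneg _), ofReal_norm]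
  rw [h3]
  refine (ENNReal.toReal_mono (ENNReal.pow_ne_top (ENNReal.mul_ne_top hv.2.ne
    (ENNReal.rpow_ne_top_of_nonneg hexp hA))) h2).trans (le_of_eq ?_)
  rw [ENNReal.toReal_pow, ENNReal.toReal_mul, ← ENNReal.toReal_rpow, mul_pow, Measure.real,
    ← Real.rpow_natCast (_ ^ (1 / 2 - 1 / q)), ← Real.rpow_mul ENNReal.toReal_nonneg]
  congr 2
  push_cast; ring

lemma volume_superlevel_lt_top (hu : MemLp u 2 volume) {ℓ : ℝ} (hℓ : 0 < ℓ) :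
    volume {z | ℓ < u z} < ∞ := by
  have h1 := hu.integrable_sq.measure_ge_lt_top (ε := ℓ ^ 2) (by positivity)
  refine (measure_mono fun z hz => ?_).trans_lt h1
  have hz : ℓ < u z := hz
  simp only [mem_ofPred_eq]
  gcongr

/-- The right-hand side of the energy estimates in terms of the measure of the level set. -/
lemma energyBound_ramp_le (hη : 0 < η) (hk : 2 < k) (hum : Measurable u) (hu : MemLp u 2 volume)
    (hf : MemLp f (ENNReal.ofReal (k / 2)) volume) (hh : MemLp h (ENNReal.ofReal k) volume)
    {L : ℝ} (hL1 : 1 ≤ L) (hL : ∀ s, deriv Real.smoothTransition s ≤ L)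
    {ℓ δ : ℝ} (hℓ : 0 < ℓ) (hδ : 0 < δ) :
    energyBound η (ramp ℓ δ) (rampDeriv ℓ δ) u f h
      ≤ (δ * (eLpNorm f (ENNReal.ofReal (k / 2)) volume).toReal
          + L / (2 * η) * (eLpNorm h (ENNReal.ofReal k) volume).toReal ^ 2)
        * volume.real {z | ℓ < u z} ^ (1 - 2 / k) := by
  set A := {z | ℓ < u z} with hA
  have hAm : MeasurableSet A := measurableSet_lt measurable_const hum
  have hAt : volume A ≠ ∞ := (volume_superlevel_lt_top hu hℓ).ne
  have : IsFiniteMeasure (volume.restrict A) := ⟨by simpa using hAt.lt_top⟩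
  have i1 : Integrable (fun z => ‖f z‖) (volume.restrict A) :=
    ((hf.restrict A).integrable (by simp; linarith)).norm
  have i2 : Integrable (fun z => ‖h z‖ ^ 2) (volume.restrict A) :=
    ((hh.restrict A).mono_exponent (p := 2) (by simpa using hk.le)).integrable_norm_pow
      (by norm_num)
  have hL0 : 0 ≤ L / (2 * η) := by positivity
  have hle : energyBound η (ramp ℓ δ) (rampDeriv ℓ δ) u f h
      ≤ ∫ z in A, (δ * ‖f z‖ + L / (2 * η) * ‖h z‖ ^ 2) := by
    rw [energyBound, ← integral_indicator hAm]
    refine integral_mono_of_nonneg (Eventually.of_forall fun z => ?_)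
      ((integrable_indicator_iff hAm).2 ((i1.const_mul δ).add (i2.const_mul (L / (2 * η)))))
      (Eventually.of_forall fun z => ?_)
    · have h1 : 0 ≤ ∑ i, h z i * h z i := Finset.sum_nonneg fun i _ => mul_self_nonneg _
      have h2 := ramp_nonneg (ℓ := ℓ) (s := u z) hδ
      have h3 := rampDeriv_nonneg (ℓ := ℓ) (δ := δ) (s := u z)
      simp only [Pi.zero_apply]; positivity
    · have hsum : ∑ i, h z i * h z i = ‖h z‖ ^ 2 := by
        rw [EuclideanSpace.real_norm_sq_eq]; exact Finset.sum_congr rfl fun i _ => (sq _).symm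
      simp only
      rw [hsum]
      by_cases hz : z ∈ A
      · rw [indicator_of_mem hz, Real.norm_eq_abs]
        have e1 : rampDeriv ℓ δ (u z) ≤ L := hL _
        have e2 := mul_le_mul_of_nonneg_right (ramp_le (ℓ := ℓ) (s := u z) hδ) (abs_nonneg (f z))
        have e3 : 1 / (2 * η) * (rampDeriv ℓ δ (u z) * ‖h z‖ ^ 2)
            ≤ 1 / (2 * η) * (L * ‖h z‖ ^ 2) := by gcongr
        have e4 : 1 / (2 * η) * (L * ‖h z‖ ^ 2) = L / (2 * η) * ‖h z‖ ^ 2 := by ring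
        linarith
      · have hz' : u z ≤ ℓ := not_lt.1 hz
        rw [indicator_of_notMem hz, ramp_of_le hδ hz', rampDeriv_of_le hδ hz']
        simp
  refine hle.trans ?_
  rw [integral_add (i1.const_mul δ) (i2.const_mul _), integral_const_mul, integral_const_mul]
  have h1 := setIntegral_norm_le_eLpNorm (by linarith) hf hAt
  have h2 := setIntegral_sq_le_eLpNorm hk.le hh hAt
  rw [show 1 - 1 / (k / 2) = 1 - 2 / k by field_simp] at h1
  calc _ ≤ δ * ((eLpNorm f (ENNReal.ofReal (k / 2)) volume).toReal
          * volume.real A ^ (1 - 2 / k))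
        + L / (2 * η) * ((eLpNorm h (ENNReal.ofReal k) volume).toReal ^ 2
          * volume.real A ^ (1 - 2 / k)) := by gcongr
    _ = _ := by ring

/-! ### One step of De Giorgi's iteration -/

section Slices

variable (H : IsGlobalSolution d b η (ENNReal.ofReal p) (ENNReal.ofReal (k / 2))
  (ENNReal.ofReal k) u f g G h)
include H

/-- Chebyshev's inequality on time slices, for the energy of the truncation `ramp ℓ δ`. -/
lemma IsGlobalSolution.ae_volume_slice_le (hη : 0 < η) (hp : 2 < p) (hk : 2 < k)
    {L : ℝ} (hL1 : 1 ≤ L) (hL : ∀ s, deriv Real.smoothTransition s ≤ L)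
    {ℓ δ : ℝ} (hℓ : 0 < ℓ) (hδ : 0 < δ) :
    ∀ᵐ t : ℝ, volume {x : Space d | ℓ + δ < u (t, x)}
      ≤ ENNReal.ofReal (2 * L * energyBound η (ramp ℓ δ) (rampDeriv ℓ δ) u f h / δ ^ 2) := by
  obtain ⟨C, hS⟩ := exists_isTruncation_ramp hℓ hδ
  have h1 := H.ae_integral_primitive_le hη (by simpa using hp) (by simp)
    (by simp; linarith) (by simp) (by simpa using hk) (by simp) hS (fun _ => ramp_nonneg hδ)
    (fun _ => rampDeriv_nonneg)
  have hΦ1 : Integrable (fun z => rampPrimitive ℓ δ (u z)) := memLp_one_iff_integrable.1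
    ((TendstoLp.const H.memLp_two).comp_one hS.continuous_primitive hS.primitive_zero
      hS.primitive_sub_le).memLp
  have hΦ2 : Integrable (fun z => rampPrimitive ℓ δ (u z)) ((volume : Measure ℝ).prod volume) :=
    hΦ1
  filter_upwards [h1, hΦ2.prod_right_ae] with t ht hint
  rcases le_or_gt b t with htb | htb
  · have : {x : Space d | ℓ + δ < u (t, x)} = ∅ := by
      ext x
      simp only [H.zero_after (t, x) htb, mem_ofPred_eq, mem_empty_iff_false, iff_false]
      linarith
    simp [this]
  · have hR := ht htb
    set R := energyBound η (ramp ℓ δ) (rampDeriv ℓ δ) u f h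
    have hsub : {x : Space d | ℓ + δ < u (t, x)}
        ⊆ {x | ENNReal.ofReal (δ ^ 2) ≤ ENNReal.ofReal (2 * L * rampPrimitive ℓ δ (u (t, x)))} := by
      intro x hx
      have hx : ℓ + δ < u (t, x) := hx
      refine ENNReal.ofReal_le_ofReal ?_
      have := sq_ramp_le (ℓ := ℓ) (s := u (t, x)) hδ hL
      rwa [ramp_of_ge hδ hx.le] at this
    have hδ2 : ENNReal.ofReal (δ ^ 2) ≠ 0 := by
      rw [Ne, ENNReal.ofReal_eq_zero, not_le]; positivity
    refine (measure_mono hsub).trans ((meas_ge_le_lintegral_div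
      (hint.1.aemeasurable.const_mul (2 * L)).ennreal_ofReal hδ2 ENNReal.ofReal_ne_top).trans ?_)
    rw [← ofReal_integral_eq_lintegral_ofReal (hint.const_mul _)
      (Eventually.of_forall fun x => mul_nonneg (by linarith) (rampPrimitive_nonneg hδ)),
      integral_const_mul, ENNReal.ofReal_div_of_pos (by positivity)]
    gcongr

lemma IsGlobalSolution.weak_spatial (hp : 2 < p) (y : Space d) (ψ : ℝ × Space d → ℝ)
    (hψ : IsTest univ ψ) :
    ∫ z, u z * fderiv ℝ ψ z (0, y) = -∫ z, (∑ i, y i * g z i) * ψ z := by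
  have hdir : ((0, y) : ℝ × Space d) = ∑ i, y i • spaceDir i := by
    refine Prod.ext (by simp [spaceDir, Prod.fst_sum]) ?_
    rw [Prod.snd_sum]
    ext j
    simp [spaceDir, Finset.sum_apply, Pi.single_apply]
  have hp1 : (1 : ℝ≥0∞) ≤ ENNReal.ofReal p := by simp; linarith
  have i1 : ∀ i, Integrable fun z => u z * fderiv ℝ ψ z (spaceDir i) := fun i => by
    have hc : Continuous fun z => fderiv ℝ ψ z (spaceDir i) :=
      (hψ.contDiff.continuous_fderiv (by simp)).clm_apply continuous_const
    have hs : HasCompactSupport fun z => fderiv ℝ ψ z (spaceDir i) :=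
      (hψ.hasCompactSupport.fderiv (𝕜 := ℝ)).comp_left
        (g := fun L : (ℝ × Space d) →L[ℝ] ℝ => L (spaceDir i)) rfl
    exact H.memLp_two.integrable_mul (hc.memLp_of_hasCompactSupport (p := 2) hs)
  have i2 : ∀ i, Integrable fun z => g z i * ψ z := fun i => by
    have : Fact (1 ≤ ENNReal.ofReal p) := ⟨hp1⟩
    exact integrable_mul_of_conj (memLp_coord H.memLp_grad i)
      (hψ.contDiff.continuous.memLp_of_hasCompactSupport hψ.hasCompactSupport)
  have e1 : ∀ z, u z * fderiv ℝ ψ z (0, y) = ∑ i, y i * (u z * fderiv ℝ ψ z (spaceDir i)) := by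
    intro z
    rw [hdir, map_sum, Finset.mul_sum]
    refine Finset.sum_congr rfl fun i _ => ?_
    rw [map_smul, smul_eq_mul]; ring
  have e2 : ∀ z, (∑ i, y i * g z i) * ψ z = ∑ i, y i * (g z i * ψ z) := by
    intro z
    rw [Finset.sum_mul]
    exact Finset.sum_congr rfl fun i _ => by ring
  simp_rw [e1, e2]
  rw [integral_finsetSum _ fun i _ => (i1 i).const_mul _,
    integral_finsetSum _ fun i _ => (i2 i).const_mul _, ← Finset.sum_neg_distrib]
  refine Finset.sum_congr rfl fun i _ => ?_
  rw [integral_const_mul, integral_const_mul, H.grad i ψ hψ, mul_neg]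

/-- Translations of a truncation in space by less than `ρ` are controlled by `ρ` and the energy. -/
lemma IsGlobalSolution.lintegral_translate_le (hη : 0 < η) (hp : 2 < p) (hk : 2 < k)
    {L : ℝ} (hL1 : 1 ≤ L) (hL : ∀ s, deriv Real.smoothTransition s ≤ L)
    {ℓ δ ρ : ℝ} (hℓ : 0 < ℓ) (hδ : 0 < δ) {y : Space d} (hy : y ∈ Metric.ball 0 ρ) :
    ∫⁻ z, ‖ramp ℓ δ (u z) - ramp ℓ δ (u (z - (0, y)))‖ₑ ^ 2
      ≤ ENNReal.ofReal (ρ ^ 2 * L * (2 / η * energyBound η (ramp ℓ δ) (rampDeriv ℓ δ) u f h)) := by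
  obtain ⟨C, hS⟩ := exists_isTruncation_ramp hℓ hδ
  have hp2 : 2 < ENNReal.ofReal p := by simpa using hp
  have hgi : ∀ i, MemLp (fun z => g z i) (ENNReal.ofReal p) volume := memLp_coord H.memLp_grad
  have hvy : MemLp (fun z => ∑ i, y i * g z i) (ENNReal.ofReal p) volume :=
    memLp_finsetSum _ fun i _ => (hgi i).const_mul (y i)
  have h1 := eLpNorm_sub_translate_le hp2 (by simp) H.memLp_two hvy (H.weak_spatial hp y) hS
  have hE := H.integral_grad_le hη hp2 (by simp)
    (by simp; linarith) (by simp) (by simpa using hk) (by simp) hS (fun _ => ramp_nonneg hδ)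
    (fun _ => rampDeriv_nonneg) (fun _ => rampPrimitive_nonneg hδ)
  set R := energyBound η (ramp ℓ δ) (rampDeriv ℓ δ) u f h
  have hint : Integrable fun z => rampDeriv ℓ δ (u z) * ∑ i, g z i * g z i := by
    refine (integrable_finsetSum Finset.univ fun i _ =>
      hS.integrable_deriv_mul H.memLp_two hp2 hp2 (hgi i) (hgi i)).congr
      (Eventually.of_forall fun z => ?_)
    simp only [Finset.mul_sum]
  rw [← eLpNorm_two_sq]
  refine (pow_le_pow_left' h1 2).trans ?_
  rw [eLpNorm_two_sq]
  have hρ : ‖y‖ ≤ ρ := by rw [mem_ball_zero_iff] at hy; exact hy.le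
  have hpt : ∀ z, ‖rampDeriv ℓ δ (u z) * ∑ i, y i * g z i‖ₑ ^ 2
      ≤ ENNReal.ofReal (ρ ^ 2 * L * (rampDeriv ℓ δ (u z) * ∑ i, g z i * g z i)) := by
    intro z
    rw [← ofReal_norm, ← ENNReal.ofReal_pow (norm_nonneg _)]
    refine ENNReal.ofReal_le_ofReal ?_
    rw [Real.norm_eq_abs, sq_abs, mul_pow]
    have hcs : (∑ i, y i * g z i) ^ 2 ≤ ρ ^ 2 * ∑ i, g z i * g z i := by
      refine (Finset.sum_mul_sq_le_sq_mul_sq _ _ _).trans ?_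
      rw [← EuclideanSpace.real_norm_sq_eq]
      simp only [← sq]
      gcongr
    have h0 := rampDeriv_nonneg (ℓ := ℓ) (δ := δ) (s := u z)
    have hle : rampDeriv ℓ δ (u z) ≤ L := hL _
    have hg0 : 0 ≤ ∑ i, g z i * g z i := Finset.sum_nonneg fun i _ => mul_self_nonneg _
    calc rampDeriv ℓ δ (u z) ^ 2 * (∑ i, y i * g z i) ^ 2
        ≤ (L * rampDeriv ℓ δ (u z)) * (ρ ^ 2 * ∑ i, g z i * g z i) := by
          refine mul_le_mul ?_ hcs (sq_nonneg _) (by positivity)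
          rw [sq]; gcongr
      _ = _ := by ring
  refine (lintegral_mono hpt).trans ?_
  rw [← ofReal_integral_eq_lintegral_ofReal (hint.const_mul _), integral_const_mul]
  · refine ENNReal.ofReal_le_ofReal (mul_le_mul_of_nonneg_left ?_ (by positivity))
    rw [div_mul_eq_mul_div, le_div_iff₀ hη]
    linarith
  · refine Eventually.of_forall fun z => ?_
    have := rampDeriv_nonneg (ℓ := ℓ) (δ := δ) (s := u z)
    have hg0 : 0 ≤ ∑ i, g z i * g z i := Finset.sum_nonneg fun i _ => mul_self_nonneg _
    simp only [Pi.zero_apply]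
    positivity

/-- One De Giorgi step. The energy at the level `ℓ` bounds the time slices of the level set
`{u > ℓ + δ}`; the Faber–Krahn inequality for the truncation at the level `ℓ + δ` then gains the
factor `a^{2/d}`, for `a` the measure of `{u > ℓ}`. -/
theorem IsGlobalSolution.deGiorgi_step (hd : 1 ≤ d) (hη : 0 < η) (hp : 2 < p) (hk : 2 < k)
    {L : ℝ} (hL1 : 1 ≤ L) (hL : ∀ s, deriv Real.smoothTransition s ≤ L)
    {ℓ δ K : ℝ} (hℓ : 0 < ℓ) (hδ : 0 < δ) (hδK : δ ≤ K)
    (hF : (eLpNorm f (ENNReal.ofReal (k / 2)) volume).toReal ≤ K)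
    (hH : (eLpNorm h (ENNReal.ofReal k) volume).toReal ≤ K) :
    volume.real {z | ℓ + 2 * δ < u z}
      ≤ 4 * L / η * (1 + L / (2 * η)) * (4 * L * (1 + L / (2 * η))
          / volume.real (Metric.ball (0 : Space d) 1)) ^ (2 / (d : ℝ))
        * (K / δ) ^ (2 + 4 / (d : ℝ))
        * volume.real {z | ℓ < u z} ^ ((1 - 2 / k) * (1 + 2 / (d : ℝ))) := by
  set c := 1 + L / (2 * η) with hc
  set ω := volume.real (Metric.ball (0 : Space d) 1) with hω
  set a := volume.real {z | ℓ < u z} with ha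
  have hK0 : 0 < K := hδ.trans_le hδK
  have hc0 : 0 < c := by positivity
  have hd0 : (0 : ℝ) < d := by exact_mod_cast hd
  have hω0 : 0 < ω := ENNReal.toReal_pos (Metric.measure_ball_pos volume _ one_pos).ne'
    measure_ball_lt_top.ne
  have hγ : 0 < 1 - 2 / k := by
    rw [sub_pos, div_lt_one (by linarith)]; exact hk
  have hat : volume {z | ℓ < u z} ≠ ∞ := (volume_superlevel_lt_top H.memLp_two hℓ).ne
  have ha0 : 0 ≤ a := measureReal_nonneg
  have hmono : volume.real {z | ℓ + 2 * δ < u z} ≤ a :=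
    measureReal_mono (fun z hz => by
      have hz : ℓ + 2 * δ < u z := hz
      simp only [mem_ofPred_eq]; linarith) hat
  rcases ha0.eq_or_lt with ha00 | hapos
  · rw [← ha00] at hmono
    exact hmono.trans (by positivity)
  -- Both energies are bounded by `c K² a^{1 - 2/k}`.
  have hbound : ∀ a' : ℝ, 0 ≤ a' → a' ≤ a →
      (δ * (eLpNorm f (ENNReal.ofReal (k / 2)) volume).toReal
          + L / (2 * η) * (eLpNorm h (ENNReal.ofReal k) volume).toReal ^ 2) * a' ^ (1 - 2 / k)
        ≤ c * K ^ 2 * a ^ (1 - 2 / k) := by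
    intro a' h0 h1
    have e1 : δ * (eLpNorm f (ENNReal.ofReal (k / 2)) volume).toReal ≤ K * K := by
      gcongr
    have e2 : L / (2 * η) * (eLpNorm h (ENNReal.ofReal k) volume).toReal ^ 2
        ≤ L / (2 * η) * K ^ 2 := by gcongr
    have e3 : a' ^ (1 - 2 / k) ≤ a ^ (1 - 2 / k) := by gcongr
    refine mul_le_mul ?_ e3 (by positivity) (by positivity)
    rw [hc]; linarith
  have hR1 := (energyBound_ramp_le hη hk H.measurable H.memLp_two H.memLp_source H.memLp_field hL1
    hL hℓ hδ).trans (hbound a ha0 le_rfl)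
  have hR2 := (energyBound_ramp_le hη hk H.measurable H.memLp_two H.memLp_source H.memLp_field hL1
    hL (show 0 < ℓ + δ by linarith) hδ).trans (hbound _ measureReal_nonneg
      (measureReal_mono (fun z hz => by
        have hz : ℓ + δ < u z := hz
        simp only [mem_ofPred_eq]; linarith) hat))
  set R := c * K ^ 2 * a ^ (1 - 2 / k) with hR
  have hRpos : 0 < R := by positivity
  -- The radius is chosen such that the ball has twice the measure of the slices.
  set α := 2 * L * R / δ ^ 2 with hα
  have hα0 : 0 < α := by positivity
  set ρ := (2 * α / ω) ^ (1 / (d : ℝ)) with hρ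
  have hρ0 : 0 < ρ := by positivity
  have hρd : ρ ^ d = 2 * α / ω := by
    rw [hρ, ← Real.rpow_natCast, ← Real.rpow_mul (by positivity), one_div,
      inv_mul_cancel₀ hd0.ne', Real.rpow_one]
  have hball : 2 * ENNReal.ofReal α ≤ volume (Metric.ball (0 : Space d) ρ) := by
    have h2α : 2 * ENNReal.ofReal α = ENNReal.ofReal (2 * α) := by
      rw [ENNReal.ofReal_mul (by norm_num), ENNReal.ofReal_ofNat]
    rw [h2α, Measure.addHaar_ball_of_pos volume _ hρ0, finrank_euclideanSpace_fin, hρd,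
      ← ENNReal.ofReal_toReal (a := volume (Metric.ball (0 : Space d) 1)) measure_ball_lt_top.ne,
      ← ENNReal.ofReal_mul (by positivity)]
    refine ENNReal.ofReal_le_ofReal (le_of_eq ?_)
    change 2 * α = 2 * α / ω * ω
    field_simp
  have hw : Measurable fun z => ramp (ℓ + δ) δ (u z) :=
    (continuous_ramp hδ).measurable.comp H.measurable
  have hFK := lintegral_sq_le_of_translate hw hρ0 (α := ENNReal.ofReal α)
    (K := ENNReal.ofReal (ρ ^ 2 * L * (2 / η * R)))
    (fun y hy => (H.lintegral_translate_le hη hp hk hL1 hL (show 0 < ℓ + δ by linarith) hδ hy).trans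
      (ENNReal.ofReal_le_ofReal (by gcongr)))
    (by
      filter_upwards [H.ae_volume_slice_le hη hp hk hL1 hL hℓ hδ] with t ht
      refine (measure_mono fun x hx => ?_).trans (ht.trans (ENNReal.ofReal_le_ofReal (by
        rw [hα]; gcongr)))
      by_contra hle
      exact hx (ramp_of_le hδ (not_lt.1 hle)))
    hball
  have hcheb : ENNReal.ofReal (δ ^ 2) * volume {z | ℓ + 2 * δ < u z}
      ≤ ENNReal.ofReal (2 * (ρ ^ 2 * L * (2 / η * R))) := by
    rw [ENNReal.ofReal_mul (by norm_num), ENNReal.ofReal_ofNat]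
    refine le_trans ?_ hFK
    refine le_trans (mul_le_mul_right (measure_mono fun z hz => ?_) _)
      (mul_meas_ge_le_lintegral (hw.enorm.pow_const 2) (ENNReal.ofReal (δ ^ 2)))
    have hz : ℓ + 2 * δ < u z := hz
    change ENNReal.ofReal (δ ^ 2) ≤ ‖ramp (ℓ + δ) δ (u z)‖ₑ ^ 2
    rw [ramp_of_ge hδ (by linarith), ← ofReal_norm, Real.norm_of_nonneg hδ.le,
      ENNReal.ofReal_pow hδ.le]
  have hcheb' : δ ^ 2 * volume.real {z | ℓ + 2 * δ < u z} ≤ 2 * (ρ ^ 2 * L * (2 / η * R)) := by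
    have := ENNReal.toReal_mono ENNReal.ofReal_ne_top hcheb
    rwa [ENNReal.toReal_mul, ENNReal.toReal_ofReal (by positivity),
      ENNReal.toReal_ofReal (by positivity)] at this
  have hρ2 : ρ ^ 2 = (4 * L * c / ω) ^ (2 / (d : ℝ)) * (K / δ) ^ (4 / (d : ℝ))
      * a ^ ((1 - 2 / k) * (2 / (d : ℝ))) := by
    have h1 : 2 * α / ω = (4 * L * c / ω) * (K / δ) ^ 2 * a ^ (1 - 2 / k) := by
      rw [hα, hR]; field_simp; ring
    have h2 : ρ ^ 2 = (2 * α / ω) ^ (2 / (d : ℝ)) := by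
      rw [hρ, ← Real.rpow_natCast, ← Real.rpow_mul (by positivity)]
      congr 1; push_cast; ring
    have h3 : ((K / δ) ^ 2) ^ (2 / (d : ℝ)) = (K / δ) ^ (4 / (d : ℝ)) := by
      rw [← Real.rpow_natCast (K / δ), ← Real.rpow_mul (by positivity)]
      congr 1; push_cast; ring
    rw [h2, h1, Real.mul_rpow (by positivity) (by positivity),
      Real.mul_rpow (by positivity) (by positivity), h3, ← Real.rpow_mul ha0]
  have hKδ : 0 < K / δ := by positivity
  have hfin : volume.real {z | ℓ + 2 * δ < u z} ≤ 4 * L / η * c * ρ ^ 2 * (K / δ) ^ 2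
      * a ^ (1 - 2 / k) := by
    rw [mul_comm, ← le_div_iff₀ (by positivity)] at hcheb'
    refine hcheb'.trans (le_of_eq ?_)
    rw [hR]; field_simp; ring
  refine hfin.trans (le_of_eq ?_)
  rw [hρ2, Real.rpow_add hKδ, show (1 - 2 / k) * (1 + 2 / (d : ℝ))
    = (1 - 2 / k) * (2 / (d : ℝ)) + (1 - 2 / k) by ring, Real.rpow_add hapos, Real.rpow_ofNat]
  ring

end Slices

end LevelSets

/-! ### De Giorgi's iteration -/

section Iteration

/-- Fast geometric convergence: a superlinear recursion with geometrically growing constants tends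
to zero from a small enough start. -/
lemma tendsto_zero_of_superlinear {x : ℕ → ℝ} {C D β : ℝ} (hC : 0 ≤ C) (hD : 1 < D) (hβ : 0 < β)
    (hx : ∀ j, 0 ≤ x j) (hstep : ∀ j, x (j + 1) ≤ C * D ^ j * x j ^ (1 + β))
    (h0 : C * x 0 ^ β ≤ D ^ (-1 / β)) : Tendsto x atTop (𝓝 0) := by
  have hD0 : 0 < D := by linarith
  set q := D ^ (-1 / β) with hq
  have hq0 : 0 < q := Real.rpow_pos_of_pos hD0 _
  have hq1 : q < 1 := Real.rpow_lt_one_of_one_lt_of_neg hD (div_neg_of_neg_of_pos (by norm_num) hβ)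
  have hqβ : ∀ j : ℕ, (q ^ j) ^ β = (D ^ j)⁻¹ := fun j => by
    rw [← Real.rpow_natCast, ← Real.rpow_mul hq0.le, hq, ← Real.rpow_mul hD0.le,
      show -1 / β * ((j : ℝ) * β) = -(j : ℝ) by field_simp, Real.rpow_neg hD0.le, Real.rpow_natCast]
  have hind : ∀ j, x j ≤ x 0 * q ^ j := by
    intro j
    induction j with
    | zero => simp
    | succ j ih =>
      have h1 : x j ^ β ≤ x 0 ^ β * (D ^ j)⁻¹ := by
        rw [← hqβ, ← Real.mul_rpow (hx 0) (by positivity)]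
        exact Real.rpow_le_rpow (hx j) ih hβ.le
      calc x (j + 1) ≤ C * D ^ j * x j ^ (1 + β) := hstep j
        _ = C * D ^ j * (x j * x j ^ β) := by
            rw [Real.rpow_add_of_nonneg (hx j) zero_le_one hβ.le, Real.rpow_one]
        _ ≤ C * D ^ j * (x 0 * q ^ j * (x 0 ^ β * (D ^ j)⁻¹)) := by
            have := hx 0
            have := hx j
            gcongr
        _ = C * x 0 ^ β * (x 0 * q ^ j) := by field_simp
        _ ≤ q * (x 0 * q ^ j) := by
            have := hx 0
            gcongr
        _ = _ := by ring
  have hlim : Tendsto (fun j => x 0 * q ^ j) atTop (𝓝 0) := by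
    simpa using (tendsto_pow_atTop_nhds_zero_of_lt_one hq0.le hq1).const_mul (x 0)
  exact tendsto_of_tendsto_of_tendsto_of_le_of_le tendsto_const_nhds hlim hx hind

/-- De Giorgi's iteration along the levels `K (2 - 2^{-j})`. The exponent
`(1 - 2/k)(1 + 2/d)` of the recursion is greater than `1` exactly when `k > d + 2`. -/
theorem exists_ae_le_two_mul (d : ℕ) (hd : 1 ≤ d) (η : ℝ) (hη : 0 < η) (k : ℝ)
    (hk : (d : ℝ) + 2 < k) :
    ∃ M : ℝ, 1 ≤ M ∧ ∀ (b p : ℝ) (u f : ℝ × Space d → ℝ) (g G h : ℝ × Space d → Space d) (K : ℝ),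
      IsGlobalSolution d b η (ENNReal.ofReal p) (ENNReal.ofReal (k / 2)) (ENNReal.ofReal k)
        u f g G h → 2 < p → 0 < K →
      (eLpNorm f (ENNReal.ofReal (k / 2)) volume).toReal ≤ K →
      (eLpNorm h (ENNReal.ofReal k) volume).toReal ≤ K →
      M * (eLpNorm u 2 volume).toReal ≤ K → ∀ᵐ z, u z ≤ 2 * K := by
  obtain ⟨L, hL1, hL⟩ := exists_deriv_smoothTransition_le
  have hd0 : (0 : ℝ) < d := by exact_mod_cast hd
  have hk0 : 0 < k := by linarith
  have hk2 : 2 < k := by linarith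
  set ε : ℝ := 2 + 4 / (d : ℝ) with hε
  have hε0 : 0 < ε := by positivity
  set C₀ : ℝ := 4 * L / η * (1 + L / (2 * η)) * (4 * L * (1 + L / (2 * η))
          / volume.real (Metric.ball (0 : Space d) 1)) ^ (2 / (d : ℝ)) with hC₀
  have hC₀0 : 0 ≤ C₀ := by
    have : 0 ≤ volume.real (Metric.ball (0 : Space d) 1) := measureReal_nonneg
    positivity
  set β : ℝ := (1 - 2 / k) * (1 + 2 / (d : ℝ)) - 1 with hβdef
  have hβ : 0 < β := by
    have h1 : β = 2 * (k - (d + 2)) / (k * d) := by rw [hβdef]; field_simp; ring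
    rw [h1]
    have : 0 < k - (d + 2) := by linarith
    positivity
  set D : ℝ := (2 : ℝ) ^ ε with hD
  have hD1 : 1 < D := Real.one_lt_rpow (by norm_num) hε0
  have hD0 : 0 < D := by linarith
  set C : ℝ := C₀ * (4 : ℝ) ^ ε with hC
  have hC0 : 0 ≤ C := by positivity
  set q : ℝ := D ^ (-1 / β) with hq
  have hq0 : 0 < q := Real.rpow_pos_of_pos hD0 _
  -- The constant `M` makes the measure of `{u > K}` small enough to start the iteration.
  refine ⟨max 1 ((C / q) ^ (1 / (2 * β))), le_max_left _ _, ?_⟩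
  intro b p u f g G h K H hp hK hF hH hM
  set M : ℝ := max 1 ((C / q) ^ (1 / (2 * β))) with hMdef
  have hM1 : 1 ≤ M := le_max_left _ _
  set ℓ : ℕ → ℝ := fun j => K * (2 - (1 / 2) ^ j) with hℓ
  have hpow1 : ∀ j : ℕ, ((1 : ℝ) / 2) ^ j ≤ 1 := fun j => pow_le_one₀ (by norm_num) (by norm_num)
  have hpow0 : ∀ j : ℕ, 0 < ((1 : ℝ) / 2) ^ j := fun j => by positivity
  have hℓ0 : ∀ j, 0 < ℓ j := fun j => mul_pos hK (by linarith [hpow1 j])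
  set x : ℕ → ℝ := fun j => volume.real {z | ℓ j < u z} with hx
  have hstep : ∀ j, x (j + 1) ≤ C * D ^ j * x j ^ (1 + β) := by
    intro j
    set δ := K * ((1 / 2) ^ j / 4) with hδ
    have hδ0 : 0 < δ := by positivity
    have h1 := H.deGiorgi_step hd hη hp hk2 hL1 hL (hℓ0 j) hδ0
      (by rw [hδ]; nlinarith [hpow1 j]) hF hH
    have h2 : ℓ j + 2 * δ = ℓ (j + 1) := by
      simp only [hℓ, hδ, pow_succ]; ring
    have h3 : (K / δ) ^ ε = 4 ^ ε * D ^ j := by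
      have e : K / δ = 4 * 2 ^ j := by
        rw [hδ, one_div, inv_pow]; field_simp
      rw [e, Real.mul_rpow (by norm_num) (by positivity), hD, ← Real.rpow_natCast 2 j,
        ← Real.rpow_mul (by norm_num), ← Real.rpow_natCast, ← Real.rpow_mul (by norm_num), mul_comm ε]
    rw [h2, h3, ← hC₀] at h1
    calc x (j + 1) ≤ _ := h1
      _ = _ := by
        rw [show 1 + β = (1 - 2 / k) * (1 + 2 / (d : ℝ)) by rw [hβdef]; ring, hC]
        ring
  have hstart : C * x 0 ^ β ≤ q := by
    set N := (eLpNorm u 2 volume).toReal with hN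
    have hN0 : 0 ≤ N := ENNReal.toReal_nonneg
    have hcheb : K ^ 2 * x 0 ≤ N ^ 2 := by
      have hsub : {z | ℓ 0 < u z} ⊆ {z | ENNReal.ofReal (K ^ 2) ≤ ‖u z‖ₑ ^ 2} := by
        intro z hz
        have hz : ℓ 0 < u z := hz
        have hz' : K < u z := by simp only [hℓ, pow_zero] at hz; linarith
        simp only [mem_ofPred_eq]
        rw [← ofReal_norm, ← ENNReal.ofReal_pow (norm_nonneg _)]
        refine ENNReal.ofReal_le_ofReal ?_
        rw [Real.norm_eq_abs, sq_abs]
        gcongr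
      have h1 : ENNReal.ofReal (K ^ 2) * volume {z | ℓ 0 < u z} ≤ eLpNorm u 2 volume ^ 2 := by
        rw [eLpNorm_two_sq]
        exact (mul_le_mul_right (measure_mono hsub) _).trans
          (mul_meas_ge_le_lintegral (H.measurable.enorm.pow_const 2) _)
      have h2 := ENNReal.toReal_mono (ENNReal.pow_ne_top H.memLp_two.2.ne) h1
      rwa [ENNReal.toReal_mul, ENNReal.toReal_ofReal (by positivity), ENNReal.toReal_pow] at h2
    have hx0 : M ^ 2 * x 0 ≤ 1 := by
      have h1 : M ^ 2 * (K ^ 2 * x 0) ≤ K ^ 2 := by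
        calc M ^ 2 * (K ^ 2 * x 0) ≤ M ^ 2 * N ^ 2 := by gcongr
          _ = (M * N) ^ 2 := by ring
          _ ≤ K ^ 2 := by gcongr
      have hK2 : 0 < K ^ 2 := by positivity
      refine le_of_mul_le_mul_left ?_ hK2
      linarith
    have hx00 : 0 ≤ x 0 := measureReal_nonneg
    have hMβ : C / q ≤ (M ^ 2) ^ β := by
      have h1 : (C / q) ^ (1 / (2 * β)) ≤ M := le_max_right _ _
      calc C / q = ((C / q) ^ (1 / (2 * β))) ^ (2 * β) := by
            rw [← Real.rpow_mul (by positivity), one_div, inv_mul_cancel₀ (by positivity),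
              Real.rpow_one]
        _ ≤ M ^ (2 * β) := by gcongr
        _ = (M ^ 2) ^ β := by
            rw [← Real.rpow_natCast, ← Real.rpow_mul (by positivity)]; norm_cast
    calc C * x 0 ^ β = q * (C / q * x 0 ^ β) := by field_simp
      _ ≤ q * ((M ^ 2) ^ β * x 0 ^ β) := by gcongr
      _ = q * (M ^ 2 * x 0) ^ β := by rw [Real.mul_rpow (by positivity) hx00]
      _ ≤ q * 1 := by
          gcongr
          exact Real.rpow_le_one (by positivity) hx0 hβ.le
      _ = q := mul_one _
  have hlim := tendsto_zero_of_superlinear (x := x) hC0 hD1 hβ (fun j => measureReal_nonneg) hstep hstart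
  have hle : volume.real {z | 2 * K < u z} ≤ 0 := by
    refine ge_of_tendsto' hlim fun j => ?_
    refine measureReal_mono (fun z hz => ?_) (volume_superlevel_lt_top H.memLp_two (hℓ0 j)).ne
    have hz : 2 * K < u z := hz
    simp only [mem_ofPred_eq, hℓ]
    nlinarith [hpow0 j]
  have hzero : volume {z | 2 * K < u z} = 0 := by
    have := (ENNReal.toReal_eq_zero_iff _).1 (le_antisymm hle measureReal_nonneg)
    exact this.resolve_right (volume_superlevel_lt_top H.memLp_two (by linarith)).ne
  rw [ae_iff]
  simpa only [not_le] using hzero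

end Iteration

/-! ### Extension by zero in time -/

section TimeExtension

variable {d : ℕ}

/-- A smooth cutoff in time that vanishes for `t ≤ c + 1/(n+1)` and is `1` for `t ≥ c + 2/(n+1)`. -/
def startCutoff (c : ℝ) (n : ℕ) (t : ℝ) : ℝ :=
  Real.smoothTransition ((n + 1) * (t - c) - 1)

/-- The derivative of `startCutoff c n`. -/
def startCutoffDeriv (c : ℝ) (n : ℕ) (t : ℝ) : ℝ :=
  (n + 1) * deriv Real.smoothTransition ((n + 1) * (t - c) - 1)

lemma contDiff_startCutoff (c : ℝ) (n : ℕ) : ContDiff ℝ (⊤ : ℕ∞) (startCutoff c n) :=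
  Real.smoothTransition.contDiff.comp
    ((contDiff_const.mul (contDiff_id.sub contDiff_const)).sub contDiff_const)

lemma hasDerivAt_startCutoff (c : ℝ) (n : ℕ) (t : ℝ) :
    HasDerivAt (startCutoff c n) (startCutoffDeriv c n t) t := by
  have h1 : HasDerivAt (fun t : ℝ => (n + 1) * (t - c) - 1) ((n + 1) * 1) t :=
    (((hasDerivAt_id t).sub_const c).const_mul _).sub_const 1
  have h2 := (contDiff_smoothTransition.differentiable (by simp)
    ((n + 1) * (t - c) - 1)).hasDerivAt
  exact (h2.comp t h1).congr_deriv (by rw [startCutoffDeriv]; ring)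

lemma startCutoff_eq_zero {c : ℝ} {n : ℕ} {t : ℝ} (h : t ≤ c + 1 / (n + 1)) :
    startCutoff c n t = 0 := by
  refine Real.smoothTransition.zero_of_nonpos ?_
  have hn : (0 : ℝ) < n + 1 := by positivity
  have h1 : t - c ≤ 1 / (n + 1) := by linarith
  rw [le_div_iff₀ hn] at h1
  linarith

lemma tsupport_startCutoff_subset (c : ℝ) (n : ℕ) : tsupport (startCutoff c n) ⊆ Ioi c := by
  have h : tsupport (startCutoff c n) ⊆ Ici (c + 1 / (n + 1)) := by
    refine closure_minimal (fun t ht => ?_) isClosed_Ici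
    by_contra hlt
    exact ht (startCutoff_eq_zero (not_le.1 hlt).le)
  intro t ht
  have h1 : c + 1 / (n + 1) ≤ t := h ht
  have h2 : (0 : ℝ) < 1 / (n + 1) := by positivity
  exact lt_of_lt_of_le (by linarith) h1

lemma abs_startCutoff_le (c : ℝ) (n : ℕ) (t : ℝ) : |startCutoff c n t| ≤ 1 := by
  rw [startCutoff, abs_of_nonneg (Real.smoothTransition.nonneg _)]
  exact Real.smoothTransition.le_one _

lemma tendsto_startCutoff {c t : ℝ} (h : c < t) :
    Tendsto (fun n => startCutoff c n t) atTop (𝓝 1) := by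
  refine tendsto_const_nhds.congr' ?_
  have h1 : Tendsto (fun n : ℕ => ((n : ℝ) + 1) * (t - c)) atTop atTop :=
    (tendsto_natCast_atTop_atTop.atTop_add tendsto_const_nhds).atTop_mul_const (by linarith)
  filter_upwards [h1.eventually_ge_atTop 2] with n hn
  rw [startCutoff, Real.smoothTransition.one_of_one_le (by linarith)]

lemma startCutoffDeriv_eq_zero_of_ge {c : ℝ} {n : ℕ} {t : ℝ} (h : c + 2 / (n + 1) ≤ t) :
    startCutoffDeriv c n t = 0 := by
  have hn : (0 : ℝ) < n + 1 := by positivity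
  rw [startCutoffDeriv, deriv_smoothTransition_of_one_le, mul_zero]
  have h1 : 2 / ((n : ℝ) + 1) ≤ t - c := by linarith
  rw [div_le_iff₀ hn] at h1
  linarith

lemma startCutoffDeriv_eq_zero_of_le {c : ℝ} {n : ℕ} {t : ℝ} (h : t ≤ c) :
    startCutoffDeriv c n t = 0 := by
  have hn : (0 : ℝ) < n + 1 := by positivity
  rw [startCutoffDeriv, deriv_smoothTransition_of_nonpos, mul_zero]
  nlinarith

lemma continuous_startCutoffDeriv (c : ℝ) (n : ℕ) : Continuous (startCutoffDeriv c n) := by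
  have := contDiff_deriv_smoothTransition.continuous
  unfold startCutoffDeriv
  fun_prop

lemma IsTest.mul_time {U V : Set (ℝ × Space d)} {ψ : ℝ × Space d → ℝ} (hψ : IsTest U ψ)
    {χ : ℝ → ℝ} (hχ : ContDiff ℝ (⊤ : ℕ∞) χ) (hV : ∀ z ∈ U, z.1 ∈ tsupport χ → z ∈ V) :
    IsTest V fun z => ψ z * χ z.1 where
  contDiff := hψ.contDiff.mul (hχ.comp contDiff_fst)
  hasCompactSupport := hψ.hasCompactSupport.mul_right
  tsupport_subset := by
    intro z hz
    refine hV z (hψ.tsupport_subset (tsupport_mul_subset_left hz)) ?_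
    have h1 : tsupport (fun z : ℝ × Space d => χ z.1) ⊆ Prod.fst ⁻¹' tsupport χ :=
      closure_minimal (fun w hw => subset_tsupport _ hw)
        ((isClosed_tsupport χ).preimage continuous_fst)
    exact h1 (tsupport_mul_subset_right hz)

lemma fderiv_mul_time {ψ : ℝ × Space d → ℝ} {χ : ℝ → ℝ} {χ' : ℝ} {z : ℝ × Space d}
    (hψ : DifferentiableAt ℝ ψ z) (hχ : HasDerivAt χ χ' z.1) (e : ℝ × Space d) :
    fderiv ℝ (fun z => ψ z * χ z.1) z e = fderiv ℝ ψ z e * χ z.1 + ψ z * χ' * e.1 := by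
  have h := hψ.hasFDerivAt.mul (hasFDerivAt_comp_fst (d := d) hχ)
  rw [show fderiv ℝ (fun z => ψ z * χ z.1) z = _ from h.fderiv]
  simp only [add_apply, smul_apply, smul_eq_mul, ContinuousLinearMap.coe_fst']
  ring

lemma integrable_mul_of_memLp {v w : ℝ × Space d → ℝ} {q : ℝ≥0∞} (hq : 1 ≤ q)
    (hv : MemLp v q volume) (hw : Continuous w) (hs : HasCompactSupport w) :
    Integrable fun z => v z * w z := by
  have : Fact (1 ≤ q) := ⟨hq⟩
  exact integrable_mul_of_conj hv (hw.memLp_of_hasCompactSupport hs)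

lemma IsTest.continuous_fderiv {U : Set (ℝ × Space d)} {ψ : ℝ × Space d → ℝ} (hψ : IsTest U ψ)
    (e : ℝ × Space d) : Continuous fun z => fderiv ℝ ψ z e :=
  (hψ.contDiff.continuous_fderiv (by simp)).clm_apply continuous_const

lemma IsTest.hasCompactSupport_fderiv {U : Set (ℝ × Space d)} {ψ : ℝ × Space d → ℝ}
    (hψ : IsTest U ψ) (e : ℝ × Space d) : HasCompactSupport fun z => fderiv ℝ ψ z e :=
  (hψ.hasCompactSupport.fderiv (𝕜 := ℝ)).comp_left
    (g := fun L : (ℝ × Space d) →L[ℝ] ℝ => L e) rfl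

lemma tendsto_integral_mul_time {F : ℝ × Space d → ℝ} (hF : Integrable F) {χ : ℕ → ℝ → ℝ}
    (hc : ∀ n, Continuous (χ n)) (h1 : ∀ n t, |χ n t| ≤ 1)
    (hlim : ∀ z, F z ≠ 0 → Tendsto (fun n => χ n z.1) atTop (𝓝 1)) :
    Tendsto (fun n => ∫ z, F z * χ n z.1) atTop (𝓝 (∫ z, F z)) := by
  refine tendsto_integral_of_dominated_convergence (fun z => ‖F z‖)
    (fun n => hF.1.mul ((hc n).comp continuous_fst).aestronglyMeasurable) hF.norm
    (fun n => Eventually.of_forall fun z => ?_) (Eventually.of_forall fun z => ?_)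
  · rw [norm_mul]
    exact mul_le_of_le_one_right (norm_nonneg _) (h1 n z.1)
  · by_cases hz : F z = 0
    · simp [hz]
    · simpa using (hlim z hz).const_mul (F z)

/-- A weak spatial derivative on the strip extends by zero in time: cutoffs in time do not interact
with spatial derivatives. -/
lemma weak_spatial_of_strip {a b : ℝ} {v w : ℝ × Space d → ℝ} {q : ℝ≥0∞} (hq : 1 ≤ q)
    (hv : MemLp v q volume) (hw : MemLp w q volume)
    (hv0 : ∀ z, z ∉ strip d a b → v z = 0) (hw0 : ∀ z, z ∉ strip d a b → w z = 0) (i : Fin d)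
    (h : ∀ ψ, IsTest (strip d a b : Set (ℝ × Space d)) ψ →
      ∫ z, v z * fderiv ℝ ψ z (spaceDir i) = -∫ z, w z * ψ z)
    (ψ : ℝ × Space d → ℝ) (hψ : IsTest univ ψ) :
    ∫ z, v z * fderiv ℝ ψ z (spaceDir i) = -∫ z, w z * ψ z := by
  set χ : ℕ → ℝ → ℝ := fun n t => startCutoff a n t * startCutoff (-b) n (-t) with hχ
  have hχd : ∀ n, ContDiff ℝ (⊤ : ℕ∞) (χ n) := fun n =>
    (contDiff_startCutoff a n).mul ((contDiff_startCutoff (-b) n).comp contDiff_neg)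
  have hχ1 : ∀ n t, |χ n t| ≤ 1 := fun n t => by
    rw [abs_mul]
    exact mul_le_one₀ (abs_startCutoff_le _ _ _) (abs_nonneg _) (abs_startCutoff_le _ _ _)
  have hχs : ∀ n, ∀ t ∈ tsupport (χ n), t ∈ Ioo a b := by
    intro n t ht
    refine ⟨tsupport_startCutoff_subset a n (tsupport_mul_subset_left ht), ?_⟩
    have h1 : tsupport (fun t => startCutoff (-b) n (-t)) ⊆ Neg.neg ⁻¹' tsupport (startCutoff (-b) n) :=
      closure_minimal (fun w hw => subset_tsupport _ hw)
        ((isClosed_tsupport _).preimage continuous_neg)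
    have h2 : -b < -t := tsupport_startCutoff_subset (-b) n (h1 (tsupport_mul_subset_right ht))
    linarith
  have hlim : ∀ t ∈ Ioo a b, Tendsto (fun n => χ n t) atTop (𝓝 1) := fun t ht => by
    simpa using (tendsto_startCutoff ht.1).mul
      (tendsto_startCutoff (c := -b) (t := -t) (by linarith [ht.2]))
  have hstep : ∀ n, ∫ z, v z * fderiv ℝ ψ z (spaceDir i) * χ n z.1 = -∫ z, w z * ψ z * χ n z.1 := by
    intro n
    have h1 := h _ (hψ.mul_time (hχd n) fun z _ hz => ⟨hχs n _ hz, mem_univ _⟩)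
    have h2 : ∀ z, fderiv ℝ (fun z => ψ z * χ n z.1) z (spaceDir i)
        = fderiv ℝ ψ z (spaceDir i) * χ n z.1 := fun z => by
      rw [fderiv_mul_time (hψ.contDiff.differentiable (by simp) z)
        ((hχd n).differentiable (by simp) z.1).hasDerivAt]
      simp [spaceDir]
    simp only [h2, ← mul_assoc] at h1
    exact h1
  have l1 := tendsto_integral_mul_time (integrable_mul_of_memLp hq hv
    (hψ.continuous_fderiv (spaceDir i)) (hψ.hasCompactSupport_fderiv (spaceDir i)))
    (fun n => (hχd n).continuous) hχ1 (fun z hz => hlim z.1 (by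
      by_contra hn
      exact hz (by simp only [hv0 z fun hm => hn hm.1, zero_mul])))
  have l2 := tendsto_integral_mul_time (integrable_mul_of_memLp hq hw
    hψ.contDiff.continuous hψ.hasCompactSupport)
    (fun n => (hχd n).continuous) hχ1 (fun z hz => hlim z.1 (by
      by_contra hn
      exact hz (by simp only [hw0 z fun hm => hn hm.1, zero_mul])))
  exact tendsto_nhds_unique (l1.congr hstep) l2.neg

/-- The vanishing initial trace and the `L^∞(L²)` bound make the pairing with a test function that
depends on time vanish at the initial time. -/
lemma tendsto_slice_integral {a M : ℝ} {u : ℝ × Space d → ℝ} (hu : Measurable u)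
    (huM : ∀ᵐ t : ℝ, ∫⁻ x, ‖u (t, x)‖ₑ ^ 2 ≤ ENNReal.ofReal M)
    (h0 : InitialZero d a u) {U : Set (ℝ × Space d)} {ψ : ℝ × Space d → ℝ} (hψ : IsTest U ψ) :
    Tendsto (fun t => ∫ x, u (t, x) * ψ (t, x)) (𝓝[>] a ⊓ ae volume) (𝓝 0) := by
  obtain ⟨B, hB⟩ := hψ.contDiff.lipschitzWith_of_hasCompactSupport hψ.hasCompactSupport (by simp)
  set K : Set (Space d) := Prod.snd '' tsupport ψ with hK
  have hKc : IsCompact K := hψ.hasCompactSupport.isCompact.image continuous_snd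
  have hK0 : ∀ t x, x ∉ K → ψ (t, x) = 0 := fun t x hx =>
    image_eq_zero_of_notMem_tsupport fun h => hx ⟨_, h, rfl⟩
  have hslice : ∀ t, Continuous fun x => ψ (t, x) := fun t =>
    hψ.contDiff.continuous.comp (by fun_prop)
  have hsl : ∀ t, HasCompactSupport fun x => ψ (t, x) := fun t =>
    HasCompactSupport.intro hKc (hK0 t)
  have hφ := h0 ⟨fun x => ψ (a, x), hψ.contDiff.comp (contDiff_const.prodMk contDiff_id), hsl a,
    subset_univ _⟩
  change Tendsto (fun t => ∫ x, u (t, x) * ψ (a, x)) _ _ at hφ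
  have hdiff : ∀ᵐ t : ℝ, |(∫ x, u (t, x) * ψ (t, x)) - ∫ x, u (t, x) * ψ (a, x)|
      ≤ B * |t - a| * (volume.real K + max M 0) := by
    filter_upwards [huM] with t ht
    have hut : Measurable fun x => u (t, x) := hu.comp measurable_prodMk_left
    have hL2 : MemLp (fun x => u (t, x)) 2 volume := by
      refine ⟨hut.aestronglyMeasurable, ?_⟩
      have : eLpNorm (fun x => u (t, x)) 2 volume ^ 2 < ∞ := by
        rw [eLpNorm_two_sq]; exact ht.trans_lt ENNReal.ofReal_lt_top
      exact (ENNReal.pow_lt_top_iff.1 this).resolve_right (by norm_num)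
    have hi : ∀ s, Integrable fun x => u (t, x) * ψ (s, x) := fun s =>
      hL2.integrable_mul ((hslice s).memLp_of_hasCompactSupport (p := 2) (hsl s))
    have hsq : ∫ x, u (t, x) ^ 2 ≤ max M 0 := by
      rw [integral_eq_lintegral_of_nonneg_ae (Eventually.of_forall fun x => sq_nonneg _)
        (hut.pow_const 2).aestronglyMeasurable]
      refine ENNReal.toReal_le_of_le_ofReal (le_max_right _ _) ?_
      refine le_trans (le_of_eq (lintegral_congr fun x => ?_))
        (ht.trans (ENNReal.ofReal_le_ofReal (le_max_left _ _)))
      rw [← ofReal_norm, ← ENNReal.ofReal_pow (norm_nonneg _), Real.norm_eq_abs, sq_abs]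
    have hiK : Integrable (fun x => K.indicator (fun _ => (1 : ℝ)) x + u (t, x) ^ 2) :=
      ((integrable_indicator_iff hKc.measurableSet).2
        (integrableOn_const hKc.measure_lt_top.ne)).add hL2.integrable_sq
    rw [← integral_sub (hi t) (hi a), ← Real.norm_eq_abs]
    calc _ ≤ ∫ x, B * |t - a| * (K.indicator (fun _ => (1 : ℝ)) x + u (t, x) ^ 2) := by
          refine norm_integral_le_of_norm_le (hiK.const_mul _) (Eventually.of_forall fun x => ?_)
          rw [← mul_sub, norm_mul, Real.norm_eq_abs, Real.norm_eq_abs]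
          by_cases hx : x ∈ K
          · rw [indicator_of_mem hx]
            have h1 : |ψ (t, x) - ψ (a, x)| ≤ B * |t - a| := by
              have := hB.dist_le_mul (t, x) (a, x)
              rwa [Real.dist_eq, Prod.dist_eq, dist_self, max_eq_left dist_nonneg,
                Real.dist_eq] at this
            have h2 : |u (t, x)| ≤ 1 + u (t, x) ^ 2 := by
              rw [← sq_abs]; nlinarith [sq_nonneg (|u (t, x)| - 1), abs_nonneg (u (t, x))]
            calc _ ≤ (1 + u (t, x) ^ 2) * (B * |t - a|) := by gcongr
              _ = _ := by ring
          · rw [hK0 t x hx, hK0 a x hx, sub_zero, abs_zero, mul_zero]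
            have : 0 ≤ K.indicator (fun _ => (1 : ℝ)) x := indicator_nonneg (by simp) x
            positivity
      _ = B * |t - a| * (volume.real K + ∫ x, u (t, x) ^ 2) := by
          rw [integral_const_mul, integral_add ((integrable_indicator_iff hKc.measurableSet).2
            (integrableOn_const hKc.measure_lt_top.ne)) hL2.integrable_sq,
            integral_indicator hKc.measurableSet]
          simp
      _ ≤ _ := by gcongr
  have hzero : Tendsto (fun t : ℝ => B * |t - a| * (volume.real K + max M 0))
      (𝓝[>] a ⊓ ae volume) (𝓝 0) := by
    have : Continuous fun t : ℝ => B * |t - a| * (volume.real K + max M 0) := by fun_prop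
    have h1 := this.tendsto a
    simp only [sub_self, abs_zero, mul_zero, zero_mul] at h1
    exact h1.mono_left (inf_le_left.trans nhdsWithin_le_nhds)
  have hd0 : Tendsto (fun t => (∫ x, u (t, x) * ψ (t, x)) - ∫ x, u (t, x) * ψ (a, x))
      (𝓝[>] a ⊓ ae volume) (𝓝 0) :=
    squeeze_zero_norm' (Filter.Eventually.filter_mono inf_le_right hdiff) hzero
  simpa using hd0.add hφ

/-- The boundary term produced by the time cutoff at the initial time tends to zero. -/
lemma tendsto_integral_startCutoffDeriv {a M : ℝ} {u : ℝ × Space d → ℝ} (hu : Measurable u)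
    (hu2 : MemLp u 2 volume)
    (huM : ∀ᵐ t : ℝ, ∫⁻ x, ‖u (t, x)‖ₑ ^ 2 ≤ ENNReal.ofReal M)
    (h0 : InitialZero d a u) {U : Set (ℝ × Space d)} {ψ : ℝ × Space d → ℝ} (hψ : IsTest U ψ) :
    Tendsto (fun n => ∫ z, u z * (ψ z * startCutoffDeriv a n z.1)) atTop (𝓝 0) := by
  obtain ⟨L, hL1, hL⟩ := exists_deriv_smoothTransition_le
  have hlim := tendsto_slice_integral hu huM h0 hψ
  rw [Metric.tendsto_atTop]
  intro ε hε
  have hε' : 0 < ε / (4 * L) := by positivity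
  have hev : ∀ᶠ t in 𝓝[>] a ⊓ ae volume, |∫ x, u (t, x) * ψ (t, x)| < ε / (4 * L) := by
    have := (Metric.tendsto_nhds.1 hlim) _ hε'
    simpa only [Real.dist_eq, sub_zero] using this
  obtain ⟨s, hs, s', hs', hss⟩ := Filter.mem_inf_iff_superset.1 hev
  obtain ⟨c, hc, hcs⟩ := mem_nhdsGT_iff_exists_Ioo_subset.1 hs
  have hc : a < c := hc
  have hN : Tendsto (fun n : ℕ => 2 / ((n : ℝ) + 1)) atTop (𝓝 0) := by
    have := (tendsto_one_div_add_atTop_nhds_zero_nat (𝕜 := ℝ)).const_mul 2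
    simpa [div_eq_mul_inv] using this
  obtain ⟨N, hN⟩ := eventually_atTop.1 (hN.eventually (gt_mem_nhds (show 0 < c - a by linarith)))
  refine ⟨N, fun n hn => ?_⟩
  have hn2 := hN n hn
  have hn1 : (0 : ℝ) < n + 1 := by positivity
  have hcont : Continuous fun z : ℝ × Space d => ψ z * startCutoffDeriv a n z.1 :=
    hψ.contDiff.continuous.mul ((continuous_startCutoffDeriv a n).comp continuous_fst)
  have hint := integrable_mul_of_memLp (by norm_num) hu2 hcont hψ.hasCompactSupport.mul_right
  rw [Real.dist_eq, sub_zero, Measure.volume_eq_prod, integral_prod _ hint]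
  have hfub : ∀ t, ∫ x, u (t, x) * (ψ (t, x) * startCutoffDeriv a n t)
      = (∫ x, u (t, x) * ψ (t, x)) * startCutoffDeriv a n t := fun t => by
    rw [← integral_mul_const]
    exact integral_congr_ae (Eventually.of_forall fun x => by simp only; ring)
  simp only [hfub]
  -- The derivative is at most `L (n + 1)` on an interval of length `2/(n + 1)`.
  have hbd : ∀ᵐ t : ℝ, ‖(∫ x, u (t, x) * ψ (t, x)) * startCutoffDeriv a n t‖
      ≤ (Ioc a (a + 2 / (n + 1))).indicator (fun _ => ε / (4 * L) * (L * (n + 1))) t := by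
    filter_upwards [hs'] with t hts'
    by_cases ht : t ∈ Ioc a (a + 2 / ((n : ℝ) + 1))
    · rw [indicator_of_mem ht, norm_mul, Real.norm_eq_abs, Real.norm_eq_abs]
      have h1 : |∫ x, u (t, x) * ψ (t, x)| < ε / (4 * L) :=
        hss ⟨hcs ⟨ht.1, by linarith [ht.2]⟩, hts'⟩
      have h2 : |startCutoffDeriv a n t| ≤ L * (n + 1) := by
        rw [startCutoffDeriv, abs_of_nonneg (mul_nonneg hn1.le (deriv_smoothTransition_nonneg _)),
          mul_comm]
        gcongr
        exact hL _
      gcongr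
    · have h2 : startCutoffDeriv a n t = 0 := by
        rcases le_or_gt t a with h | h
        · exact startCutoffDeriv_eq_zero_of_le h
        · refine startCutoffDeriv_eq_zero_of_ge ?_
          by_contra hlt
          exact ht ⟨h, (not_le.1 hlt).le⟩
      rw [h2, mul_zero, norm_zero, indicator_of_notMem ht]
  have hle := norm_integral_le_of_norm_le ((integrable_indicator_iff measurableSet_Ioc).2
    (integrableOn_const (by simp))) hbd
  rw [integral_indicator measurableSet_Ioc, setIntegral_const, Real.norm_eq_abs] at hle
  refine hle.trans_lt ?_
  rw [Measure.real, Real.volume_Ioc, ENNReal.toReal_ofReal (by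
    have : 0 < 2 / ((n : ℝ) + 1) := by positivity
    linarith), smul_eq_mul]
  have : (a + 2 / ((n : ℝ) + 1) - a) * (ε / (4 * L) * (L * (n + 1))) = ε / 2 := by
    field_simp; ring
  rw [this]; linarith

end TimeExtension

/-! ### From the strip to global solutions -/

section ZeroExtension

variable {d : ℕ}

/-- The equation on the strip extends to `(-∞, b) × ℝ^d`, with all data extended by zero, because
the initial trace vanishes. -/
lemma weak_equation_of_strip {a b M : ℝ} {q r m : ℝ≥0∞} (hq : 1 ≤ q) (hr : 1 ≤ r) (hm : 1 ≤ m)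
    {u f : ℝ × Space d → ℝ} {G h : ℝ × Space d → Space d} (hu : Measurable u)
    (hu2 : MemLp u 2 volume) (hG : MemLp G q volume) (hh : MemLp h m volume)
    (hf : MemLp f r volume)
    (hu0 : ∀ z, z ∉ strip d a b → u z = 0) (hG0 : ∀ z, z ∉ strip d a b → G z = 0)
    (hh0 : ∀ z, z ∉ strip d a b → h z = 0) (hf0 : ∀ z, z ∉ strip d a b → f z = 0)
    (huM : ∀ᵐ t : ℝ, ∫⁻ x, ‖u (t, x)‖ₑ ^ 2 ≤ ENNReal.ofReal M) (h0 : InitialZero d a u)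
    (heq : ∀ ψ, IsTest (strip d a b : Set (ℝ × Space d)) ψ → -(∫ z, u z * fderiv ℝ ψ z (1, 0))
      + ((∑ i, ∫ z, G z i * fderiv ℝ ψ z (spaceDir i))
        + ∑ i, ∫ z, -h z i * fderiv ℝ ψ z (spaceDir i)) = ∫ z, f z * ψ z)
    (ψ : ℝ × Space d → ℝ) (hψ : IsTest (Iio b ×ˢ univ) ψ) :
    -(∫ z, u z * fderiv ℝ ψ z (1, 0))
      + ((∑ i, ∫ z, G z i * fderiv ℝ ψ z (spaceDir i))
        + ∑ i, ∫ z, -h z i * fderiv ℝ ψ z (spaceDir i)) = ∫ z, f z * ψ z := by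
  have hlim : ∀ {F : ℝ × Space d → ℝ}, Integrable F → (∀ z, z ∉ strip d a b → F z = 0) →
      Tendsto (fun n => ∫ z, F z * startCutoff a n z.1) atTop (𝓝 (∫ z, F z)) := fun hF hF0 =>
    tendsto_integral_mul_time hF (fun n => (contDiff_startCutoff a n).continuous)
      (fun n t => abs_startCutoff_le a n t) fun z hz => tendsto_startCutoff (by
        by_contra hn
        exact hz (hF0 z fun hmem => hn hmem.1.1))
  have iu := integrable_mul_of_memLp (by norm_num) hu2 (hψ.continuous_fderiv (1, 0))
    (hψ.hasCompactSupport_fderiv (1, 0))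
  have iG := fun i => integrable_mul_of_memLp hq (memLp_coord hG i)
    (hψ.continuous_fderiv (spaceDir i)) (hψ.hasCompactSupport_fderiv (spaceDir i))
  have ih := fun i => integrable_mul_of_memLp hm (memLp_coord hh i).neg
    (hψ.continuous_fderiv (spaceDir i)) (hψ.hasCompactSupport_fderiv (spaceDir i))
  have i_f := integrable_mul_of_memLp hr hf hψ.contDiff.continuous hψ.hasCompactSupport
  have lu := hlim iu fun z hz => by simp only [hu0 z hz, zero_mul]
  have lG := fun i => hlim (iG i) fun z hz => by simp only [hG0 z hz, PiLp.zero_apply, zero_mul]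
  have lh := fun i => hlim (ih i) fun z hz => by
    simp only [Pi.neg_apply, hh0 z hz, PiLp.zero_apply, neg_zero, zero_mul]
  have lf := hlim i_f fun z hz => by simp only [hf0 z hz, zero_mul]
  have l0 := tendsto_integral_startCutoffDeriv hu hu2 huM h0 hψ
  have hstep : ∀ n, -((∫ z, u z * fderiv ℝ ψ z (1, 0) * startCutoff a n z.1)
        + ∫ z, u z * (ψ z * startCutoffDeriv a n z.1))
      + ((∑ i, ∫ z, G z i * fderiv ℝ ψ z (spaceDir i) * startCutoff a n z.1)
        + ∑ i, ∫ z, -h z i * fderiv ℝ ψ z (spaceDir i) * startCutoff a n z.1)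
      = ∫ z, f z * ψ z * startCutoff a n z.1 := by
    intro n
    have htest : IsTest (strip d a b : Set (ℝ × Space d)) fun z => ψ z * startCutoff a n z.1 :=
      hψ.mul_time (contDiff_startCutoff a n)
        fun z hz hz' => ⟨⟨tsupport_startCutoff_subset a n hz', hz.1⟩, mem_univ _⟩
    have h1 := heq _ htest
    have hd : ∀ z e, fderiv ℝ (fun z => ψ z * startCutoff a n z.1) z e
        = fderiv ℝ ψ z e * startCutoff a n z.1 + ψ z * startCutoffDeriv a n z.1 * e.1 :=
      fun z e => fderiv_mul_time (hψ.contDiff.differentiable (by simp) z)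
        (hasDerivAt_startCutoff a n z.1) e
    simp only [hd, spaceDir, mul_zero, add_zero, mul_one, ← mul_assoc] at h1
    have hsplit : ∫ z, u z * (fderiv ℝ ψ z (1, 0) * startCutoff a n z.1
        + ψ z * startCutoffDeriv a n z.1)
        = (∫ z, u z * fderiv ℝ ψ z (1, 0) * startCutoff a n z.1)
          + ∫ z, u z * (ψ z * startCutoffDeriv a n z.1) := by
      rw [← integral_add]
      · exact integral_congr_ae (Eventually.of_forall fun z => by simp only; ring)
      · exact memLp_one_iff_integrable.1 (MemLp.bdd_mul_cont (memLp_one_iff_integrable.2 iu)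
          ((contDiff_startCutoff a n).continuous.comp continuous_fst)
          fun z => abs_startCutoff_le a n z.1)
      · exact integrable_mul_of_memLp (by norm_num) hu2
          (hψ.contDiff.continuous.mul ((continuous_startCutoffDeriv a n).comp continuous_fst))
          hψ.hasCompactSupport.mul_right
    rw [← hsplit]
    exact h1
  have hL := (lu.add l0).neg.add ((tendsto_finsetSum Finset.univ fun i _ => lG i).add
    (tendsto_finsetSum Finset.univ fun i _ => lh i))
  rw [add_zero] at hL
  exact tendsto_nhds_unique (hL.congr hstep) lf

lemma integral_indicator_strip_mul {a b : ℝ} (v w : ℝ × Space d → ℝ) :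
    ∫ z, (strip d a b : Set (ℝ × Space d)).indicator v z * w z
      = ∫ z, v z * w z ∂stripMeasure d a b := by
  rw [stripMeasure, ← integral_indicator (strip d a b).isOpen.measurableSet]
  exact integral_congr_ae (Eventually.of_forall fun z => (indicator_mul_left _ _ _).symm)

lemma indicator_strip_coord {a b : ℝ} (v : ℝ × Space d → Space d) (z : ℝ × Space d) (i : Fin d) :
    (strip d a b : Set (ℝ × Space d)).indicator v z i
      = (strip d a b : Set (ℝ × Space d)).indicator (fun z => v z i) z := by
  by_cases hz : z ∈ (strip d a b : Set (ℝ × Space d))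
  · rw [indicator_of_mem hz, indicator_of_mem hz]
  · rw [indicator_of_notMem hz, indicator_of_notMem hz]; rfl

lemma stripMeasure_eq_prod (a b : ℝ) :
    stripMeasure d a b = (volume.restrict (Ioo a b)).prod (volume : Measure (Space d)) := by
  conv_rhs => rw [← Measure.restrict_univ (μ := (volume : Measure (Space d))),
    Measure.prod_restrict]
  rfl

/-- `L^∞(a, b; L²)` functions vanishing off the strip are square integrable. -/
lemma memLp_two_of_slices {a b M : ℝ} {u : ℝ × Space d → ℝ} (hu : Measurable u)
    (hu0 : ∀ z, z ∉ strip d a b → u z = 0)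
    (huM : ∀ᵐ t : ℝ, ∫⁻ x, ‖u (t, x)‖ₑ ^ 2 ≤ ENNReal.ofReal M) : MemLp u 2 volume := by
  refine ⟨hu.aestronglyMeasurable, ?_⟩
  have h : eLpNorm u 2 volume ^ 2 < ∞ := by
    rw [eLpNorm_two_sq, Measure.volume_eq_prod, lintegral_prod _ (by fun_prop)]
    calc _ ≤ ∫⁻ t, (Ioo a b).indicator (fun _ => ENNReal.ofReal M) t := by
          refine lintegral_mono_ae ?_
          filter_upwards [huM] with t ht
          by_cases hab : t ∈ Ioo a b
          · rwa [indicator_of_mem hab]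
          · have h0 : ∀ x, u (t, x) = 0 := fun x => hu0 _ fun hmem => hab hmem.1
            simp [h0]
      _ < ∞ := by
          rw [lintegral_indicator measurableSet_Ioo, setLIntegral_const]
          exact ENNReal.mul_lt_top ENNReal.ofReal_lt_top (by simp)
  exact (ENNReal.pow_lt_top_iff.1 h).resolve_right (by norm_num)

/-- Extension by zero turns a weak solution on the strip into a global solution. -/
theorem exists_isGlobalSolution {η : ℝ} {ς : ℝ≥0} {Q : Space d → Matrix (Fin d) (Fin d) ℝ}
    (hQ : IsDiffusion d η ς Q) {a b k p : ℝ} {f : ℝ × Space d → ℝ} (hk : 2 ≤ k)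
    (hf : MemLp f (ENNReal.ofReal (k / 2)) (stripMeasure d a b)) {h : ℝ × Space d → Space d}
    (hh : MemLp h (ENNReal.ofReal k) (stripMeasure d a b)) (hp : 1 ≤ p)
    {u : ℝ × Space d → ℝ} {g : ℝ × Space d → Space d} {T : DualW01 d (ENNReal.ofReal p) a b}
    (hu : MemH d (ENNReal.ofReal p) a b u g T) (hu2 : MemLinfL2 d a b u) (h0 : InitialZero d a u)
    (hab : a < b) (hsol : IsWeakSolution d (ENNReal.ofReal p) a b Q f h g T) :
    ∃ (v : ℝ × Space d → ℝ) (g' G : ℝ × Space d → Space d), v =ᵐ[stripMeasure d a b] u ∧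
      (∀ z, z ∉ strip d a b → v z = 0) ∧
      IsGlobalSolution d b η (ENNReal.ofReal p) (ENNReal.ofReal (k / 2)) (ENNReal.ofReal k) v
        ((strip d a b : Set (ℝ × Space d)).indicator f) g' G
        ((strip d a b : Set (ℝ × Space d)).indicator h) := by
  set Ω : Set (ℝ × Space d) := (strip d a b : Set (ℝ × Space d)) with hΩ
  have hΩm : MeasurableSet Ω := (strip d a b).isOpen.measurableSet
  set w := hu2.1.mk u with hw
  set v := Ω.indicator w with hv
  have hvm : Measurable v := hu2.1.stronglyMeasurable_mk.measurable.indicator hΩm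
  have hv0 : ∀ z, z ∉ strip d a b → v z = 0 := fun z hz => indicator_of_notMem hz _
  have hvu : v =ᵐ[stripMeasure d a b] u := by
    have h1 : ∀ᵐ z ∂stripMeasure d a b, z ∈ Ω := ae_restrict_mem hΩm
    filter_upwards [h1, hu2.1.ae_eq_mk] with z hz hz'
    rw [hv, indicator_of_mem hz, hz']
  have hslice : ∀ᵐ t : ℝ, t ∈ Ioo a b → ∀ᵐ x : Space d, v (t, x) = u (t, x) := by
    have h1 := hvu
    rw [stripMeasure_eq_prod] at h1
    exact (ae_restrict_iff' measurableSet_Ioo).1 (Measure.ae_ae_of_ae_prod h1)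
  set M := (essSup (fun t => eLpNorm (fun x => u (t, x)) 2 volume)
    (volume.restrict (Ioo a b))).toReal
  have hvM : ∀ᵐ t : ℝ, ∫⁻ x, ‖v (t, x)‖ₑ ^ 2 ≤ ENNReal.ofReal (M ^ 2) := by
    have h1 := (ae_restrict_iff' measurableSet_Ioo).1
      (ENNReal.ae_le_essSup (μ := volume.restrict (Ioo a b))
        fun t => eLpNorm (fun x => u (t, x)) 2 volume)
    filter_upwards [h1, hslice] with t ht hts
    by_cases htab : t ∈ Ioo a b
    · rw [← eLpNorm_two_sq (fun x => v (t, x)), eLpNorm_congr_ae (hts htab),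
        ENNReal.ofReal_pow ENNReal.toReal_nonneg, ENNReal.ofReal_toReal hu2.2.ne]
      exact pow_le_pow_left' (ht htab) 2
    · have h0 : ∀ x, v (t, x) = 0 := fun x => hv0 _ fun hmem => htab hmem.1
      simp [h0]
  have hv2 : MemLp v 2 volume := memLp_two_of_slices hvm hv0 hvM
  have hvinit : InitialZero d a v := by
    intro φ
    refine (h0 φ).congr' ?_
    have h1 : ∀ᶠ t in 𝓝[>] a ⊓ ae volume, t ∈ Ioo a b :=
      Filter.Eventually.filter_mono inf_le_left (Ioo_mem_nhdsGT hab)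
    have h2 : ∀ᶠ t in 𝓝[>] a ⊓ ae volume, t ∈ Ioo a b → ∀ᵐ x : Space d, v (t, x) = u (t, x) :=
      Filter.Eventually.filter_mono inf_le_right hslice
    filter_upwards [h1, h2] with t ht hts
    refine integral_congr_ae ?_
    filter_upwards [hts ht] with x hx
    rw [hx]
  set g' := Ω.indicator g with hg'
  set G : ℝ × Space d → Space d := fun z => WithLp.toLp 2 fun i => ∑ j, Q z.2 i j * g' z j with hG
  have hp1 : 1 ≤ ENNReal.ofReal p := by simpa using hp
  have hk1 : 1 ≤ ENNReal.ofReal k := by simp; linarith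
  have hk2 : 1 ≤ ENNReal.ofReal (k / 2) := by simp; linarith
  have hg'L : MemLp g' (ENNReal.ofReal p) volume :=
    (memLp_indicator_iff_restrict hΩm).2 hu.memLp_grad
  have hh'L : MemLp (Ω.indicator h) (ENNReal.ofReal k) volume :=
    (memLp_indicator_iff_restrict hΩm).2 hh
  have hf'L : MemLp (Ω.indicator f) (ENNReal.ofReal (k / 2)) volume :=
    (memLp_indicator_iff_restrict hΩm).2 hf
  have hGL : MemLp G (ENNReal.ofReal p) volume := by
    refine MemLp.of_eval_piLp fun i => ?_
    change MemLp (fun z => ∑ j, Q z.2 i j * g' z j) _ _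
    refine memLp_finsetSum _ fun j _ => ?_
    obtain ⟨B, hB⟩ := hQ.bounded i j
    have := MemLp.bdd_mul_cont (memLp_coord hg'L j) ((hQ.continuous i j).comp continuous_snd)
      fun z => hB z.2
    simpa only [mul_comm, Function.comp_def] using this
  have hG0 : ∀ z, z ∉ strip d a b → G z = 0 := fun z hz => by
    have : g' z = 0 := indicator_of_notMem hz _
    ext i; simp [hG, this]
  have hv_int : ∀ X : ℝ × Space d → ℝ, ∫ z, v z * X z = ∫ z, u z * X z ∂stripMeasure d a b := by
    intro X
    rw [hv, integral_indicator_strip_mul]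
    refine integral_congr_ae ?_
    filter_upwards [hu2.1.ae_eq_mk] with z hz
    rw [hw, ← hz]
  have hgrad : ∀ i ψ, IsTest univ ψ →
      ∫ z, v z * fderiv ℝ ψ z (spaceDir i) = -∫ z, g' z i * ψ z := by
    intro i ψ hψ
    have hvp : MemLp v (ENNReal.ofReal p) volume := by
      refine (memLp_indicator_iff_restrict hΩm).2 (MemLp.ae_eq ?_ hu.memLp)
      exact hu2.1.ae_eq_mk
    refine weak_spatial_of_strip hp1 hvp (memLp_coord hg'L i) hv0 (fun z hz => ?_) i
      (fun φ hφ => ?_) ψ hψ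
    · have : g' z = 0 := indicator_of_notMem hz _
      simp [this]
    · have h1 := hu.isWeakSpaceGrad
        ⟨φ, hφ.contDiff, hφ.hasCompactSupport, hφ.tsupport_subset⟩ i
      simp only [hg', indicator_strip_coord, hΩ]
      rw [hv_int, integral_indicator_strip_mul]
      exact h1
  have heq : ∀ ψ, IsTest Ω ψ → -(∫ z, v z * fderiv ℝ ψ z (1, 0))
      + ((∑ i, ∫ z, G z i * fderiv ℝ ψ z (spaceDir i))
        + ∑ i, ∫ z, -Ω.indicator h z i * fderiv ℝ ψ z (spaceDir i))
      = ∫ z, Ω.indicator f z * ψ z := by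
    intro ψ hψ
    set Ψ : TestFunction (strip d a b) ℝ ⊤ :=
      ⟨ψ, hψ.contDiff, hψ.hasCompactSupport, hψ.tsupport_subset⟩ with hΨ
    have h1 := hsol Ψ
    rw [hu.timeDeriv_eq Ψ] at h1
    have e1 : ∫ z, v z * fderiv ℝ ψ z (1, 0) = ∫ z, u z * timeDeriv Ψ z ∂stripMeasure d a b :=
      hv_int _
    have e2 : ∫ z, Ω.indicator f z * ψ z = ∫ z, f z * Ψ z ∂stripMeasure d a b :=
      integral_indicator_strip_mul f ψ
    have e3 : ∑ i, ∫ z, G z i * fderiv ℝ ψ z (spaceDir i)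
        = ∫ z, form (Q z.2) (g z) (spaceGrad Ψ z) ∂stripMeasure d a b := by
      rw [← integral_finsetSum _ fun i _ => integrable_mul_of_memLp hp1 (memLp_coord hGL i)
        (hψ.continuous_fderiv (spaceDir i)) (hψ.hasCompactSupport_fderiv (spaceDir i)),
        stripMeasure, ← integral_indicator hΩm]
      refine integral_congr_ae (Eventually.of_forall fun z => ?_)
      by_cases hz : z ∈ Ω
      · have hgz : g' z = g z := indicator_of_mem hz _
        rw [indicator_of_mem hz]
        simp only [form, hG, hgz, Finset.sum_mul]
        rfl
      · rw [indicator_of_notMem hz]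
        simp only [hG0 z hz, PiLp.zero_apply, zero_mul, Finset.sum_const_zero]
    have e4 : ∑ i, ∫ z, -Ω.indicator h z i * fderiv ℝ ψ z (spaceDir i)
        = -∫ z, inner ℝ (h z) (spaceGrad Ψ z) ∂stripMeasure d a b := by
      have ihn : ∀ i, Integrable fun z => -Ω.indicator h z i * fderiv ℝ ψ z (spaceDir i) :=
        fun i => integrable_mul_of_memLp hk1 (memLp_coord hh'L i).neg
          (hψ.continuous_fderiv (spaceDir i)) (hψ.hasCompactSupport_fderiv (spaceDir i))
      rw [← integral_finsetSum _ fun i _ => ihn i, stripMeasure, ← integral_indicator hΩm, ← integral_neg]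
      refine integral_congr_ae (Eventually.of_forall fun z => ?_)
      by_cases hz : z ∈ Ω
      · simp only [indicator_of_mem hz, PiLp.inner_apply, neg_mul,
          Finset.sum_neg_distrib]
        congr 1
        exact Finset.sum_congr rfl fun i _ => by
          exact mul_comm _ _
      · simp [indicator_of_notMem hz]
    rw [e1, e2, e3, e4]
    linarith
  refine ⟨v, g', G, hvu, hv0, ?_⟩
  exact {
    measurable := hvm
    memLp_two := hv2
    memLp_grad := hg'L
    memLp_flux := hGL
    memLp_source := hf'L
    memLp_field := hh'L
    grad := hgrad
    eq := weak_equation_of_strip hp1 hk2 hk1 hvm hv2 hGL hh'L hf'L hv0 hG0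
      (fun z hz => indicator_of_notMem hz _) (fun z hz => indicator_of_notMem hz _) hvM hvinit heq
    elliptic := fun z => by
      have h1 := hQ.elliptic z.2 (g' z)
      rw [EuclideanSpace.real_norm_sq_eq] at h1
      have e1 : ∑ i, g' z i * g' z i = ∑ i, g' z i ^ 2 := Finset.sum_congr rfl fun i _ => (sq _).symm
      rw [e1]
      refine h1.trans (le_of_eq ?_)
      simp only [form, hG, Finset.mul_sum]
      exact Finset.sum_congr rfl fun i _ => Finset.sum_congr rfl fun j _ => by ring
    zero_after := fun z hz => hv0 z fun hmem => absurd hmem.1.2 (not_lt.2 hz)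
    grad_zero_after := fun z hz => indicator_of_notMem
      (fun hmem => absurd hmem.1.2 (not_lt.2 hz)) _ }

end ZeroExtension

end

theorem mainTheorem6 (d : ℕ) (hd : 1 ≤ d) (η : ℝ) (hη : 0 < η) (k : ℝ) (hk : (d : ℝ) + 2 < k) :
    ∃ C : ℝ, 0 < C ∧
      ∀ (ς : ℝ≥0) (_ : 0 < ς) (_ : ς ≤ 1)
        (Q : Space d → Matrix (Fin d) (Fin d) ℝ) (_ : IsDiffusion d η ς Q)
        (a₀ b₀ : ℝ) (_ : 0 ≤ a₀) (_ : a₀ < b₀) (_ : b₀ ≤ 1)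
        (f : ℝ × Space d → ℝ) (_ : MemLp f (ENNReal.ofReal (k / 2)) (stripMeasure d a₀ b₀))
        (h : ℝ × Space d → Space d) (_ : MemLp h (ENNReal.ofReal k) (stripMeasure d a₀ b₀))
        (p : ℝ) (_ : (d : ℝ) + 2 < p)
        (u : ℝ × Space d → ℝ) (g : ℝ × Space d → Space d)
        (T : DualW01 d (ENNReal.ofReal p) a₀ b₀)
        (_ : MemH d (ENNReal.ofReal p) a₀ b₀ u g T)
        (_ : MemLinfL2 d a₀ b₀ u)
        (_ : InitialZero d a₀ u)
        (_ : IsWeakSolution d (ENNReal.ofReal p) a₀ b₀ Q f h g T),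
        MemLp u ∞ (stripMeasure d a₀ b₀) ∧
          eLpNorm u ∞ (stripMeasure d a₀ b₀) ≤
            ENNReal.ofReal C *
              (eLpNorm u 2 (stripMeasure d a₀ b₀)
                + eLpNorm f (ENNReal.ofReal (k / 2)) (stripMeasure d a₀ b₀)
                + eLpNorm h (ENNReal.ofReal k) (stripMeasure d a₀ b₀)) := by
  obtain ⟨M, hM1, hM⟩ := exists_ae_le_two_mul d hd η hη k hk
  have hd0 : (1 : ℝ) ≤ d := by exact_mod_cast hd
  refine ⟨2 * M, by linarith, ?_⟩
  intro ς _ _ Q hQ a b _ hab _ f hf h hh p hp u g T hu hu2 h0 hsol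
  obtain ⟨v, g', G, hvu, hv0, H⟩ := exists_isGlobalSolution hQ (by linarith) hf hh (by linarith)
    hu hu2 h0 hab hsol
  have hΩm : MeasurableSet (strip d a b : Set (ℝ × Space d)) := (strip d a b).isOpen.measurableSet
  have hN : eLpNorm v 2 volume = eLpNorm u 2 (stripMeasure d a b) := by
    have : v = (strip d a b : Set (ℝ × Space d)).indicator v :=
      (indicator_eq_self.2 fun z hz => by
        by_contra hn
        exact hz (hv0 z hn)).symm
    rw [this, eLpNorm_indicator_eq_eLpNorm_restrict hΩm]
    exact eLpNorm_congr_ae hvu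
  have hF := eLpNorm_indicator_eq_eLpNorm_restrict (p := ENNReal.ofReal (k / 2)) (f := f)
    (μ := volume) hΩm
  have hH := eLpNorm_indicator_eq_eLpNorm_restrict (p := ENNReal.ofReal k) (f := h)
    (μ := volume) hΩm
  change _ = eLpNorm f _ (stripMeasure d a b) at hF
  change _ = eLpNorm h _ (stripMeasure d a b) at hH
  have hNt := H.memLp_two.2.ne
  rw [hN] at hNt
  set N := (eLpNorm u 2 (stripMeasure d a b)).toReal with hNdef
  set F := (eLpNorm f (ENNReal.ofReal (k / 2)) (stripMeasure d a b)).toReal with hFdef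
  set W := (eLpNorm h (ENNReal.ofReal k) (stripMeasure d a b)).toReal with hWdef
  have hN0 : 0 ≤ N := ENNReal.toReal_nonneg
  have hF0 : 0 ≤ F := ENNReal.toReal_nonneg
  have hW0 : 0 ≤ W := ENNReal.toReal_nonneg
  have hMN : 0 ≤ M * N := by positivity
  set K := M * N + F + W with hK
  have hbound : ∀ᵐ z, |v z| ≤ 2 * K := by
    rcases (show 0 ≤ K by positivity).eq_or_lt with hK0 | hK0
    · -- If all norms vanish, then `u = 0` because its `L²` norm does.
      have hN00 : N = 0 := by nlinarith
      have h1 : eLpNorm v 2 volume = 0 := by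
        rw [hN]; exact ((ENNReal.toReal_eq_zero_iff _).1 hN00).resolve_right hNt
      have h2 := (eLpNorm_eq_zero_iff H.memLp_two.1 (by norm_num)).1 h1
      filter_upwards [h2] with z hz
      rw [hz, Pi.zero_apply, abs_zero, ← hK0, mul_zero]
    · have h1 := hM b p v _ g' G _ K H (by linarith) hK0 (by rw [hF]; linarith)
        (by rw [hH]; linarith) (by rw [hN]; linarith)
      have h2 := hM b p (-v) _ (-g') (-G) _ K H.neg (by linarith) hK0
        (by rw [eLpNorm_neg, hF]; linarith) (by rw [eLpNorm_neg, hH]; linarith)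
        (by rw [eLpNorm_neg, hN]; linarith)
      filter_upwards [h1, h2] with z hz1 hz2
      rw [Pi.neg_apply] at hz2
      exact abs_le.2 ⟨by linarith, hz1⟩
  have hbu : ∀ᵐ z ∂stripMeasure d a b, ‖u z‖ ≤ 2 * K := by
    filter_upwards [ae_restrict_of_ae hbound, hvu] with z hz hz'
    rw [← hz', Real.norm_eq_abs]; exact hz
  refine ⟨memLp_top_of_bound hu2.1 _ hbu, ?_⟩
  rw [eLpNorm_exponent_top]
  refine (eLpNormEssSup_le_of_ae_bound hbu).trans ?_
  rw [← ENNReal.ofReal_toReal hNt, ← ENNReal.ofReal_toReal hf.2.ne,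
    ← ENNReal.ofReal_toReal hh.2.ne, ← hNdef, ← hFdef, ← hWdef, ← ENNReal.ofReal_add hN0 hF0,
    ← ENNReal.ofReal_add (by positivity) hW0, ← ENNReal.ofReal_mul (by positivity)]
  refine ENNReal.ofReal_le_ofReal ?_
  rw [hK]
  nlinarith
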